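/- **Setting.** $M$ and $B$ are the sizes (in records) of main memory and of a disk block, $m=M/B\ge 4$, $B\ge 1$, $q=\lfloor\sqrt m\rfloor$, $0<\varepsilon\le 1$, and $r=\lfloor\log_q(1/\varepsilon)\rfloor$. Keys come from a linearly ordered set, and elements are identified with their keys. The cost of an operation is the number of block transfers it performs. **The data structure.** An *external memory soft heap* (EMSH) with error rate $\varepsilon$ is a forest on disk in which the children of a node of rank $k$ have rank $k-1$, a non-leaf has at most $q$ children, and there are at most $q-1$ roots of each rank. Nodes of rank at most $r$ (pnodes) hold a sorted array of at most $Bq$ elements. Nodes of rank greater than $r$ (cnodes) hold a list of listnodes with at most $Bq$ elements each (all but the last with at least $Bq/2$) and a common ckey; an element of the list that is smaller than the ckey is *corrupt*. Let $s_{r+1}=2$ and $s_k=\lceil\frac32 s_{k-1}\rceil$ for $k>r+1$. A non-leaf satisfies its invariant if it holds at least $Bq/2$ elements (pnode), or at least $\lfloor s_k/2\rfloor+1$ listnodes (cnode of rank $k$). An insert buffer for $Bq$ elements, and for each rank a bucket, are kept; of the elements of a bucket at most one block is in main memory. The buffers, the bookkeeping of the buckets and these blocks are accessed without I/O. - *Sift*$(x)$,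 invoked on a non-leaf $x$ that fails its invariant. A pnode receives the smallest $Bq/2$ elements of its children (all of them if there are fewer) by a multi-way merge. A cnode of rank $r+1$ does so once if it has a listnode left and twice otherwise, stores these elements in listnodes, and its ckey becomes the largest key in its list. A cnode of rank $k>r+1$ repeatedly takes over the list and the ckey of its child with the smallest ckey, until it has $s_k$ listnodes or the lists of all its children are empty. Children that thereby fail their invariants are sifted recursively, and emptied leaves are removed. - *Fill-Up* of an empty bucket sifts the roots of its rank that fail their invariants, and then moves into the bucket the smallest $Bq/2$ elements of these roots (rank $\le r$), or one listnode, not the last unless it is the only one, of the root with the smallest ckey (rank $>r$). - *Insert* puts the element into the buffer; a full buffer becomes a new tree of rank $0$, which is melded with the heap. - *Meld* unites the buffers (making a tree of rank $0$ of $Bq$ elements if there are so many) and adds the two sequences of buckets like numbers in radix $q$. Where at least two of the two buckets and the carry-in meet, the bucket elements are sent back to their roots, roots failing their invariants are sifted, and, if there are at least $q$ roots, $q$ of them become the children of a new root of the next rank, which is sifted and carried; buckets that are empty are filled up. - *Findmin* returns, and *Deletemin* deletes and returns, the smallest element of the buffer if it is smaller than the minkeys of all buckets, and otherwise the first element of a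 bucket with the smallest minkey (its first element if its rank is $\le r$, the ckey of the root this element came from otherwise). When the block of the bucket in memory is exhausted, the next block is loaded; when the bucket is empty, it is filled up. **Amortised cost.** Consider the heaps that arise from empty heaps by these operations. Amortised costs are bounded by given numbers if there is a real-valued potential that is non-negative on these heaps and $0$ on the empty heap, such that for each operation the actual number of I/Os plus the increase of the total potential of the heaps involved is at most the number given for it. **Claim.** There is an absolute constant $C>0$ such that for all $M,B,\varepsilon$ as above: 1. In EMSH, Insert has amortised cost at most $\frac CB\max\{1,\log_m\frac1\varepsilon\}$ (hence $O(\frac1B\log_m\frac1\varepsilon)$ if, say, $\varepsilon\le 1/\sqrt m$), and Findmin, Deletemin and Meld have non-positive amortised costs. 2. Let $N\ge1$ and $\varepsilon<1/N$, and consider only heaps into which (together with the heaps melded into them) at most $N$ elements have been inserted. Then no element is ever corrupt, and EMSH is an exact meldable priority queue (the "hard heap"): Insert adds the given element to the multiset of elements, Meld forms the sum of the two multisets, Findmin returns a smallest element, and Deletemin returns and removes a smallest element (both return nothing exactly if the heap is empty). If moreover $N\ge B$, then for these heaps Insert has amortised cost at most $\frac CB\log_m\frac NB$, and Findmin, Deletemin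 and Meld have non-positive amortised costs. -/

import Mathlib

/-!
External memory soft heap (EMSH): the data structure, its operations, and the
number of block transfers that each operation performs.

Every procedure returns its result together with the number of I/Os it performs.
The insert buffer and, for each bucket, its root pointers and at most one block
of its elements reside in main memory and are accessed for free; everything else
is on disk, in blocks of `B` records.
-/

universe u

namespace EMSH

/-- The parameters of the structure: the block size `B`, the branching factor `q` (the
integer `⌊√m⌋`, with `m = M / B`), and the largest rank `r` of a pnode. -/
structure Params where
  B : ℕ
  q : ℕ
  r : ℕ

/-- The parameters for main memory size `M`, block size `B` and error rate `ε`: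
a node is a pnode if its rank is at most `log_q (1/ε)`. -/
noncomputable def params (M B : ℕ) (ε : ℝ) : Params where
  B := B
  q := Nat.sqrt (M / B)
  r := ⌊Real.logb (Nat.sqrt (M / B)) (1 / ε)⌋₊

/-- The capacity of arrays, listnodes and the insert buffer: `B * q`. -/
def Params.full (P : Params) : ℕ := P.B * P.q

/-- `B * q / 2`, rounded up. -/
def Params.half (P : Params) : ℕ := (P.B * P.q + 1) / 2

/-- `2, 3, 5, 8, 12, …`, each term being `⌈3/2 · previous⌉`. -/
def sAux : ℕ → ℕ
  | 0 => 2
  | j + 1 => (3 * sAux j + 1) / 2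

/-- The numbers `s_k`. -/
def Params.s (P : Params) (k : ℕ) : ℕ := if k ≤ P.r then 0 else sAux (k - (P.r + 1))

/-- The largest number of blocks that `n` consecutively stored records can meet (they need
not be aligned with block boundaries): `⌈(n - 1) / B⌉ + 1` if `n > 0`. -/
def Params.blocks (P : Params) (n : ℕ) : ℕ := if n = 0 then 0 else (n + P.B - 2) / P.B + 1

/-- A tree node. If it is a pnode, `arr` is its sorted array. If it is a cnode, `lists` is its
list of listnodes, and `ckey` its ckey (`⊥` as long as it has not been given one). -/
structure Node (α : Type u) where
  rank : ℕ
  arr : List α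
  lists : List (List α)
  ckey : WithBot α
  kids : List (Node α)

/-- The bucket of the roots of one rank. Its elements are those in `mem` (the block in main
memory) followed by those in `disk`. They have been physically removed from the roots; each is
stored with the position, in `roots`, of the root that it was taken from. -/
structure Bucket (α : Type u) where
  roots : List (Node α)
  mem : List (α × ℕ)
  disk : List (α × ℕ)

/-- A heap: the sorted insert buffer, and the list of buckets by rank
(`none` if there is no bucket of that rank). -/
structure Heap (α : Type u) where
  buffer : List α
  buckets : List (Option (Bucket α))

/-! ### Nodes -/

mutual
/-- All elements in the subtree of a node. -/
def Node.elems {α : Type u} : Node α → List α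
  | ⟨_, arr, lists, _, kids⟩ => arr ++ lists.flatten ++ elemsAll kids
/-- All elements in a list of subtrees. -/
def elemsAll {α : Type u} : List (Node α) → List α
  | [] => []
  | x :: xs => x.elems ++ elemsAll xs
end

mutual
/-- The corrupt elements in the subtree of a node: those that belong to the list of a cnode
whose ckey exceeds them. -/
def Node.corrupt {α : Type u} [LinearOrder α] : Node α → List α
  | ⟨_, _, lists, ckey, kids⟩ => lists.flatten.filter (fun a : α => decide ((a : WithBot α) < ckey)) ++
      corruptAll kids
/-- The corrupt elements in a list of subtrees. -/
def corruptAll {α : Type u} [LinearOrder α] : List (Node α) → List α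
  | [] => []
  | x :: xs => x.corrupt ++ corruptAll xs
end

/-- A leaf that holds no element. -/
def Node.isDead {α : Type u} (x : Node α) : Bool :=
  x.kids.isEmpty && x.arr.isEmpty && x.lists.isEmpty

/-- Does a node fail its invariant? A leaf never does. A pnode that is not a leaf has to hold at
least `B q / 2` elements, and a cnode of rank `k` that is not a leaf at least `⌊s_k / 2⌋ + 1`
listnodes. (The upper bound `B q` on sizes is never exceeded by the operations.) -/
def Node.violates {α : Type u} (P : Params) (x : Node α) : Bool :=
  !x.kids.isEmpty &&
    (if x.rank ≤ P.r then decide (x.arr.length < P.half)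
     else decide (x.lists.length < P.s x.rank / 2 + 1))

/-- A node with the smallest ckey, with its position. -/
def minCkey {α : Type u} [LinearOrder α] : List (Node α) → Option (ℕ × Node α)
  | [] => none
  | x :: xs =>
    match minCkey xs with
    | none => some (0, x)
    | some (j, y) => if x.ckey ≤ y.ckey then some (0, x) else some (j + 1, y)

/-! ### Extract and Sift -/

/-- Remove a smallest element from the sorted arrays of the given nodes; it is returned with the
position of the node that it was taken from. -/
def popMin {α : Type u} [LinearOrder α] : List (Node α) → Option ((α × ℕ) × List (Node α))
  | [] => none
  | x :: xs =>
    match x.arr, popMin xs with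
    | [], none => none
    | [], some ((b, j), ys) => some ((b, j + 1), x :: ys)
    | a :: as, none => some ((a, 0), { x with arr := as } :: xs)
    | a :: as, some ((b, j), ys) =>
      if a ≤ b then some ((a, 0), { x with arr := as } :: xs) else some ((b, j + 1), x :: ys)

/-- The multi-way merge: remove the `min t N` smallest elements from the sorted arrays of the
given nodes, which hold `N` elements together. They are returned in sorted order. -/
def extract {α : Type u} [LinearOrder α] : ℕ → List (Node α) → List (α × ℕ) × List (Node α)
  | 0, xs => ([], xs)
  | t + 1, xs =>
    match popMin xs with
    | none => ([], xs)
    | some (a, ys) =>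
      let e := extract t ys
      (a :: e.1, e.2)

/-- The I/Os for reading in a multi-way merge that turns the nodes `xs` into `ys`: the record of
each node is read and written, and the blocks are read that contain the elements taken from its
array and the one that follows these. -/
def mergeCost {α : Type u} (P : Params) (xs ys : List (Node α)) : ℕ :=
  (List.zipWith (fun x y =>
    2 + P.blocks (min (x.arr.length - y.arr.length + 1) x.arr.length)) xs ys).sum

/-- Read the record of each of the given nodes, apply `f` to those that fail their invariant,
and remove the empty leaves. -/
def restoreWith {α : Type u} (P : Params) (f : Node α → Node α × ℕ) (xs : List (Node α)) :
    List (Node α) × ℕ :=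
  let t := xs.map (fun y => if y.violates P then f y else (y, 0))
  ((t.map Prod.fst).filter (fun y => !y.isDead), (t.map (fun p => 2 + p.2)).sum)

/-- Extract the smallest `B q / 2` elements (or all, if there are fewer) from the children of
`x`, and apply `f` to the children that fail their invariant thereafter. The result consists of
the extracted elements, the new `x` (the extracted elements not yet being stored in it), and the
number of I/Os, including those for writing the extracted elements. -/
def pull {α : Type u} [LinearOrder α] (P : Params) (f : Node α → Node α × ℕ) (x : Node α) :
    List α × Node α × ℕ :=
  let e := extract P.half x.kids
  let k := restoreWith P f e.2
  (e.1.map Prod.fst, { x with kids := k.1 },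
    2 + 2 * P.blocks x.kids.length + mergeCost P x.kids e.2 + P.blocks e.1.length + k.2)

/-- Sift at a pnode. -/
def siftPnode {α : Type u} [LinearOrder α] (P : Params) (f : Node α → Node α × ℕ) (x : Node α) :
    Node α × ℕ :=
  let p := pull P f x
  ({ p.2.1 with arr := p.2.1.arr ++ p.1 }, p.2.2)

/-- The largest of the keys present in a list of listnodes. -/
def maxKey {α : Type u} [LinearOrder α] (lists : List (List α)) : WithBot α :=
  lists.flatten.foldr (fun a b => max (a : WithBot α) b) ⊥

/-- Sift at a cnode `x` of rank `r + 1`. If `x` has no listnode left, extract twice and store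
the elements in one or two new listnodes; otherwise `x` has one listnode `l`; extract once and add
the elements `e`, as a listnode in front of `l`, or merged into `l`, or as a listnode after `l` from
which `l` is replenished. -/
def siftBase {α : Type u} [LinearOrder α] (P : Params) (f : Node α → Node α × ℕ) (x : Node α) :
    Node α × ℕ :=
  let p₁ := pull P f x
  match x.lists with
  | [] =>
    let p₂ := if p₁.2.1.kids.isEmpty then ([], p₁.2.1, 0) else pull P f p₁.2.1
    let e := p₁.1 ++ p₂.1
    let ls := if e.length ≤ P.half then [e] else [e.take P.half, e.drop P.half]
    ({ p₂.2.1 with lists := ls, ckey := maxKey ls }, p₁.2.2 + p₂.2.2 + 4)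
  | l :: rest =>
    let e := p₁.1
    let ls :=
      if e.length = P.half then e :: l :: rest
      else if l.length + e.length ≤ P.half then (l ++ e) :: rest
      else (l ++ e.take (P.half - l.length)) :: e.drop (P.half - l.length) :: rest
    ({ p₁.2.1 with lists := ls, ckey := maxKey ls },
      p₁.2.2 + 2 * P.blocks l.length + 2 * P.blocks e.length + 4)

/-- The two lists, of `x` and of its child `y`, become one, in which all but the last listnode
have at least `B q / 2` elements: the two last listnodes are merged if they hold at most
`B q` elements together; otherwise at least one of them is large enough to precede others. -/
def joinLists {α : Type u} (P : Params) (lx ly : List (List α)) : List (List α) :=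
  match lx.getLast?, ly.getLast? with
  | some a, some b =>
    if a.length + b.length ≤ P.full then lx.dropLast ++ ly.dropLast ++ [a ++ b]
    else if P.half ≤ a.length then lx ++ ly
    else lx.dropLast ++ ly ++ [a]
  | _, _ => lx ++ ly

/-- The I/Os of `joinLists`: the elements of two last listnodes are read and written if they are
merged, and a constant number of records of nodes and listnodes are read, relinked, and written. -/
def joinCost {α : Type u} (P : Params) (lx ly : List (List α)) : ℕ :=
  match lx.getLast?, ly.getLast? with
  | some a, some b =>
    if a.length + b.length ≤ P.full then
      P.blocks a.length + P.blocks b.length + P.blocks (a.length + b.length) + 10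
    else 10
  | _, _ => 10

/-- The loop of Sift at a cnode `x` of rank greater than `r + 1`. While `x` has fewer than `s_k`
listnodes, and not all children have empty lists, the child `y` with the smallest ckey gives its
list and its ckey to `x`; then `y` is sifted by `f`, or, if it is a leaf, removed. The first argument
bounds the number of rounds. -/
def siftLoop {α : Type u} [LinearOrder α] (P : Params) (f : Node α → Node α × ℕ) :
    ℕ → Node α → Node α × ℕ
  | 0, x => (x, 0)
  | n + 1, x =>
    if P.s x.rank ≤ x.lists.length || x.kids.all (fun y => y.lists.isEmpty) then (x, 0)
    else
      match minCkey x.kids with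
      | none => (x, 0)
      | some (j, y) =>
        let s :=
          if y.kids.isEmpty then (x.kids.eraseIdx j, 0)
          else
            let u := f { y with lists := [] }
            (x.kids.set j u.1, u.2)
        let t := siftLoop P f n
          { x with lists := joinLists P x.lists y.lists, ckey := y.ckey, kids := s.1 }
        (t.1, 2 * P.blocks x.kids.length + x.kids.length + joinCost P x.lists y.lists + s.2 + t.2)

/-- Sift at a node of rank `k`. Each round of the loop moves at least one element from below `x`
into `x`, so that the number of elements below `x` is no restriction on the number of rounds. -/
def siftAt {α : Type u} [LinearOrder α] (P : Params) : ℕ → Node α → Node α × ℕ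
  | 0, x => (x, 0)
  | k + 1, x =>
    if k + 1 ≤ P.r then siftPnode P (siftAt P k) x
    else if k = P.r then siftBase P (siftAt P k) x
    else siftLoop P (siftAt P k) (elemsAll x.kids).length x

/-- Sift. -/
def sift {α : Type u} [LinearOrder α] (P : Params) (x : Node α) : Node α × ℕ :=
  siftAt P x.rank x

/-- Sift those of the given roots that fail their invariants, and remove the empty leaves. -/
def restore {α : Type u} [LinearOrder α] (P : Params) (xs : List (Node α)) :
    List (Node α) × ℕ :=
  restoreWith P (sift P) xs

/-! ### Buckets -/

/-- A bucket that has just been given the elements `es`: its first block is loaded. -/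
def mkBucket {α : Type u} (P : Params) (roots : List (Node α)) (es : List (α × ℕ)) : Bucket α :=
  ⟨roots, es.take P.B, es.drop P.B⟩

/-- Fill-Up of the empty bucket of rank `i` with the given roots. The bucket ceases to exist if
there is no root with an element left. For `i ≤ r`, the bucket receives the smallest `B q / 2`
elements of the roots (or all, if there are fewer). For `i > r`, it receives a listnode of the root
with the smallest ckey, not the last one unless it is the only one. -/
def fillUp {α : Type u} [LinearOrder α] (P : Params) (i : ℕ) (roots : List (Node α)) :
    Option (Bucket α) × ℕ :=
  let t := restore P roots
  if i ≤ P.r then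
    if t.1.isEmpty then (none, t.2)
    else
      let e := extract P.half t.1
      (some (mkBucket P e.2 e.1), t.2 + mergeCost P t.1 e.2 + P.blocks e.1.length + 1)
  else
    match minCkey t.1 with
    | none => (none, t.2)
    | some (j, y) =>
      let l := y.lists.headD []
      (some (mkBucket P (t.1.set j { y with lists := y.lists.tail }) (l.map (fun a => (a, j)))),
        t.2 + 2 * P.blocks l.length + 5)

/-- Put elements `es` that were taken from the list `ls` of a root back: they are merged
into the last listnode if both are small, and form a listnode of their own otherwise. -/
def putBack {α : Type u} (P : Params) (es : List α) (ls : List (List α)) : List (List α) :=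
  match ls.getLast? with
  | none => [es]
  | some l =>
    if es.length < P.half ∧ l.length < P.half then ls.dropLast ++ [l ++ es]
    else if P.half ≤ es.length then es :: ls
    else ls ++ [es]

/-- Send the elements of the bucket of rank `i` back to the roots that they were taken from.
For `i ≤ r` they are written in front of the arrays; for `i > r` they have all been taken from the
same root. -/
def flush {α : Type u} (P : Params) (i : ℕ) (b : Bucket α) : List (Node α) × ℕ :=
  let es := b.mem ++ b.disk
  if i ≤ P.r then
    (b.roots.mapIdx (fun j x =>
        { x with arr := (es.filter (fun e => e.2 = j)).map Prod.fst ++ x.arr }),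
      P.blocks b.disk.length + ((List.range b.roots.length).map (fun j =>
        2 + P.blocks (es.filter (fun e => e.2 = j)).length)).sum)
  else
    match es with
    | [] => (b.roots, 0)
    | (_, j) :: _ =>
      (b.roots.modify j (fun x => { x with lists := putBack P (es.map Prod.fst) x.lists }),
        P.blocks b.disk.length + P.blocks es.length +
          2 * P.blocks (((b.roots[j]?.map Node.lists).getD []).getLastD []).length + 6)

/-- The minkey of the bucket of rank `i`: its first element if `i ≤ r`, and the ckey of the root
that this element was taken from if `i > r`. -/
def Bucket.minkey {α : Type u} (P : Params) (i : ℕ) (b : Bucket α) : WithBot α :=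
  match b.mem with
  | [] => ⊥
  | (a, j) :: _ => if i ≤ P.r then (a : WithBot α) else (b.roots[j]?.map Node.ckey).getD ⊥

/-- The bucket with the smallest minkey (the one that `suffixmin[0]` points to), with its rank,
in a list of buckets of which the first has rank `i`. -/
def minBucket {α : Type u} [LinearOrder α] (P : Params) :
    ℕ → List (Option (Bucket α)) → Option (ℕ × Bucket α)
  | _, [] => none
  | i, none :: bs => minBucket P (i + 1) bs
  | i, some b :: bs =>
    match minBucket P (i + 1) bs with
    | none => some (i, b)
    | some (j, c) => if b.minkey P i ≤ c.minkey P j then some (i, b) else some (j, c)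

/-! ### The operations on heaps -/

/-- The empty heap. -/
def Heap.empty (α : Type u) : Heap α := ⟨[], []⟩

/-- The bucket of rank `0`, still empty, of a single new tree that holds the elements `l`. -/
def newTree {α : Type u} (l : List α) : Bucket α := ⟨[⟨0, l, [], ⊥, []⟩], [], []⟩

/-- The I/Os for writing a new tree of rank `0` with `n` elements. -/
def newTreeCost (P : Params) (n : ℕ) : ℕ := P.blocks n + 1

/-- The work of Meld at position `i`, on those that exist of the two buckets of rank `i` and the
carry-in. The result consists of the new bucket of rank `i`, the carry-out, and the
number of I/Os. -/
def meldStep {α : Type u} [LinearOrder α] (P : Params) (i : ℕ) (bs : List (Bucket α)) :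
    Option (Bucket α) × Option (Bucket α) × ℕ :=
  match bs with
  | [] => (none, none, 0)
  | [b] =>
    if b.mem.isEmpty then
      let u := fillUp P i b.roots
      (u.1, none, u.2)
    else (some b, none, 0)
  | bs =>
    let fs := bs.map (flush P i)
    let c := (fs.map Prod.snd).sum
    let t := restore P (fs.flatMap Prod.fst)
    if t.1.length < P.q then
      let u := fillUp P i t.1
      (u.1, none, c + t.2 + u.2)
    else
      let x := sift P ⟨i + 1, [], [], ⊥, t.1.take P.q⟩
      let u := fillUp P i (t.1.drop P.q)
      (u.1, some ⟨[x.1], [], []⟩, c + t.2 + (1 + P.blocks P.q) + x.2 + u.2)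

/-- The loop of Meld over `n` positions from `i` on, with carry-in `c`. -/
def meldLoop {α : Type u} [LinearOrder α] (P : Params) (b₁ b₂ : List (Option (Bucket α))) :
    ℕ → ℕ → Option (Bucket α) → List (Option (Bucket α)) × ℕ
  | 0, _, _ => ([], 0)
  | n + 1, i, c =>
    let t := meldStep P i ((b₁.getD i none).toList ++ (b₂.getD i none).toList ++ c.toList)
    let u := meldLoop P b₁ b₂ n (i + 1) t.2.1
    (t.1 :: u.1, t.2.2 + u.2)

/-- Meld: the resulting heap and the number of I/Os. -/
def meld {α : Type u} [LinearOrder α] (P : Params) (H₁ H₂ : Heap α) : Heap α × ℕ :=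
  let buf := List.merge H₁.buffer H₂.buffer (fun a b => decide (a ≤ b))
  let n := max H₁.buckets.length H₂.buckets.length + 1
  if buf.length < P.full then
    let t := meldLoop P H₁.buckets H₂.buckets n 0 none
    (⟨buf, t.1⟩, t.2)
  else
    let t := meldLoop P H₁.buckets H₂.buckets n 0 (some (newTree (buf.take P.full)))
    (⟨buf.drop P.full, t.1⟩, newTreeCost P P.full + t.2)

/-- Insert: the resulting heap and the number of I/Os. -/
def insert {α : Type u} [LinearOrder α] (P : Params) (a : α) (H : Heap α) : Heap α × ℕ :=
  let buf := H.buffer.orderedInsert (· ≤ ·) a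
  if buf.length < P.full then (⟨buf, H.buckets⟩, 0)
  else
    let t := meld P ⟨[], H.buckets⟩ ⟨[], [some (newTree buf)]⟩
    (t.1, newTreeCost P buf.length + t.2)

/-- Findmin: the element that a Deletemin would return (`none` if there is none), and the
number of I/Os, which is `0` because only the insert buffer and the loaded blocks are consulted. -/
def findmin {α : Type u} [LinearOrder α] (P : Params) (H : Heap α) : Option α × ℕ :=
  match minBucket P 0 H.buckets, H.buffer with
  | none, buf => (buf.head?, 0)
  | some (_, b), [] => (b.mem.head?.map Prod.fst, 0)
  | some (i, b), e :: _ =>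
    if (e : WithBot α) < b.minkey P i then (some e, 0) else (b.mem.head?.map Prod.fst, 0)

/-- Delete the first element of the bucket `b` of rank `i`. If no element of the block in memory
is left, the next block is loaded, or the bucket is filled up if it has become empty. -/
def Bucket.deleteHead {α : Type u} [LinearOrder α] (P : Params) (i : ℕ) (b : Bucket α) :
    Option (Bucket α) × ℕ :=
  if !b.mem.tail.isEmpty then (some { b with mem := b.mem.tail }, 0)
  else if !b.disk.isEmpty then (some (mkBucket P b.roots b.disk), 1)
  else fillUp P i b.roots

/-- Deletemin: the element returned, the resulting heap, and the number of I/Os. -/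
def deletemin {α : Type u} [LinearOrder α] (P : Params) (H : Heap α) :
    Option α × Heap α × ℕ :=
  match minBucket P 0 H.buckets, H.buffer with
  | none, buf => (buf.head?, ⟨buf.tail, H.buckets⟩, 0)
  | some (i, b), [] =>
    let t := b.deleteHead P i
    (b.mem.head?.map Prod.fst, ⟨[], H.buckets.set i t.1⟩, t.2)
  | some (i, b), e :: buf =>
    if (e : WithBot α) < b.minkey P i then (some e, ⟨buf, H.buckets⟩, 0)
    else
      let t := b.deleteHead P i
      (b.mem.head?.map Prod.fst, ⟨e :: buf, H.buckets.set i t.1⟩, t.2)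

/-- `Reach P n H`: the heap `H` can be produced from empty heaps by the operations, with
`n` elements having been inserted into it and the heaps melded into it. -/
inductive Reach {α : Type u} [LinearOrder α] (P : Params) : ℕ → Heap α → Prop
  | empty : Reach P 0 (Heap.empty α)
  | insert {n : ℕ} {H : Heap α} (a : α) (h : Reach P n H) : Reach P (n + 1) (insert P a H).1
  | deletemin {n : ℕ} {H : Heap α} (h : Reach P n H) : Reach P n (deletemin P H).2.1
  | meld {n₁ n₂ : ℕ} {H₁ H₂ : Heap α} (h₁ : Reach P n₁ H₁) (h₂ : Reach P n₂ H₂) :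
      Reach P (n₁ + n₂) (meld P H₁ H₂).1

/-- The elements in a bucket and its trees. -/
def Bucket.elems {α : Type u} (b : Bucket α) : List α :=
  (b.mem ++ b.disk).map Prod.fst ++ elemsAll b.roots

/-- The corrupt elements in the bucket of rank `i` and its trees. (The ckey of an element
in a bucket with `i > r` is that of the root that it was taken from.) -/
def Bucket.corrupt {α : Type u} [LinearOrder α] (P : Params) (i : ℕ) (b : Bucket α) : List α :=
  (if i ≤ P.r then [] else
    ((b.mem ++ b.disk).filter
      (fun e => (e.1 : WithBot α) < (b.roots[e.2]?.map Node.ckey).getD ⊥)).map Prod.fst) ++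
    corruptAll b.roots

/-- The elements in a heap. -/
def Heap.contents {α : Type u} (H : Heap α) : Multiset α :=
  (H.buffer : Multiset α) + (H.buckets.flatMap (fun b => (b.map Bucket.elems).getD []) : List α)

/-- The corrupt elements in a heap. -/
def Heap.corrupt {α : Type u} [LinearOrder α] (P : Params) (H : Heap α) : Multiset α :=
  (H.buckets.mapIdx (fun i b => (b.map (Bucket.corrupt P i)).getD [])).flatten

/-! ### Amortised costs and exactness -/

/-- For heaps into which at most `N` elements are inserted, the amortised number of I/Os of an
Insert is at most `c`, and those of Findmin, Deletemin and Meld are non-positive: there is a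
non-negative potential, vanishing on the empty heap, such that the actual cost of an
operation plus the increase of the total potential caused by it obeys these bounds. -/
def AmortisedCosts (α : Type u) [LinearOrder α] (P : Params) (N : ℕ∞) (c : ℝ) : Prop :=
  ∃ Φ : Heap α → ℝ,
    Φ (Heap.empty α) = 0 ∧
    (∀ (n : ℕ) (H : Heap α), Reach P n H → (n : ℕ∞) ≤ N → 0 ≤ Φ H) ∧
    (∀ (n : ℕ) (H : Heap α) (a : α), Reach P n H → ((n + 1 : ℕ) : ℕ∞) ≤ N →
      ((insert P a H).2 : ℝ) + (Φ (insert P a H).1 - Φ H) ≤ c) ∧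
    (∀ (n : ℕ) (H : Heap α), Reach P n H → (n : ℕ∞) ≤ N →
      ((findmin P H).2 : ℝ) + (Φ H - Φ H) ≤ 0) ∧
    (∀ (n : ℕ) (H : Heap α), Reach P n H → (n : ℕ∞) ≤ N →
      ((deletemin P H).2.2 : ℝ) + (Φ (deletemin P H).2.1 - Φ H) ≤ 0) ∧
    (∀ (n₁ n₂ : ℕ) (H₁ H₂ : Heap α), Reach P n₁ H₁ → Reach P n₂ H₂ →
      ((n₁ + n₂ : ℕ) : ℕ∞) ≤ N →
      ((meld P H₁ H₂).2 : ℝ) + (Φ (meld P H₁ H₂).1 - (Φ H₁ + Φ H₂)) ≤ 0)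

/-- `o` is a smallest element of `S`, or `none` if `S` is empty. -/
def IsMinOf {α : Type u} [LinearOrder α] (S : Multiset α) (o : Option α) : Prop :=
  (o = none ∧ S = 0) ∨ ∃ a, o = some a ∧ a ∈ S ∧ ∀ b ∈ S, a ≤ b

/-- Heaps into which at most `N` elements are inserted have no corrupt elements, and
their operations are those of an exact meldable priority queue. -/
def ExactPriorityQueue (α : Type u) [LinearOrder α] (P : Params) (N : ℕ) : Prop :=
  (Heap.empty α).contents = 0 ∧
  (∀ (n : ℕ) (H : Heap α), Reach P n H → n ≤ N → H.corrupt P = 0) ∧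
  (∀ (n : ℕ) (H : Heap α) (a : α), Reach P n H → n + 1 ≤ N →
    (insert P a H).1.contents = a ::ₘ H.contents) ∧
  (∀ (n : ℕ) (H : Heap α), Reach P n H → n ≤ N → IsMinOf H.contents (findmin P H).1) ∧
  (∀ (n : ℕ) (H : Heap α), Reach P n H → n ≤ N →
    IsMinOf H.contents (deletemin P H).1 ∧
    (deletemin P H).2.1.contents = H.contents - ((deletemin P H).1.toList : Multiset α)) ∧
  (∀ (n₁ n₂ : ℕ) (H₁ H₂ : Heap α), Reach P n₁ H₁ → Reach P n₂ H₂ → n₁ + n₂ ≤ N →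
    (meld P H₁ H₂).1.contents = H₁.contents + H₂.contents)

end EMSH

/-!
The proof is an amortised analysis by an explicit potential, together with invariants of the
trees, the buckets and the heap. All costs and potentials are multiplied by the block size `B`,
and `F` stands for `B q`, the size of a listnode; a procedure that works through the at most `q`
children or roots at one place, and moves `O(1)` listnodes or arrays, costs `O(F)`.

*Trees.* In the invariant `Tree` every node but the root is good: it satisfies its own invariant
and is not an empty leaf. So an extraction from the children of a node either gets `B q / 2`
elements, or empties all children, which then are leaves, so that the node becomes a leaf itself
(`pull_spec`). Every element of a pnode has a potential that falls by a constant from each rank to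
the next; the first kind of extraction is paid by the elements that rise, and the second kind,
which happens once in the life of a node, by a potential `O(F)` of the nodes that have children.
Every listnode has a potential proportional to `F` that falls by `O(F / s k)` from rank `k` to rank
`k + 1`. It is bounded, as the numbers `s k` grow geometrically, and pays for the rounds of Sift at
cnodes, each of which lifts at least `s k / 2` listnodes, or removes a leaf (`takeList_spec`). Hence
Sift costs nothing beyond the loss of potential, and leaves a good tree (`sift_spec`).

*Heaps.* Fill-Up takes `B q / 2` elements or a listnode, and their potential pays for it; when fewer
elements are left, nothing remains below the bucket, which happens once (`fillUp_spec`). Meld works,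
for `O(F)`, where at least two of two buckets and a carry-in meet. If there is no carry-out, the
number of buckets falls, and each has a potential `600 F`. If there is one, `q` roots are replaced
by one, and each has a potential `1700 B` (`meldStep_spec`). A new tree of rank `0` gets its
potential, `O(F)` and `O(D)` for each of its `F` elements, from a buffer that has become full, where
`D` bounds the ranks of the pnodes. So an element of the buffer needs the potential `O(D + 1)`,
which is the amortised cost of Insert. One can take `D = r`, or, as a root of rank `k` requires
`F q ^ k` insertions (`Reach.spec`), the largest `D` with `F q ^ D ≤ N`; if `N < F`, no tree is ever
made.

*Exactness.* If `N < 1 / ε`, then `F q ^ k ≤ N` implies `k ≤ r`, so that all nodes are pnodes. In a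
tree of pnodes the elements of a node do not exceed those below it. An extraction cannot exhaust
the array of a good node with children before it ends, so that the merge of the arrays yields the
smallest elements of all the trees (`extract_sorted`), and this order is maintained. So the first
element of a bucket is the smallest one of the bucket and its trees (`deletemin_isMinOf`).
-/

namespace EMSH

section

variable {α : Type u}

/-! ### Parameters -/

/-- The conditions on the parameters that the analysis needs. -/
structure Params.Ok (P : Params) : Prop where
  one_le_B : 1 ≤ P.B
  two_le_q : 2 ≤ P.q

theorem Params.Ok.two_mul_B_le_full {P : Params} (hP : P.Ok) : 2 * P.B ≤ P.full := by
  unfold Params.full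
  nlinarith [hP.one_le_B, hP.two_le_q]

theorem Params.Ok.q_le_full {P : Params} (hP : P.Ok) : P.q ≤ P.full := by
  unfold Params.full
  nlinarith [hP.one_le_B, hP.two_le_q]

theorem Params.full_le_two_mul_half (P : Params) : P.full ≤ 2 * P.half := by
  unfold Params.half Params.full
  omega

theorem Params.Ok.half_le_full {P : Params} (hP : P.Ok) : P.half ≤ P.full := by
  have := hP.two_mul_B_le_full
  have := hP.one_le_B
  unfold Params.half Params.full at *
  omega

theorem Params.Ok.one_le_half {P : Params} (hP : P.Ok) : 1 ≤ P.half := by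
  have := hP.two_mul_B_le_full
  have := hP.one_le_B
  unfold Params.half Params.full at *
  omega

theorem Params.Ok.B_mul_blocks_le {P : Params} (hP : P.Ok) (n : ℕ) :
    P.B * P.blocks n ≤ n + 2 * P.B := by
  have h1 := hP.one_le_B
  unfold Params.blocks
  split_ifs with h
  · simp
  · have := Nat.mul_div_le (n + P.B - 2) P.B
    rw [mul_add]
    omega

theorem two_le_sAux (j : ℕ) : 2 ≤ sAux j := by
  induction j with
  | zero => simp [sAux]
  | succ j ih => simp only [sAux]; omega

theorem Params.s_of_lt {P : Params} {k : ℕ} (h : P.r < k) : P.s k = sAux (k - (P.r + 1)) := by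
  simp [Params.s, Nat.not_le.2 h]

theorem Params.two_le_s {P : Params} {k : ℕ} (h : P.r < k) : 2 ≤ P.s k := by
  rw [Params.s_of_lt h]; exact two_le_sAux _

theorem Params.three_mul_s_le {P : Params} {k : ℕ} (h : P.r < k) :
    3 * P.s k ≤ 2 * P.s (k + 1) := by
  rw [Params.s_of_lt h, Params.s_of_lt (Nat.lt_succ_of_lt h), 
    show k + 1 - (P.r + 1) = (k - (P.r + 1)) + 1 by omega]
  simp only [sAux]
  omega

/-! ### Contents of trees -/

theorem Node.elems_eq (x : Node α) : x.elems = x.arr ++ x.lists.flatten ++ elemsAll x.kids := by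
  cases x; simp [Node.elems]

@[simp] theorem elemsAll_nil : elemsAll ([] : List (Node α)) = [] := by simp [elemsAll]

@[simp] theorem elemsAll_cons (x : Node α) (xs : List (Node α)) :
    elemsAll (x :: xs) = x.elems ++ elemsAll xs := by simp [elemsAll]

@[simp] theorem elemsAll_append (xs ys : List (Node α)) :
    elemsAll (xs ++ ys) = elemsAll xs ++ elemsAll ys := by
  induction xs with
  | nil => simp
  | cons x xs ih => simp [ih]

theorem mem_elemsAll {a : α} {xs : List (Node α)} :
    a ∈ elemsAll xs ↔ ∃ x ∈ xs, a ∈ x.elems := by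
  induction xs with
  | nil => simp
  | cons x xs ih => simp [ih]

/-- The multiset of the elements in a list of subtrees. -/
def contAll (xs : List (Node α)) : Multiset α := elemsAll xs

/-- The multiset of the elements in a subtree. -/
def Node.cont (x : Node α) : Multiset α := x.elems

@[simp] theorem contAll_nil : contAll ([] : List (Node α)) = 0 := by simp [contAll]

@[simp] theorem contAll_cons (x : Node α) (xs : List (Node α)) :
    contAll (x :: xs) = x.cont + contAll xs := by simp [contAll, Node.cont]

@[simp] theorem contAll_append (xs ys : List (Node α)) :
    contAll (xs ++ ys) = contAll xs + contAll ys := by simp [contAll]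

theorem Node.cont_eq (x : Node α) :
    x.cont = (x.arr : Multiset α) + (x.lists.flatten : Multiset α) + contAll x.kids := by
  simp [Node.cont, contAll, Node.elems_eq]

theorem mem_contAll {a : α} {xs : List (Node α)} : a ∈ contAll xs ↔ a ∈ elemsAll xs := by
  simp [contAll]

theorem Node.isDead_iff {x : Node α} :
    x.isDead = true ↔ x.kids = [] ∧ x.arr = [] ∧ x.lists = [] := by
  simp [Node.isDead, and_assoc]

theorem Node.cont_of_isDead {x : Node α} (h : x.isDead = true) : x.cont = 0 := by
  obtain ⟨h1, h2, h3⟩ := Node.isDead_iff.1 h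
  simp [Node.cont_eq, h1, h2, h3]

theorem Node.violates_of_kids_eq_nil {P : Params} {x : Node α} (h : x.kids = []) :
    x.violates P = false := by simp [Node.violates, h]

/-! ### Invariants of trees -/

/-- A node that satisfies its invariant and is not an empty leaf. -/
structure Node.Good (P : Params) (x : Node α) : Prop where
  not_violates : x.violates P = false
  not_dead : x.isDead = false

theorem Node.Good.half_le_arr {P : Params} {x : Node α} (hx : x.Good P) (hk : x.rank ≤ P.r)
    (h : x.kids ≠ []) :
    P.half ≤ x.arr.length := by
  have := hx.not_violates
  simp only [Node.violates, hk, if_true] at this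
  simpa [h] using this

theorem Node.Good.le_lists {P : Params} {x : Node α} (hx : x.Good P) (hk : P.r < x.rank)
    (h : x.kids ≠ []) :
    P.s x.rank / 2 + 1 ≤ x.lists.length := by
  have := hx.not_violates
  simp only [Node.violates, Nat.not_le.2 hk, if_false] at this
  simpa [h] using this

/-- The conditions on what a single node stores. A pnode has a sorted array, whose elements do
not exceed those below; a cnode has nonempty listnodes of bounded size. -/
structure Node.Shape [LinearOrder α] (P : Params) (x : Node α) : Prop where
  lists_eq : x.rank ≤ P.r → x.lists = []
  sorted : x.rank ≤ P.r → x.arr.Pairwise (· ≤ ·)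
  le_kids : x.rank ≤ P.r → ∀ a ∈ x.arr, ∀ b ∈ elemsAll x.kids, a ≤ b
  arr_eq : P.r < x.rank → x.arr = []
  lists_ne : P.r < x.rank → ∀ l ∈ x.lists, l ≠ []
  lists_le : P.r < x.rank → ∀ l ∈ x.lists, l.length ≤ P.full

/-- The invariant of a tree whose root has rank `k`. All nodes but the root are good. -/
def Tree [LinearOrder α] (P : Params) : ℕ → Node α → Prop
  | 0, x => x.rank = 0 ∧ x.kids = [] ∧ x.Shape P
  | k + 1, x => x.rank = k + 1 ∧ x.kids.length ≤ P.q ∧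
      (∀ y ∈ x.kids, Tree P k y ∧ y.Good P) ∧ x.Shape P

section Tree

variable [LinearOrder α] {P : Params} {k : ℕ} {x : Node α}

theorem Tree.rank_eq (h : Tree P k x) : x.rank = k := by
  cases k with
  | zero => exact h.1
  | succ k => exact h.1

theorem Tree.shape (h : Tree P k x) : x.Shape P := by
  cases k with
  | zero => exact h.2.2
  | succ k => exact h.2.2.2

/-- The own data of the root of a tree may be replaced by any that have the right shape. -/
theorem Tree.congr {y : Node α} (h : Tree P k x) (hr : y.rank = x.rank) (hk : y.kids = x.kids)
    (hy : y.Shape P) : Tree P k y := by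
  cases k with
  | zero => exact ⟨hr.trans h.1, hk.trans h.2.1, hy⟩
  | succ k => exact ⟨hr.trans h.1, hk ▸ h.2.1, hk ▸ h.2.2.1, hy⟩

theorem Node.Good.arr_ne (hP : P.Ok) (hx : x.Good P) (hs : x.Shape P) (hk : x.rank ≤ P.r) :
    x.arr ≠ [] := by
  intro h0
  by_cases h : x.kids = []
  · have := hx.not_dead
    have h1 : x.isDead = true := Node.isDead_iff.2 ⟨h, h0, hs.lists_eq hk⟩
    simp [h1] at this
  · have h1 := hx.half_le_arr hk h
    have := hP.one_le_half
    simp [h0] at h1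
    omega

theorem Node.Good.lists_ne_nil (hx : x.Good P) (hs : x.Shape P) (hk : P.r < x.rank) :
    x.lists ≠ [] := by
  intro h0
  by_cases h : x.kids = []
  · have := hx.not_dead
    have h1 : x.isDead = true := Node.isDead_iff.2 ⟨h, hs.arr_eq hk, h0⟩
    simp [h1] at this
  · have h1 := hx.le_lists hk h
    simp [h0] at h1

theorem Node.Good.elems_ne (hP : P.Ok) (hx : x.Good P) (hs : x.Shape P) : x.elems ≠ [] := by
  rw [Node.elems_eq]
  rcases le_or_gt x.rank P.r with hk | hk
  · simp [hx.arr_ne hP hs hk]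
  · obtain ⟨l, ls, h⟩ := List.exists_cons_of_ne_nil (hx.lists_ne_nil hs hk)
    have := hs.lists_ne hk l (by simp [h])
    simp [h, this]

end Tree

/-! ### The multi-way merge -/

/-- `y` results from `x` by the removal of an initial segment of its array. -/
def Drained (x y : Node α) : Prop := y = { x with arr := y.arr } ∧ y.arr <:+ x.arr

theorem Drained.refl (x : Node α) : Drained x x := ⟨by cases x; rfl, List.suffix_rfl⟩

theorem Drained.trans {x y z : Node α} (h : Drained x y) (h' : Drained y z) : Drained x z := by
  refine ⟨?_, h'.2.trans h.2⟩
  rw [h'.1, h.1]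

/-- The total size of the arrays of a list of nodes. -/
def arrSum (xs : List (Node α)) : ℕ := (xs.map (fun x => x.arr.length)).sum

theorem forall₂_drained_refl (xs : List (Node α)) : List.Forall₂ Drained xs xs :=
  List.forall₂_same.2 fun x _ => Drained.refl x

theorem forall₂_drained_trans {xs ys zs : List (Node α)} (h : List.Forall₂ Drained xs ys)
    (h' : List.Forall₂ Drained ys zs) : List.Forall₂ Drained xs zs := by
  induction h generalizing zs with
  | nil => exact h'
  | cons h1 _ ih =>
    cases h' with
    | cons h2 h3 => exact .cons (h1.trans h2) (ih h3)

theorem mergeCost_le {P : Params} (hP : P.Ok) {xs ys : List (Node α)}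
    (h : List.Forall₂ Drained xs ys) :
    P.B * mergeCost P xs ys + arrSum ys ≤ arrSum xs + 5 * P.B * xs.length := by
  have h1 := hP.one_le_B
  induction h with
  | nil => simp [mergeCost, arrSum]
  | @cons x y xs ys hxy _ ih =>
    have hb := hP.B_mul_blocks_le (min (x.arr.length - y.arr.length + 1) x.arr.length)
    have := hxy.2.length_le
    have hm : min (x.arr.length - y.arr.length + 1) x.arr.length ≤
      x.arr.length - y.arr.length + 1 := min_le_left _ _
    simp only [mergeCost, arrSum, List.zipWith_cons_cons, List.sum_cons, List.map_cons,
      List.length_cons, mul_add] at ih ⊢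
    omega

section Extract

variable [LinearOrder α]

theorem popMin_eq_none {xs : List (Node α)} (h : popMin xs = none) : ∀ x ∈ xs, x.arr = [] := by
  induction xs with
  | nil => simp
  | cons x xs ih =>
    rw [popMin] at h
    cases hx : x.arr with
    | nil =>
      cases hp : popMin xs with
      | none => simpa [hx] using ih hp
      | some v => obtain ⟨⟨b, j⟩, ys⟩ := v; simp [hx, hp] at h
    | cons a as =>
      cases hp : popMin xs with
      | none => simp [hx, hp] at h
      | some v =>
        obtain ⟨⟨b, j⟩, ys⟩ := v
        simp only [hx, hp] at h
        split_ifs at h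

theorem popMin_eq_some {xs ys : List (Node α)} {a : α} {j : ℕ}
    (h : popMin xs = some ((a, j), ys)) :
    (∃ l₁ x as l₂, xs = l₁ ++ x :: l₂ ∧ x.arr = a :: as ∧
      ys = l₁ ++ { x with arr := as } :: l₂ ∧ j = l₁.length) ∧
    ∀ x ∈ xs, ∀ b ∈ x.arr.head?, a ≤ b := by
  induction xs generalizing ys a j with
  | nil => simp [popMin] at h
  | cons x xs ih =>
    rw [popMin] at h
    cases hx : x.arr with
    | nil =>
      cases hp : popMin xs with
      | none => simp [hx, hp] at h
      | some v =>
        obtain ⟨⟨b, i⟩, zs⟩ := v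
        simp only [hx, hp, Option.some.injEq, Prod.mk.injEq] at h
        obtain ⟨⟨rfl, rfl⟩, rfl⟩ := h
        obtain ⟨⟨l₁, y, as, l₂, rfl, h2, rfl, rfl⟩, h5⟩ := ih hp
        refine ⟨⟨x :: l₁, y, as, l₂, rfl, h2, rfl, rfl⟩, ?_⟩
        intro z hz c hc
        rcases List.mem_cons.1 hz with rfl | hz
        · simp [hx] at hc
        · exact h5 z hz c hc
    | cons b bs =>
      have here : ∀ h5 : ∀ y ∈ xs, ∀ c ∈ y.arr.head?, b ≤ c, 
          some ((b, 0), { x with arr := bs } :: xs) = some ((a, j), ys) → 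
          (∃ l₁ y as l₂, x :: xs = l₁ ++ y :: l₂ ∧ y.arr = a :: as ∧
            ys = l₁ ++ { y with arr := as } :: l₂ ∧ j = l₁.length) ∧
          ∀ y ∈ x :: xs, ∀ c ∈ y.arr.head?, a ≤ c := by
        intro h5 h
        simp only [Option.some.injEq, Prod.mk.injEq] at h
        obtain ⟨⟨rfl, rfl⟩, rfl⟩ := h
        refine ⟨⟨[], x, bs, xs, rfl, hx, rfl, rfl⟩, ?_⟩
        intro z hz c hc
        rcases List.mem_cons.1 hz with rfl | hz
        · simp [hx] at hc; exact hc.le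
        · exact h5 z hz c hc
      cases hp : popMin xs with
      | none =>
        simp only [hx, hp] at h
        refine here ?_ h
        intro y hy c hc
        simp [popMin_eq_none hp y hy] at hc
      | some v =>
        obtain ⟨⟨c, i⟩, zs⟩ := v
        obtain ⟨⟨l₁, y, as, l₂, rfl, h2, rfl, rfl⟩, h5⟩ := ih hp
        simp only [hx, hp] at h
        split_ifs at h with hle
        · exact here (fun z hz d hd => hle.trans (h5 z hz d hd)) h
        · simp only [Option.some.injEq, Prod.mk.injEq] at h
          obtain ⟨⟨rfl, rfl⟩, rfl⟩ := h
          refine ⟨⟨x :: l₁, y, as, l₂, rfl, h2, rfl, rfl⟩, ?_⟩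
          intro z hz d hd
          rcases List.mem_cons.1 hz with rfl | hz
          · simp [hx] at hd; exact hd ▸ (not_le.1 hle).le
          · exact h5 z hz d hd

/-- What the multi-way merge does, apart from the order of the elements. -/
theorem extract_spec (t : ℕ) (xs : List (Node α)) :
    List.Forall₂ Drained xs (extract t xs).2 ∧
    (extract t xs).1.length ≤ t ∧
    ((extract t xs).1.length = t ∨ ∀ y ∈ (extract t xs).2, y.arr = []) ∧
    contAll xs = ((extract t xs).1.map Prod.fst : List α) + contAll (extract t xs).2 ∧
    arrSum xs = (extract t xs).1.length + arrSum (extract t xs).2 ∧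
    ∀ p ∈ (extract t xs).1, p.2 < xs.length := by
  induction t generalizing xs with
  | zero => simp [extract, Drained.refl]
  | succ t ih =>
    rw [extract]
    cases hp : popMin xs with
    | none => simpa [Drained.refl] using popMin_eq_none hp
    | some v =>
      obtain ⟨⟨a, j⟩, ys⟩ := v
      obtain ⟨⟨l₁, x, as, l₂, rfl, h2, h3, rfl⟩, h5⟩ := popMin_eq_some hp
      obtain ⟨i1, i2, i3, i4, i5, i6⟩ := ih ys
      have hd : List.Forall₂ Drained (l₁ ++ x :: l₂) ys := by
        rw [h3]
        refine List.rel_append (forall₂_drained_refl _) (.cons ⟨rfl, ?_⟩ (forall₂_drained_refl _))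
        simp [h2]
      dsimp only
      refine ⟨forall₂_drained_trans hd i1, by simpa using i2, ?_, ?_, ?_, ?_⟩
      · rcases i3 with i3 | i3
        · left; simp [i3]
        · right; exact i3
      · rw [List.map_cons, ← Multiset.cons_coe, Multiset.cons_add, ← i4, h3]
        simp only [contAll_append, contAll_cons, Node.cont_eq x, Node.cont_eq { x with arr := as },
          h2, ← Multiset.cons_coe, Multiset.cons_add, Multiset.add_cons]
      · rw [List.length_cons, Nat.add_right_comm, ← i5, h3]
        simp [arrSum, h2]
        omega
      · intro p hp
        rcases List.mem_cons.1 hp with rfl | hp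
        · simp
        · have := i6 p hp
          rw [h3] at this
          simpa using this

/-- If no array can run out while there are elements below it, then the elements extracted are
sorted, and they do not exceed the others. -/
theorem extract_sorted (t : ℕ) (xs : List (Node α))
    (hs : ∀ x ∈ xs, x.arr.Pairwise (· ≤ ·)) (hl : ∀ x ∈ xs, x.lists = [])
    (hk : ∀ x ∈ xs, ∀ a ∈ x.arr, ∀ b ∈ elemsAll x.kids, a ≤ b)
    (ht : ∀ x ∈ xs, x.kids = [] ∨ t ≤ x.arr.length) :
    ((extract t xs).1.map Prod.fst).Pairwise (· ≤ ·) ∧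
    ∀ a ∈ (extract t xs).1.map Prod.fst, ∀ b ∈ elemsAll (extract t xs).2, a ≤ b := by
  induction t generalizing xs with
  | zero => simp [extract]
  | succ t ih =>
    have hc := (extract_spec (t + 1) xs).2.2.2.1
    rw [extract] at hc ⊢
    cases hp : popMin xs with
    | none => simp
    | some v =>
      obtain ⟨⟨a, j⟩, ys⟩ := v
      rw [hp] at hc
      obtain ⟨⟨l₁, x, as, l₂, rfl, h2, h3, rfl⟩, h5⟩ := popMin_eq_some hp
      have hall : ∀ b ∈ elemsAll (l₁ ++ x :: l₂), a ≤ b := by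
        intro b hb
        obtain ⟨y, hy, hby⟩ := mem_elemsAll.1 hb
        rw [Node.elems_eq, hl y hy] at hby
        cases hya : y.arr with
        | nil =>
          have : y.kids = [] := by simpa [hya] using ht y hy
          simp [hya, this] at hby
        | cons c cs =>
          have hac := h5 y hy c (by simp [hya])
          have hsy := hs y hy
          rw [hya, List.pairwise_cons] at hsy
          simp only [hya, List.flatten_nil, List.append_nil, List.mem_append, List.mem_cons] at hby
          rcases hby with (rfl | hby) | hby
          · exact hac
          · exact hac.trans (hsy.1 b hby)
          · exact hac.trans (hk y hy c (by simp [hya]) b hby)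
      have hx : x ∈ l₁ ++ x :: l₂ := by simp
      have hmem : ∀ z ∈ ys, z = { x with arr := as } ∨ z ∈ l₁ ++ x :: l₂ := by
        intro z hz
        rw [h3] at hz
        simp only [List.mem_append, List.mem_cons] at hz ⊢
        tauto
      have hsx := hs x hx
      rw [h2, List.pairwise_cons] at hsx
      obtain ⟨i1, i2⟩ := ih ys
        (by
          intro z hz
          rcases hmem z hz with rfl | hz
          · exact hsx.2
          · exact hs z hz)
        (by
          intro z hz
          rcases hmem z hz with rfl | hz
          · exact hl x hx
          · exact hl z hz)
        (by
          intro z hz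
          rcases hmem z hz with rfl | hz
          · intro c hc; exact hk x hx c (by simp [h2, hc])
          · exact hk z hz)
        (by
          intro z hz
          rcases hmem z hz with rfl | hz
          · have := ht x hx
            simpa [h2] using this
          · exact (ht z hz).imp id (by omega))
      have hm : ∀ b, b ∈ (extract t ys).1.map Prod.fst ∨ b ∈ elemsAll (extract t ys).2 →
          a ≤ b := by
        intro b hb
        apply hall
        rw [← mem_contAll, hc]
        simp only [List.map_cons, Multiset.mem_add, Multiset.mem_coe, List.mem_cons, mem_contAll]
        tauto
      dsimp only
      rw [List.map_cons, List.pairwise_cons]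
      refine ⟨⟨fun b hb => hm b (.inl hb), i1⟩, ?_⟩
      intro c hc b hb
      rcases List.mem_cons.1 hc with rfl | hc
      · exact hm b (.inr hb)
      · exact i2 c hc b hb

end Extract

end

section

variable {α : Type u}

/-! ### The potential of trees -/

/-- The potential per element of a pnode of rank `k`, times `B`. It falls by `240` from each rank
to the next. The parameter `D` bounds the ranks of the pnodes. -/
noncomputable def elemWeight (D k : ℕ) : ℝ := 240 * ((D + 2 - k : ℕ) : ℝ)

/-- The potential per listnode of a cnode of rank `k`, times `B`. As the numbers `s k` grow
geometrically, it falls by at least `40 B q / s k` from rank `k` to the next. -/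
noncomputable def listWeight (P : Params) (k : ℕ) : ℝ := P.full * (20 + 120 / P.s k)

/-- The potential of a node itself, times `B`, if its rank is `k`. Apart from its elements or
listnodes, its existence counts, which pays for its removal when it is a leaf, and the existence of
children, which pays for the last extraction from them. -/
noncomputable def ownPot (P : Params) (D k : ℕ) (x : Node α) : ℝ :=
  20 * P.full + (if x.kids.isEmpty then (0 : ℝ) else 240 * P.full) +
    if k ≤ P.r then x.arr.length * elemWeight D k else x.lists.length * listWeight P k

/-- The potential of a tree, times `B`, if its root has rank `k`. -/
noncomputable def treePot (P : Params) (D : ℕ) : ℕ → Node α → ℝ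
  | 0, x => ownPot P D 0 x
  | k + 1, x => ownPot P D (k + 1) x + (x.kids.map (treePot P D k)).sum

/-- The total potential of trees whose roots have rank `k`, times `B`. -/
noncomputable def potAll (P : Params) (D k : ℕ) (xs : List (Node α)) : ℝ :=
  (xs.map (treePot P D k)).sum

section Pot

variable {P : Params} {D k : ℕ}

theorem treePot_succ (x : Node α) :
    treePot P D (k + 1) x = ownPot P D (k + 1) x + potAll P D k x.kids := rfl

@[simp] theorem potAll_nil : potAll P D k ([] : List (Node α)) = 0 := rfl

@[simp] theorem potAll_cons (x : Node α) (xs : List (Node α)) :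
    potAll P D k (x :: xs) = treePot P D k x + potAll P D k xs := by simp [potAll]

@[simp] theorem potAll_append (xs ys : List (Node α)) :
    potAll P D k (xs ++ ys) = potAll P D k xs + potAll P D k ys := by simp [potAll]

theorem elemWeight_nonneg : 0 ≤ elemWeight D k := by unfold elemWeight; positivity

theorem elemWeight_eq (h : k ≤ D + 1) : elemWeight D k = elemWeight D (k + 1) + 240 := by
  unfold elemWeight
  rw [show D + 2 - k = (D + 2 - (k + 1)) + 1 by omega]
  push_cast
  ring

theorem le_elemWeight (h : k ≤ D) : 480 ≤ elemWeight D k := by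
  rw [elemWeight_eq (by omega), elemWeight_eq (by omega)]
  linarith [elemWeight_nonneg (D := D) (k := k + 1 + 1)]

theorem listWeight_nonneg : 0 ≤ listWeight P k := by unfold listWeight; positivity

theorem le_listWeight : 20 * (P.full : ℝ) ≤ listWeight P k := by
  unfold listWeight
  have : (0 : ℝ) ≤ P.full * (120 / P.s k) := by positivity
  linarith

theorem listWeight_le (h : P.r < k) : listWeight P k ≤ 80 * P.full := by
  unfold listWeight
  have h2 : (2 : ℝ) ≤ P.s k := by exact_mod_cast Params.two_le_s h
  have : (120 : ℝ) / P.s k ≤ 60 := by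
    rw [div_le_iff₀ (by linarith)]; linarith
  nlinarith [(Nat.cast_nonneg P.full : (0 : ℝ) ≤ P.full)]

theorem listWeight_succ_le (h : P.r < k) :
    listWeight P (k + 1) + 40 * P.full / P.s k ≤ listWeight P k := by
  unfold listWeight
  have h2 : (2 : ℝ) ≤ P.s k := by exact_mod_cast Params.two_le_s h
  have h3 : (3 : ℝ) * P.s k ≤ 2 * P.s (k + 1) := by exact_mod_cast Params.three_mul_s_le h
  have : (120 : ℝ) / P.s (k + 1) ≤ 80 / P.s k := by
    rw [div_le_div_iff₀ (by linarith) (by linarith)]; linarith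
  have h4 : (P.full : ℝ) * (120 / P.s (k + 1)) ≤ P.full * (80 / P.s k) := by gcongr
  have h5 : (P.full : ℝ) * (120 / P.s k) = P.full * (80 / P.s k) + 40 * P.full / P.s k := by ring
  linarith

theorem ownPot_nonneg (x : Node α) : 0 ≤ ownPot P D k x := by
  unfold ownPot
  have := elemWeight_nonneg (D := D) (k := k)
  have := listWeight_nonneg (P := P) (k := k)
  split_ifs <;> positivity

theorem treePot_nonneg (x : Node α) : 0 ≤ treePot P D k x := by
  induction k generalizing x with
  | zero => exact ownPot_nonneg x
  | succ k ih =>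
    refine add_nonneg (ownPot_nonneg x) (List.sum_nonneg ?_)
    simpa using fun y _ => ih y

theorem potAll_nonneg (xs : List (Node α)) : 0 ≤ potAll P D k xs :=
  List.sum_nonneg (by simpa using fun y _ => treePot_nonneg y)

theorem treePot_congr {x y : Node α} (h : y.kids = x.kids) :
    treePot P D k y + ownPot P D k x = treePot P D k x + ownPot P D k y := by
  cases k with
  | zero => exact add_comm _ _
  | succ k => rw [treePot_succ, treePot_succ, h]; ring

theorem ownPot_of_le (hk : k ≤ P.r) (x : Node α) : ownPot P D k x = 20 * P.full +
    (if x.kids.isEmpty then (0 : ℝ) else 240 * P.full) + x.arr.length * elemWeight D k := by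
  simp [ownPot, hk]

theorem ownPot_of_lt (hk : P.r < k) (x : Node α) : ownPot P D k x = 20 * P.full +
    (if x.kids.isEmpty then (0 : ℝ) else 240 * P.full) + x.lists.length * listWeight P k := by
  simp [ownPot, Nat.not_le.2 hk]

theorem potAll_of_drained (hk : k ≤ P.r) {xs ys : List (Node α)}
    (h : List.Forall₂ Drained xs ys) :
    potAll P D k xs + arrSum ys * elemWeight D k =
      potAll P D k ys + arrSum xs * elemWeight D k := by
  induction h with
  | nil => simp [arrSum]
  | @cons x y xs ys hxy _ ih =>
    have hkid : y.kids = x.kids := by rw [hxy.1]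
    have h1 := treePot_congr (P := P) (D := D) (k := k) hkid
    rw [ownPot_of_le hk, ownPot_of_le hk, hkid] at h1
    simp only [arrSum, List.map_cons, List.sum_cons, potAll_cons] at ih ⊢
    push_cast at ih ⊢
    linarith

end Pot

/-! ### Restoring invariants -/

theorem restoreWith_nil {P : Params} (f : Node α → Node α × ℕ) : restoreWith P f [] = ([], 0) := rfl

theorem restoreWith_cons {P : Params} (f : Node α → Node α × ℕ) (x : Node α) (xs : List (Node α)) :
    restoreWith P f (x :: xs) =
      ((if (if x.violates P then f x else (x, 0)).1.isDead then []
          else [(if x.violates P then f x else (x, 0)).1]) ++ (restoreWith P f xs).1,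
        2 + (if x.violates P then f x else (x, 0)).2 + (restoreWith P f xs).2) := by
  simp only [restoreWith, List.map_cons, List.filter_cons, List.sum_cons]
  split_ifs <;> simp_all

theorem forall₂_mem_right {R : Node α → Node α → Prop} {xs ys : List (Node α)}
    (h : List.Forall₂ R xs ys) {y : Node α} (hy : y ∈ ys) : ∃ x ∈ xs, R x y := by
  induction h with
  | nil => simp at hy
  | cons h1 _ ih =>
    rcases List.mem_cons.1 hy with rfl | hy
    · exact ⟨_, List.mem_cons_self, h1⟩
    · obtain ⟨x, hx, h⟩ := ih hy
      exact ⟨x, List.mem_cons_of_mem _ hx, h⟩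

theorem restoreWith_of_dead {P : Params} {f : Node α → Node α × ℕ} {xs : List (Node α)}
    (h : ∀ x ∈ xs, x.isDead = true) : (restoreWith P f xs).1 = [] := by
  induction xs with
  | nil => rfl
  | cons x xs ih =>
    have hx := h x List.mem_cons_self
    have hv : x.violates P = false := Node.violates_of_kids_eq_nil (Node.isDead_iff.1 hx).1
    rw [restoreWith_cons]
    simp [hv, hx, ih fun y hy => h y (List.mem_cons_of_mem _ hy)]

section Sift

variable [LinearOrder α] {P : Params} {D k : ℕ}

/-- What a procedure for sifting at nodes of rank `k` has to accomplish: it restores the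
invariant, keeps the elements, and is paid by the potential. -/
def SiftSpec (P : Params) (D k : ℕ) (f : Node α → Node α × ℕ) : Prop :=
  ∀ x, Tree P k x → x.violates P = true →
    Tree P k (f x).1 ∧ (f x).1.Good P ∧ (f x).1.cont = x.cont ∧
    (P.B : ℝ) * (f x).2 + treePot P D k (f x).1 ≤ treePot P D k x

theorem restoreWith_spec {f : Node α → Node α × ℕ} (hf : SiftSpec P D k f) {xs : List (Node α)}
    (hxs : ∀ x ∈ xs, Tree P k x) :
    (∀ y ∈ (restoreWith P f xs).1, Tree P k y ∧ y.Good P) ∧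
    (restoreWith P f xs).1.length ≤ xs.length ∧
    contAll (restoreWith P f xs).1 = contAll xs ∧
    (P.B : ℝ) * (restoreWith P f xs).2 + potAll P D k (restoreWith P f xs).1 ≤
      potAll P D k xs + 2 * P.B * xs.length := by
  induction xs with
  | nil => simp [restoreWith_nil]
  | cons x xs ih =>
    obtain ⟨i1, i2, i3, i4⟩ := ih fun y hy => hxs y (List.mem_cons_of_mem _ hy)
    have hx := hxs x List.mem_cons_self
    rw [restoreWith_cons]
    generalize restoreWith P f xs = t at i1 i2 i3 i4 ⊢
    have hu : ∃ u, u = (if x.violates P then f x else (x, 0)) ∧ Tree P k u.1 ∧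
        (u.1.isDead = false → u.1.Good P) ∧ u.1.cont = x.cont ∧
        (P.B : ℝ) * u.2 + treePot P D k u.1 ≤ treePot P D k x := by
      refine ⟨_, rfl, ?_⟩
      by_cases hv : x.violates P = true
      · obtain ⟨h1, h2, h3, h4⟩ := hf x hx hv
        simp only [hv, if_true]
        exact ⟨h1, fun _ => h2, h3, h4⟩
      · simp only [hv, Bool.false_eq_true, if_false]
        refine ⟨hx, fun h => ⟨by simpa using hv, h⟩, trivial, by simp⟩
    obtain ⟨u, hu, h1, h2, h3, h4⟩ := hu
    rw [← hu]
    by_cases hd : u.1.isDead = true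
    · have h0 := Node.cont_of_isDead hd
      rw [h3] at h0
      simp only [hd, if_true, List.nil_append, contAll_cons, h0, zero_add, potAll_cons,
        List.length_cons]
      refine ⟨i1, by omega, i3, ?_⟩
      have := treePot_nonneg (P := P) (D := D) (k := k) u.1
      push_cast
      linarith
    · simp only [hd, Bool.false_eq_true, if_false, List.cons_append, List.nil_append,
        contAll_cons, potAll_cons, List.length_cons, h3, i3]
      refine ⟨?_, by omega, trivial, ?_⟩
      · intro y hy
        rcases List.mem_cons.1 hy with rfl | hy
        · exact ⟨h1, h2 (by simpa using hd)⟩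
        · exact i1 y hy
      · push_cast
        linarith

/-! ### Sift at pnodes -/

theorem Tree.drained {x y : Node α} (hx : Tree P k x) (h : Drained x y) (hk : k ≤ P.r) :
    Tree P k y := by
  have hr : y.rank = x.rank := by rw [h.1]
  have hkid : y.kids = x.kids := by rw [h.1]
  have hl : y.lists = x.lists := by rw [h.1]
  have hk' : x.rank ≤ P.r := hx.rank_eq.symm ▸ hk
  refine hx.congr hr hkid ⟨?_, ?_, ?_, ?_, ?_, ?_⟩
  · exact fun _ => hl.trans (hx.shape.lists_eq hk')
  · exact fun _ => (hx.shape.sorted hk').sublist h.2.sublist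
  · exact fun _ a ha => hkid ▸ hx.shape.le_kids hk' a (h.2.subset ha)
  all_goals intro h; omega

/-- The multi-way merge of `B q / 2` elements from good trees. If it does not get so many, then
only empty leaves remain. -/
theorem extract_good (hP : P.Ok) (hk : k ≤ P.r) {xs : List (Node α)} (hne : xs ≠ [])
    (hxs : ∀ x ∈ xs, Tree P k x ∧ x.Good P) :
    (∀ y ∈ (extract P.half xs).2, Tree P k y) ∧
    (extract P.half xs).1 ≠ [] ∧
    ((extract P.half xs).1.length = P.half ∨
      ∀ y ∈ (extract P.half xs).2, y.isDead = true) ∧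
    ((extract P.half xs).1.map Prod.fst).Pairwise (· ≤ ·) ∧
    (∀ a ∈ (extract P.half xs).1.map Prod.fst, ∀ b ∈ elemsAll (extract P.half xs).2, a ≤ b) ∧
    potAll P D k xs = potAll P D k (extract P.half xs).2 +
      (extract P.half xs).1.length * elemWeight D k := by
  obtain ⟨h1, h2, h3, h4, h5, h6⟩ := extract_spec P.half xs
  have hs := extract_sorted P.half xs
    (fun x hx => (hxs x hx).1.shape.sorted ((hxs x hx).1.rank_eq.symm ▸ hk))
    (fun x hx => (hxs x hx).1.shape.lists_eq ((hxs x hx).1.rank_eq.symm ▸ hk))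
    (fun x hx => (hxs x hx).1.shape.le_kids ((hxs x hx).1.rank_eq.symm ▸ hk))
    (fun x hx => by
      by_cases h : x.kids = []
      · exact .inl h
      · exact .inr ((hxs x hx).2.half_le_arr ((hxs x hx).1.rank_eq.symm ▸ hk) h))
  have hpot := potAll_of_drained (P := P) (D := D) hk h1
  have h1half := hP.one_le_half
  generalize extract P.half xs = e at *
  have htree : ∀ y ∈ e.2, Tree P k y := fun y hy => by
    obtain ⟨x, hx, h⟩ := forall₂_mem_right h1 hy
    exact (hxs x hx).1.drained h hk
  refine ⟨htree, ?_, ?_, hs.1, hs.2, ?_⟩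
  · intro h0
    obtain ⟨x, xs, rfl⟩ := List.exists_cons_of_ne_nil hne
    obtain ⟨hx1, hx2⟩ := hxs x List.mem_cons_self
    have hxa := hx2.arr_ne hP hx1.shape (hx1.rank_eq.symm ▸ hk)
    rcases h3 with h3 | h3
    · simp [h0] at h3; omega
    · rw [h0] at h5
      have : arrSum e.2 = 0 := by
        simp only [arrSum, List.sum_eq_zero_iff, List.mem_map, forall_exists_index, and_imp,
          forall_apply_eq_imp_iff₂]
        intro y hy
        simp [h3 y hy]
      rw [this] at h5
      simp [arrSum] at h5
      exact hxa h5.1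
  · by_cases hl : e.1.length = P.half
    · exact .inl hl
    · refine .inr fun y hy => ?_
      have hy0 := (h3.resolve_left hl) y hy
      obtain ⟨x, hx, h⟩ := forall₂_mem_right h1 hy
      have hyt := htree y hy
      refine Node.isDead_iff.2 ⟨?_, hy0, hyt.shape.lists_eq (hyt.rank_eq.symm ▸ hk)⟩
      have hyk : y.kids = x.kids := by rw [h.1]
      rw [hyk]
      by_contra hkne
      -- A node with children had `B q / 2` elements, so that not all of them were extracted.
      have hhalf := (hxs x hx).2.half_le_arr ((hxs x hx).1.rank_eq.symm ▸ hk) hkne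
      have : x.arr.length ≤ arrSum xs :=
        List.single_le_sum (by simp) _ (List.mem_map_of_mem hx)
      have : arrSum e.2 = 0 := by
        simp only [arrSum, List.sum_eq_zero_iff, List.mem_map, forall_exists_index, and_imp,
          forall_apply_eq_imp_iff₂]
        intro y hy
        simp [(h3.resolve_left hl) y hy]
      omega
  · rw [h5] at hpot
    push_cast at hpot
    linarith

theorem pull_spec (hP : P.Ok) (hk : k ≤ P.r) {f : Node α → Node α × ℕ} (hf : SiftSpec P D k f)
    {x : Node α} (hne : x.kids ≠ []) (hlen : x.kids.length ≤ P.q)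
    (hxs : ∀ y ∈ x.kids, Tree P k y ∧ y.Good P) :
    ∃ es ys c, pull P f x = (es, { x with kids := ys }, c) ∧
      (∀ y ∈ ys, Tree P k y ∧ y.Good P) ∧ ys.length ≤ P.q ∧
      es ≠ [] ∧ es.length ≤ P.half ∧ (es.length = P.half ∨ ys = []) ∧
      contAll x.kids = (es : Multiset α) + contAll ys ∧
      es.Pairwise (· ≤ ·) ∧ (∀ a ∈ es, ∀ b ∈ elemsAll ys, a ≤ b) ∧
      (P.B : ℝ) * c + es.length * elemWeight D k + potAll P D k ys ≤
        potAll P D k x.kids + 15 * P.full := by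
  refine ⟨_, _, _, rfl, ?_⟩
  obtain ⟨h1, h2, h3, h4, h5, h6⟩ := extract_good (D := D) hP hk hne hxs
  obtain ⟨d1, d2, d3, d4, d5, d6⟩ := extract_spec P.half x.kids
  have hm := mergeCost_le hP d1
  generalize extract P.half x.kids = e at *
  obtain ⟨r1, r2, r3, r4⟩ := restoreWith_spec hf h1
  have hlen2 := d1.length_eq
  have hcont : ∀ b ∈ elemsAll (restoreWith P f e.2).1, b ∈ elemsAll e.2 := by
    intro b hb
    rwa [← mem_contAll, ← r3, mem_contAll]
  refine ⟨r1, by omega, by simpa using h2, by simpa using d2, ?_, by rw [r3, d4], h4, ?_, ?_⟩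
  · rcases h3 with h3 | h3
    · left; simpa using h3
    · right; exact restoreWith_of_dead h3
  · exact fun a ha b hb => h5 a ha b (hcont b hb)
  · rw [h6, List.length_map]
    generalize restoreWith P f e.2 = u at *
    have b1 := hP.B_mul_blocks_le x.kids.length
    have b2 := hP.B_mul_blocks_le e.1.length
    have g1 := hP.two_mul_B_le_full
    have g2 := hP.q_le_full
    have g3 := hP.half_le_full
    have g4 : P.B * x.kids.length ≤ P.full := Nat.mul_le_mul_left _ hlen
    have key : P.B * (2 + 2 * P.blocks x.kids.length + mergeCost P x.kids e.2 +
        P.blocks e.1.length) + 2 * P.B * x.kids.length ≤ 15 * P.full := by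
      simp only [mul_add]
      have e1 : 5 * P.B * x.kids.length = 5 * (P.B * x.kids.length) := by ring
      have e2 : 2 * P.B * x.kids.length = 2 * (P.B * x.kids.length) := by ring
      have e3 : P.B * (2 * P.blocks x.kids.length) = 2 * (P.B * P.blocks x.kids.length) := by ring
      rw [e1] at hm
      rw [e2, e3]
      omega
    have key' : (P.B : ℝ) * ((2 + 2 * P.blocks x.kids.length + mergeCost P x.kids e.2 +
        P.blocks e.1.length : ℕ) : ℝ) + 2 * P.B * x.kids.length ≤ 15 * P.full := by
      exact_mod_cast key
    rw [← hlen2] at r4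
    rw [Nat.cast_add, mul_add]
    linarith

end Sift

end

section

variable {α : Type u}

theorem Node.violates_iff {P : Params} {x : Node α} : x.violates P = true ↔ x.kids ≠ [] ∧
    (x.rank ≤ P.r → x.arr.length < P.half) ∧
    (P.r < x.rank → x.lists.length < P.s x.rank / 2 + 1) := by
  rcases le_or_gt x.rank P.r with h | h
  · simp [Node.violates, h, Nat.not_lt.2 h]
  · simp [Node.violates, h, Nat.not_le.2 h]

theorem Node.not_violates_iff {P : Params} {x : Node α} : x.violates P = false ↔ x.kids = [] ∨
    ((x.rank ≤ P.r → P.half ≤ x.arr.length) ∧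
    (P.r < x.rank → P.s x.rank / 2 + 1 ≤ x.lists.length)) := by
  rcases le_or_gt x.rank P.r with h | h
  · simp [Node.violates, h, Nat.not_lt.2 h]
    tauto
  · simp [Node.violates, h, Nat.not_le.2 h]
    tauto

theorem Node.isDead_eq_false_iff {x : Node α} :
    x.isDead = false ↔ x.kids ≠ [] ∨ x.arr ≠ [] ∨ x.lists ≠ [] := by
  rw [Bool.eq_false_iff, Ne, Node.isDead_iff]
  tauto

variable [LinearOrder α] {P : Params} {D k : ℕ}

theorem siftPnode_spec (hP : P.Ok) (hk : k + 1 ≤ P.r) (hD : k + 1 ≤ D)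
    {f : Node α → Node α × ℕ} (hf : SiftSpec P D k f) :
    SiftSpec P D (k + 1) (siftPnode P f) := by
  intro x hx hv
  obtain ⟨hrank, hlen, hkids, hshape⟩ := hx
  obtain ⟨hne, hv1, -⟩ := Node.violates_iff.1 hv
  obtain ⟨es, ys, c, hp, p1, p2, p3, p4, p5, p6, p7, p8, p9⟩ :=
    pull_spec hP (by omega) hf hne hlen hkids
  have hr : x.rank ≤ P.r := by omega
  have hle := hshape.le_kids hr
  have hmem : ∀ b, b ∈ es ∨ b ∈ elemsAll ys → b ∈ elemsAll x.kids := by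
    intro b hb
    rw [← mem_contAll, p6, Multiset.mem_add, mem_contAll]
    simpa using hb
  simp only [siftPnode, hp]
  refine ⟨⟨hrank, p2, p1, ⟨?_, ?_, ?_, ?_, ?_, ?_⟩⟩, ⟨?_, ?_⟩, ?_, ?_⟩
  · exact fun _ => hshape.lists_eq hr
  · intro _
    simp only [List.pairwise_append]
    exact ⟨hshape.sorted hr, p7, fun a ha b hb => hle a ha b (hmem b (.inl hb))⟩
  · intro _ a ha b hb
    simp only [List.mem_append] at ha
    rcases ha with ha | ha
    · exact hle a ha b (hmem b (.inr hb))
    · exact p8 a ha b hb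
  · intro h; simp only at h; omega
  · intro h; simp only at h; omega
  · intro h; simp only at h; omega
  · rw [Node.not_violates_iff]
    rcases p5 with h | h
    · right
      refine ⟨fun _ => ?_, fun h => ?_⟩
      · simp [h]
      · simp only at h; omega
    · exact .inl h
  · simp [Node.isDead_eq_false_iff, p3]
  · rw [Node.cont_eq, Node.cont_eq x, p6]
    simp only [← Multiset.coe_add]
    abel
  · rw [treePot_succ, treePot_succ, ownPot_of_le hk, ownPot_of_le hk]
    simp only [List.length_append, Nat.cast_add]
    rw [elemWeight_eq (by omega : k ≤ D + 1)] at p9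
    have hF : (0 : ℝ) ≤ P.full := Nat.cast_nonneg _
    have hie : x.kids.isEmpty = false := by simpa using hne
    rw [hie]
    rcases p5 with h | h
    · have hh : (P.full : ℝ) ≤ 2 * es.length := by
        rw [h]; exact_mod_cast P.full_le_two_mul_half
      have : (if ys.isEmpty then (0 : ℝ) else 240 * P.full) ≤ 240 * P.full := by
        split_ifs <;> linarith
      simp only [Bool.false_eq_true, if_false]
      linarith
    · subst h
      simp only [List.isEmpty_nil, if_true, Bool.false_eq_true, if_false]
      have : (0 : ℝ) ≤ es.length := Nat.cast_nonneg _
      linarith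

/-! ### Sift at cnodes of the lowest rank -/

/-- A round at the lowest cnode rank converts the potential of the elements of pnodes into that of a
listnode. -/
theorem siftBase_spec (hP : P.Ok) (hk : k = P.r) (hD : k ≤ D)
    {f : Node α → Node α × ℕ} (hf : SiftSpec P D k f) :
    SiftSpec P D (k + 1) (siftBase P f) := by
  intro x hx hv
  obtain ⟨hrank, hlen, hkids, hshape⟩ := hx
  obtain ⟨hne, -, hv2⟩ := Node.violates_iff.1 hv
  have hr : P.r < x.rank := by omega
  have hr' : P.r < k + 1 := by omega
  have hs : P.s x.rank = 2 := by
    rw [Params.s_of_lt hr, hrank, hk]; simp [sAux]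
  have hv3 := hv2 hr
  rw [hs] at hv3
  obtain ⟨es, ys, c, hp, p1, p2, p3, p4, p5, p6, -, -, p9⟩ :=
    pull_spec hP (by omega) hf hne hlen hkids
  have hF : (0 : ℝ) ≤ P.full := Nat.cast_nonneg _
  have hw := le_elemWeight hD
  have hlw := listWeight_le (P := P) (k := k + 1) hr'
  have hlw0 := listWeight_nonneg (P := P) (k := k + 1)
  have hie : x.kids.isEmpty = false := by simpa using hne
  have hhalf : (P.full : ℝ) ≤ 2 * P.half := by exact_mod_cast P.full_le_two_mul_half
  have hhf := hP.half_le_full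
  have h1h := hP.one_le_half
  have hBF : (2 : ℝ) * P.B ≤ P.full := by exact_mod_cast hP.two_mul_B_le_full
  have hespos : 0 < es.length := List.length_pos_of_ne_nil p3
  -- What a single extraction costs, in terms of the listnode that it makes.
  have paid : ∀ (n : ℕ) (zs : List (Node α)), (n = P.half ∨ zs = []) →
      120 * (P.full : ℝ) + (if zs.isEmpty then (0 : ℝ) else 240 * P.full) ≤
      240 * P.full + n * elemWeight D k := by
    intro n zs h
    have : (0 : ℝ) ≤ n * elemWeight D k := mul_nonneg (Nat.cast_nonneg _) elemWeight_nonneg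
    rcases h with rfl | rfl
    · have : (480 : ℝ) * P.half ≤ P.half * elemWeight D k := by
        rw [mul_comm]; gcongr
      split_ifs <;> linarith
    · simp only [List.isEmpty_nil, if_true]; linarith
  -- The conditions that depend on the new list of listnodes and the new children alone.
  have finish : ∀ (ls : List (List α)) (zs : List (Node α)) (ck : WithBot α) (d : ℕ),
      (∀ z ∈ zs, Tree P k z ∧ z.Good P) → zs.length ≤ P.q →
      (∀ l ∈ ls, l ≠ []) → (∀ l ∈ ls, l.length ≤ P.full) → ls ≠ [] →
      (2 ≤ ls.length ∨ zs = []) →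
      (ls.flatten : Multiset α) + contAll zs = (x.lists.flatten : Multiset α) + contAll x.kids →
      (P.B : ℝ) * d + (if zs.isEmpty then (0 : ℝ) else 240 * P.full) +
        ls.length * listWeight P (k + 1) + potAll P D k zs ≤
        240 * P.full + x.lists.length * listWeight P (k + 1) + potAll P D k x.kids →
      Tree P (k + 1) ⟨x.rank, x.arr, ls, ck, zs⟩ ∧ Node.Good P ⟨x.rank, x.arr, ls, ck, zs⟩ ∧
      Node.cont ⟨x.rank, x.arr, ls, ck, zs⟩ = x.cont ∧
      (P.B : ℝ) * d + treePot P D (k + 1) ⟨x.rank, x.arr, ls, ck, zs⟩ ≤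
        treePot P D (k + 1) x := by
    intro ls zs ck d h1 h2 h3 h4 h5 h6 h7 h8
    refine ⟨⟨hrank, h2, h1, ⟨?_, ?_, ?_, ?_, ?_, ?_⟩⟩, ⟨?_, ?_⟩, ?_, ?_⟩
    · intro h; simp only at h; omega
    · intro h; simp only at h; omega
    · intro h; simp only at h; omega
    · exact fun _ => hshape.arr_eq hr
    · exact fun _ => h3
    · exact fun _ => h4
    · rw [Node.not_violates_iff]
      rcases h6 with h | h
      · right
        refine ⟨fun h => ?_, fun _ => ?_⟩
        · simp only at h; omega
        · simpa [hs] using h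
      · exact .inl h
    · simp [Node.isDead_eq_false_iff, h5]
    · rw [Node.cont_eq, Node.cont_eq x, add_assoc, add_assoc]
      simp only [h7]
    · rw [treePot_succ, treePot_succ, ownPot_of_lt hr', ownPot_of_lt hr', hie]
      simp only [Bool.false_eq_true, if_false]
      linarith
  cases hxl : x.lists with
  | nil =>
    by_cases hys : ys = []
    · subst hys
      have : siftBase P f x = (⟨x.rank, x.arr, [es], maxKey [es], []⟩, c + 0 + 4) := by
        simp [siftBase, hp, hxl, p4]
      rw [this]
      apply finish
      · simp
      · simp
      · simpa using p3
      · simpa using p4.trans hhf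
      · simp
      · exact .inr rfl
      · rw [p6, hxl]; simp
      · have := paid _ _ p5
        simp only [List.isEmpty_nil, if_true, potAll_nil, List.length_singleton, hxl,
          List.length_nil] at *
        push_cast
        linarith
    · have hes : es.length = P.half := p5.resolve_right hys
      obtain ⟨es', zs, c', hp', p1', p2', p3', p4', p5', p6', -, -, p9'⟩ :=
        pull_spec (x := { x with kids := ys }) hP (by omega) hf hys p2 p1
      have hes'pos : 0 < es'.length := List.length_pos_of_ne_nil p3'
      have hlt : ¬ (es ++ es').length ≤ P.half := by rw [List.length_append]; omega
      have : siftBase P f x = (⟨x.rank, x.arr, [es, es'], maxKey [es, es'], zs⟩, c + c' + 4) := by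
        simp only [hxl] at hp'
        simp only [siftBase, hp, hxl]
        have : ys.isEmpty = false := by simpa using hys
        simp only [this, Bool.false_eq_true, if_false, hp', hlt]
        rw [← hes, List.take_left, List.drop_left]
      rw [this]
      apply finish
      · exact p1'
      · exact p2'
      · simpa using ⟨p3, p3'⟩
      · simpa using ⟨p4.trans hhf, p4'.trans hhf⟩
      · simp
      · simp
      · rw [p6, hxl]
        simp only [] at p6'
        rw [p6']
        simp only [List.flatten_cons, List.flatten_nil, List.append_nil, ← Multiset.coe_add,
          Multiset.coe_nil, zero_add, add_assoc]
      · have q1 := paid _ _ p5'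
        have q2 : (480 : ℝ) * es.length ≤ es.length * elemWeight D k := by
          rw [mul_comm]; gcongr
        rw [hes] at q2 p9
        simp only [List.length_cons, List.length_nil, hxl] at *
        push_cast
        linarith
  | cons l rest =>
    have hrest : rest = [] := by
      rw [hxl] at hv3
      simp at hv3
      exact hv3
    subst hrest
    have hl0 : l ≠ [] := hshape.lists_ne hr l (by simp [hxl])
    have hlF : l.length ≤ P.full := hshape.lists_le hr l (by simp [hxl])
    have hcost : (P.B : ℝ) * ((c + 2 * P.blocks l.length + 2 * P.blocks es.length + 4 : ℕ) : ℝ) ≤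
        P.B * c + 10 * P.full := by
      have b1 := hP.B_mul_blocks_le l.length
      have b2 := hP.B_mul_blocks_le es.length
      have g1 := hP.two_mul_B_le_full
      have : P.B * (c + 2 * P.blocks l.length + 2 * P.blocks es.length + 4) ≤
        P.B * c + 10 * P.full := by
        have e1 : P.B * (2 * P.blocks l.length) = 2 * (P.B * P.blocks l.length) := by ring
        have e2 : P.B * (2 * P.blocks es.length) = 2 * (P.B * P.blocks es.length) := by ring
        simp only [mul_add, e1, e2]
        omega
      exact_mod_cast this
    have main : ∀ (ls : List (List α)), 1 ≤ ls.length → ls.length ≤ 2 → (∀ l ∈ ls, l ≠ []) →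
        (∀ l ∈ ls, l.length ≤ P.full) → (2 ≤ ls.length ∨ ys = []) →
        (ls.flatten : Multiset α) = (es : Multiset α) + (l : Multiset α) → 
        siftBase P f x = (⟨x.rank, x.arr, ls, maxKey ls, ys⟩,
          c + 2 * P.blocks l.length + 2 * P.blocks es.length + 4) → 
        Tree P (k + 1) (siftBase P f x).1 ∧ Node.Good P (siftBase P f x).1 ∧
        Node.cont (siftBase P f x).1 = x.cont ∧
        (P.B : ℝ) * (siftBase P f x).2 + treePot P D (k + 1) (siftBase P f x).1 ≤
          treePot P D (k + 1) x := by
      intro ls h0 h1 h2 h3 h4 h5 h6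
      rw [h6]
      apply finish _ _ _ _ p1 p2 h2 h3 (List.ne_nil_of_length_pos h0) h4
      · rw [h5, hxl, p6]
        simp only [List.flatten_cons, List.flatten_nil, List.append_nil]
        abel
      · have := paid _ _ p5
        have h1' : (ls.length : ℝ) ≤ 2 := by exact_mod_cast h1
        have : (ls.length : ℝ) * listWeight P (k + 1) ≤ 2 * listWeight P (k + 1) := by gcongr
        simp only [hxl, List.length_singleton, Nat.cast_one, one_mul]
        linarith
    by_cases he : es.length = P.half
    · apply main [es, l]
      · simp
      · simp
      · simpa using ⟨p3, hl0⟩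
      · simpa using ⟨p4.trans hhf, hlF⟩
      · simp
      · simp
      · simp [siftBase, hp, hxl, he]
    · have hys := p5.resolve_left he
      by_cases hle : l.length + es.length ≤ P.half
      · apply main [l ++ es]
        · simp
        · simp
        · simp [hl0]
        · simp; omega
        · exact .inr hys
        · simp [List.perm_append_comm]
        · simp [siftBase, hp, hxl, he, hle]
      · apply main [l ++ es.take (P.half - l.length), es.drop (P.half - l.length)]
        · simp
        · simp
        · simp [hl0]; omega
        · simp; omega
        · exact .inr hys
        · simp only [List.flatten_cons, List.flatten_nil, List.append_nil, List.append_assoc,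
            List.take_append_drop]
          simp [List.perm_append_comm]
        · simp [siftBase, hp, hxl, he, hle]

end

section

variable {α : Type u}

/-! ### Sift at cnodes of higher rank -/

theorem joinLists_spec (P : Params) (lx ly : List (List α)) :
    ((joinLists P lx ly).flatten : Multiset α) = (lx.flatten : Multiset α) + ly.flatten ∧
    (joinLists P lx ly).length ≤ lx.length + ly.length ∧
    (ly ≠ [] → joinLists P lx ly ≠ []) ∧
    ((∀ l ∈ lx, l ≠ []) → (∀ l ∈ ly, l ≠ []) → ∀ l ∈ joinLists P lx ly, l ≠ []) ∧
    ((∀ l ∈ lx, l.length ≤ P.full) → (∀ l ∈ ly, l.length ≤ P.full) →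
      ∀ l ∈ joinLists P lx ly, l.length ≤ P.full) := by
  have triv : ((lx ++ ly).flatten : Multiset α) = (lx.flatten : Multiset α) + ly.flatten ∧
    (lx ++ ly).length ≤ lx.length + ly.length ∧
    (ly ≠ [] → lx ++ ly ≠ []) ∧
    ((∀ l ∈ lx, l ≠ []) → (∀ l ∈ ly, l ≠ []) → ∀ l ∈ lx ++ ly, l ≠ []) ∧
    ((∀ l ∈ lx, l.length ≤ P.full) → (∀ l ∈ ly, l.length ≤ P.full) →
      ∀ l ∈ lx ++ ly, l.length ≤ P.full) := by
    refine ⟨by simp, by simp, fun h => by simp [h], ?_, ?_⟩ <;>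
    · intro h1 h2 l hl
      exact (List.mem_append.1 hl).elim (h1 l) (h2 l)
  unfold joinLists
  rcases List.eq_nil_or_concat lx with rfl | ⟨lx, a, rfl⟩
  · simp
  rcases List.eq_nil_or_concat ly with rfl | ⟨ly, b, rfl⟩
  · simp
  simp only [List.concat_eq_append, List.getLast?_append, List.getLast?_singleton, Option.some_or,
    List.dropLast_append_of_ne_nil (List.cons_ne_nil _ _), List.dropLast_singleton,
    List.append_nil] at triv ⊢
  split_ifs with h1 h2
  · refine ⟨?_, by simp, by simp, ?_, ?_⟩
    · simp only [List.flatten_append, List.flatten_cons, List.flatten_nil, List.append_nil,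
        ← Multiset.coe_add]
      abel
    · intro g1 g2 l hl
      simp only [List.mem_append, List.mem_singleton] at g1 g2 hl
      rcases hl with (hl | hl) | rfl
      · exact g1 l (.inl hl)
      · exact g2 l (.inl hl)
      · simp [g1 a (.inr rfl)]
    · intro g1 g2 l hl
      simp only [List.mem_append, List.mem_singleton] at g1 g2 hl
      rcases hl with (hl | hl) | rfl
      · exact g1 l (.inl hl)
      · exact g2 l (.inl hl)
      · simpa using h1
  · exact triv
  · refine ⟨?_, by simp; omega, by simp, ?_, ?_⟩
    · simp only [List.flatten_append, List.flatten_cons, List.flatten_nil, List.append_nil,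
        ← Multiset.coe_add]
      abel
    · intro g1 g2 l hl
      simp only [List.mem_append, List.mem_singleton] at g1 g2 hl
      rcases hl with (hl | hl) | rfl
      · exact g1 l (.inl hl)
      · exact g2 l hl
      · exact g1 l (.inr rfl)
    · intro g1 g2 l hl
      simp only [List.mem_append, List.mem_singleton] at g1 g2 hl
      rcases hl with (hl | hl) | rfl
      · exact g1 l (.inl hl)
      · exact g2 l hl
      · exact g1 l (.inr rfl)

theorem joinCost_le {P : Params} (hP : P.Ok) (lx ly : List (List α)) :
    P.B * joinCost P lx ly ≤ 10 * P.full := by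
  have g1 := hP.two_mul_B_le_full
  unfold joinCost
  split
  · rename_i a b _ _
    have b1 := hP.B_mul_blocks_le a.length
    have b2 := hP.B_mul_blocks_le b.length
    have b3 := hP.B_mul_blocks_le (a.length + b.length)
    split_ifs
    · simp only [mul_add]
      omega
    · omega
  · omega

theorem ownPot_le_treePot {P : Params} {D k : ℕ} (x : Node α) :
    ownPot P D k x ≤ treePot P D k x := by
  cases k with
  | zero => exact le_rfl
  | succ k =>
    rw [treePot_succ]
    linarith [potAll_nonneg (P := P) (D := D) (k := k) x.kids]

variable [LinearOrder α] {P : Params} {D k : ℕ}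

theorem minCkey_eq_none {xs : List (Node α)} (h : minCkey xs = none) : xs = [] := by
  cases xs with
  | nil => rfl
  | cons x xs =>
    rw [minCkey] at h
    split at h
    · simp at h
    · split_ifs at h

theorem minCkey_eq_some {xs : List (Node α)} {j : ℕ} {y : Node α}
    (h : minCkey xs = some (j, y)) : ∃ l₁ l₂, xs = l₁ ++ y :: l₂ ∧ j = l₁.length := by
  induction xs generalizing j y with
  | nil => simp [minCkey] at h
  | cons x xs ih =>
    rw [minCkey] at h
    split at h
    · simp only [Option.some.injEq, Prod.mk.injEq] at h
      obtain ⟨rfl, rfl⟩ := h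
      exact ⟨[], xs, rfl, rfl⟩
    · rename_i i z hz
      split_ifs at h <;> simp only [Option.some.injEq, Prod.mk.injEq] at h <;>
        obtain ⟨rfl, rfl⟩ := h
      · exact ⟨[], xs, rfl, rfl⟩
      · obtain ⟨l₁, l₂, rfl, rfl⟩ := ih hz
        exact ⟨x :: l₁, l₂, rfl, rfl⟩

/-- The result of a round of the loop: the children of a cnode after one of them, `y`, has given
away its list. -/
theorem takeList_spec (hk : P.r < k) {f : Node α → Node α × ℕ}
    (hf : SiftSpec P D k f) {l₁ l₂ : List (Node α)} {y : Node α}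
    (hlen : (l₁ ++ y :: l₂).length ≤ P.q) (hkids : ∀ z ∈ l₁ ++ y :: l₂, Tree P k z ∧ z.Good P) :
    ∃ zs c, (if y.kids.isEmpty then ((l₁ ++ y :: l₂).eraseIdx l₁.length, 0)
        else ((l₁ ++ y :: l₂).set l₁.length (f { y with lists := [] }).1,
          (f { y with lists := [] }).2)) = (zs, c) ∧
      (∀ z ∈ zs, Tree P k z ∧ z.Good P) ∧ zs.length ≤ P.q ∧
      contAll zs + (y.lists.flatten : Multiset α) = contAll (l₁ ++ y :: l₂) ∧
      (P.B : ℝ) * c + potAll P D k zs + 20 * P.full + y.lists.length * listWeight P (k + 1) ≤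
        potAll P D k (l₁ ++ y :: l₂) := by
  obtain ⟨hy, hyg⟩ := hkids y (by simp)
  have hyr : P.r < y.rank := hy.rank_eq.symm ▸ hk
  have hya := hy.shape.arr_eq hyr
  have hlw := listWeight_succ_le hk
  have hF : (0 : ℝ) ≤ P.full := Nat.cast_nonneg _
  have hs2 : (2 : ℝ) ≤ P.s k := by exact_mod_cast Params.two_le_s hk
  have hL : (0 : ℝ) ≤ y.lists.length := Nat.cast_nonneg _
  have hown := ownPot_of_lt (D := D) hk y
  by_cases hyk : y.kids = []
  · refine ⟨l₁ ++ l₂, 0, ?_, ?_, ?_, ?_, ?_⟩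
    · simp [hyk, List.eraseIdx_append_of_length_le]
    · intro z hz
      refine hkids z ?_
      simp only [List.mem_append, List.mem_cons] at hz ⊢
      tauto
    · simp at hlen ⊢; omega
    · simp only [contAll_append, contAll_cons, Node.cont_eq y, hyk, hya, contAll_nil,
        Multiset.coe_nil]
      abel
    · have h1 := ownPot_le_treePot (P := P) (D := D) (k := k) y
      rw [hown] at h1
      have h2 : (0 : ℝ) ≤ 40 * P.full / P.s k := by positivity
      have h3 : (y.lists.length : ℝ) * listWeight P (k + 1) ≤ y.lists.length * listWeight P k := by
        gcongr
        linarith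
      simp only [hyk, List.isEmpty_nil, if_true] at h1
      simp only [potAll_append, potAll_cons]
      push_cast
      linarith
  · have hv : Node.violates P { y with lists := [] } = true := by
      refine Node.violates_iff.2 ⟨hyk, fun h => ?_, fun _ => by simp⟩
      simp only at h; omega
    have hT : Tree P k { y with lists := [] } := by
      refine hy.congr rfl rfl ⟨?_, ?_, ?_, fun _ => hya, ?_, ?_⟩
      · exact fun _ => rfl
      · intro h; simp only at h; omega
      · intro h; simp only at h; omega
      · intro _; simp
      · intro _; simp
    obtain ⟨u1, u2, u3, u4⟩ := hf _ hT hv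
    generalize f { y with lists := [] } = u at *
    refine ⟨l₁ ++ u.1 :: l₂, u.2, ?_, ?_, ?_, ?_, ?_⟩
    · simp [hyk]
    · intro z hz
      simp only [List.mem_append, List.mem_cons] at hz
      rcases hz with hz | rfl | hz
      · exact hkids z (by simp [hz])
      · exact ⟨u1, u2⟩
      · exact hkids z (by simp [hz])
    · simp at hlen ⊢; omega
    · simp only [contAll_append, contAll_cons, u3, Node.cont_eq y]
      rw [Node.cont_eq]
      simp only [List.flatten_nil, Multiset.coe_nil]
      abel
    · have h1 := treePot_congr (P := P) (D := D) (k := k) (x := y)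
        (y := { y with lists := [] }) rfl
      rw [hown, ownPot_of_lt hk] at h1
      have h2 : ((P.s k : ℕ) : ℝ) ≤ 2 * y.lists.length := by
        have := hyg.le_lists hyr hyk
        rw [hy.rank_eq] at this
        exact_mod_cast (by omega : P.s k ≤ 2 * y.lists.length)
      -- Each of the listnodes saves `40 B q / s k`, and there are at least `s k / 2` of them.
      have h3 : (20 : ℝ) * P.full ≤ y.lists.length * (40 * P.full / P.s k) := by
        rw [mul_div_assoc', le_div_iff₀ (by linarith)]
        nlinarith
      have h4 : (y.lists.length : ℝ) * (listWeight P (k + 1) + 40 * P.full / P.s k) ≤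
          y.lists.length * listWeight P k := by gcongr
      simp only [potAll_append, potAll_cons]
      simp only [List.length_nil, Nat.cast_zero, zero_mul] at h1
      linarith

/-- The loop of Sift at a cnode. As every round consumes the nonempty list of a child, a bound `n`
for the number of elements below the node is enough fuel to reach `s (k + 1)` listnodes or a
leaf. -/
theorem siftLoop_spec (hP : P.Ok) (hk : P.r < k) {f : Node α → Node α × ℕ}
    (hf : SiftSpec P D k f) (n : ℕ) (x : Node α) (hx : Tree P (k + 1) x)
    (hn : Multiset.card (contAll x.kids) ≤ n) :
    Tree P (k + 1) (siftLoop P f n x).1 ∧ (siftLoop P f n x).1.cont = x.cont ∧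
    (P.s (k + 1) ≤ (siftLoop P f n x).1.lists.length ∨ (siftLoop P f n x).1.kids = []) ∧
    (x.lists ≠ [] ∨ x.kids ≠ [] → (siftLoop P f n x).1.lists ≠ []) ∧
    (P.B : ℝ) * (siftLoop P f n x).2 + treePot P D (k + 1) (siftLoop P f n x).1 ≤
      treePot P D (k + 1) x := by
  induction n generalizing x with
  | zero =>
    have hkid : x.kids = [] := by
      by_contra hne
      obtain ⟨y, ys, h⟩ := List.exists_cons_of_ne_nil hne
      obtain ⟨h1, h2⟩ := hx.2.2.1 y (by simp [h])
      have h3 := h2.elems_ne hP h1.shape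
      have : contAll x.kids = 0 := by simpa using hn
      rw [h, contAll_cons] at this
      have : y.cont = 0 := (add_eq_zero.1 this).1
      simp [Node.cont] at this
      exact h3 this
    simp only [siftLoop]
    refine ⟨hx, trivial, .inr hkid, by simp [hkid], by simp⟩
  | succ n ih =>
    obtain ⟨hrank, hlen, hkids, hshape⟩ := hx
    have hr : P.r < x.rank := by omega
    have hkl : ∀ y ∈ x.kids, y.lists ≠ [] := fun y hy =>
      (hkids y hy).2.lists_ne_nil (hkids y hy).1.shape ((hkids y hy).1.rank_eq.symm ▸ hk)
    have hquit : (P.s (k + 1) ≤ x.lists.length ∨ x.kids = []) → Tree P (k + 1) x ∧ x.cont = x.cont ∧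
        (P.s (k + 1) ≤ x.lists.length ∨ x.kids = []) ∧
        (x.lists ≠ [] ∨ x.kids ≠ [] → x.lists ≠ []) ∧
        (P.B : ℝ) * (0 : ℕ) + treePot P D (k + 1) x ≤ treePot P D (k + 1) x := by
      intro h
      refine ⟨⟨hrank, hlen, hkids, hshape⟩, rfl, h, ?_, by simp⟩
      rintro (h1 | h1)
      · exact h1
      · have h2 := h.resolve_right h1
        have := Params.two_le_s (P := P) (k := k + 1) (by omega)
        exact List.ne_nil_of_length_pos (by omega)
    rw [siftLoop]
    split_ifs with hdone
    · refine hquit ?_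
      simp only [hrank, Bool.or_eq_true, decide_eq_true_eq, List.all_eq_true,
        List.isEmpty_iff] at hdone
      refine hdone.imp id fun h => ?_
      by_contra hne
      obtain ⟨y, ys, h'⟩ := List.exists_cons_of_ne_nil hne
      have hy : y ∈ x.kids := by simp [h']
      exact hkl y hy (h y hy)
    · split
      · rename_i hmin
        exact hquit (.inr (minCkey_eq_none hmin))
      · rename_i j y hmin
        obtain ⟨l₁, l₂, hl, rfl⟩ := minCkey_eq_some hmin
        have hy : y ∈ x.kids := by simp [hl]
        rw [hl] at hkids hlen
        obtain ⟨zs, c, hs, z1, z2, z3, z4⟩ := takeList_spec (D := D) hk hf hlen hkids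
        obtain ⟨j1, j2, j3, j4, j5⟩ := joinLists_spec P x.lists y.lists
        have hyt := (hkids y (by simp)).1
        have hyr : P.r < y.rank := hyt.rank_eq.symm ▸ hk
        have hjc := joinCost_le hP x.lists y.lists
        have hyl := hkl y hy
        rw [← hl] at hs z3 z4 hlen
        simp only [hs]
        obtain ⟨i1, i2, i3, i4, i5⟩ := ih
          { x with lists := joinLists P x.lists y.lists, ckey := y.ckey, kids := zs }
          ⟨hrank, z2, z1, ⟨fun h => by simp only at h; omega, fun h => by simp only at h; omega,
            fun h => by simp only at h; omega, fun _ => hshape.arr_eq hr,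
            fun _ => j4 (hshape.lists_ne hr) (hyt.shape.lists_ne hyr),
            fun _ => j5 (hshape.lists_le hr) (hyt.shape.lists_le hyr)⟩⟩
          (by
            have h1 := congrArg Multiset.card z3
            obtain ⟨l, ls, h2⟩ := List.exists_cons_of_ne_nil hyl
            have h3 : 0 < l.length := List.length_pos_of_ne_nil (hyt.shape.lists_ne hyr l (by simp [h2]))
            simp only [Multiset.card_add, Multiset.coe_card, h2, List.flatten_cons,
              List.length_append] at h1
            simp only
            omega)
        refine ⟨i1, ?_, i3, fun _ => i4 (.inl (j3 hyl)), ?_⟩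
        · rw [i2, Node.cont_eq, Node.cont_eq x, ← z3]
          simp only [j1]
          abel
        · generalize siftLoop P f n
            { x with lists := joinLists P x.lists y.lists, ckey := y.ckey, kids := zs } = t at *
          have hkne : x.kids.isEmpty = false := by simp [hl]
          rw [treePot_succ, treePot_succ, ownPot_of_lt (by omega), ownPot_of_lt (by omega)] at *
          have hcost : (P.B : ℝ) * ((2 * P.blocks x.kids.length + x.kids.length +
              joinCost P x.lists y.lists : ℕ) : ℝ) ≤ 15 * P.full := by
            have b1 := hP.B_mul_blocks_le x.kids.length
            have g1 := hP.two_mul_B_le_full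
            have g2 := hP.q_le_full
            have g4 : P.B * x.kids.length ≤ P.full := Nat.mul_le_mul_left _ hlen
            have e1 : P.B * (2 * P.blocks x.kids.length) = 2 * (P.B * P.blocks x.kids.length) := by
              ring
            have : P.B * (2 * P.blocks x.kids.length + x.kids.length +
                joinCost P x.lists y.lists) ≤ 15 * P.full := by
              simp only [mul_add, e1]
              omega
            exact_mod_cast this
          have hF : (0 : ℝ) ≤ P.full := Nat.cast_nonneg _
          have hif : (if zs.isEmpty then (0 : ℝ) else 240 * P.full) ≤ 240 * P.full := by
            split_ifs <;> linarith
          have hj : ((joinLists P x.lists y.lists).length : ℝ) * listWeight P (k + 1) ≤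
              (x.lists.length + y.lists.length) * listWeight P (k + 1) := by
            have := listWeight_nonneg (P := P) (k := k + 1)
            gcongr
            exact_mod_cast j2
          simp only [hkne, Bool.false_eq_true, if_false] at *
          rw [Nat.cast_add, Nat.cast_add, mul_add, mul_add]
          linarith

/-! ### Sift -/

theorem siftAt_spec (hP : P.Ok) (hD : min k P.r ≤ D) : SiftSpec P D k (siftAt (α := α) P k) := by
  induction k with
  | zero =>
    intro x hx hv
    have := Node.violates_of_kids_eq_nil (P := P) hx.2.1
    simp [this] at hv
  | succ k ih =>
    have ih := ih (by omega)
    intro x hx hv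
    rw [siftAt]
    split_ifs with h1 h2
    · exact siftPnode_spec hP h1 (by omega) ih x hx hv
    · exact siftBase_spec hP h2 (by omega) ih x hx hv
    · have hk : P.r < k := by omega
      obtain ⟨i1, i2, i3, i4, i5⟩ := siftLoop_spec hP hk ih (elemsAll x.kids).length x hx
        (by simp [contAll])
      refine ⟨i1, ⟨?_, ?_⟩, i2, i5⟩
      · rw [Node.not_violates_iff, i1.rank_eq]
        rcases i3 with h | h
        · refine .inr ⟨fun h => by omega, fun h' => ?_⟩
          have := Params.two_le_s h'
          omega
        · exact .inl h
      · rw [Node.isDead_eq_false_iff]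
        exact .inr (.inr (i4 (.inr (Node.violates_iff.1 hv).1)))

theorem sift_spec (hP : P.Ok) (hD : min k P.r ≤ D) : SiftSpec P D k (sift (α := α) P) := by
  intro x hx hv
  have := siftAt_spec hP hD x hx hv
  unfold sift
  rwa [hx.rank_eq]

end

section

variable {α : Type u}

/-! ### Buckets -/

/-- The multiset of the elements in a bucket and its trees. -/
def Bucket.cont (b : Bucket α) : Multiset α := b.elems

theorem Bucket.cont_eq (b : Bucket α) :
    b.cont = ((b.mem ++ b.disk).map Prod.fst : List α) + contAll b.roots := by
  simp [Bucket.cont, Bucket.elems, contAll]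

/-- The multiset of the elements in a bucket that need not exist. -/
def optCont (o : Option (Bucket α)) : Multiset α := (o.map Bucket.cont).getD 0

/-- The invariant of the bucket of rank `i`. The bucket may be empty: it is then about to be
filled up or to be melded. -/
structure Bucket.OK [LinearOrder α] (P : Params) (i : ℕ) (b : Bucket α) : Prop where
  roots_ne : b.roots ≠ []
  roots_lt : b.roots.length < P.q
  tree : ∀ x ∈ b.roots, Tree P i x
  disk_eq : b.mem = [] → b.disk = []
  size_le : (b.mem ++ b.disk).length ≤ P.full
  pos_lt : ∀ e ∈ b.mem ++ b.disk, e.2 < b.roots.length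
  sorted : i ≤ P.r → ((b.mem ++ b.disk).map Prod.fst).Pairwise (· ≤ ·)
  le_roots : i ≤ P.r → ∀ a ∈ (b.mem ++ b.disk).map Prod.fst, ∀ c ∈ elemsAll b.roots, a ≤ c

/-- A part of the potential of a bucket that is present as long as there are elements below it.
It pays for the last time that the bucket is filled up. -/
noncomputable def restPot (P : Params) (xs : List (Node α)) : ℝ :=
  if Multiset.card (contAll xs) = 0 then 0 else 20 * P.full

/-- The potential of an empty bucket of rank `i` with the given roots, times `B`. -/
noncomputable def rootsPot (P : Params) (D i : ℕ) (xs : List (Node α)) : ℝ :=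
  600 * P.full + 1700 * P.B * xs.length + potAll P D i xs + restPot P xs

/-- The potential of a bucket of rank `i`, times `B`: to that of its roots are added one I/O for
each block that still has to be loaded and, in the case of pnodes, the potential that its
elements would have one rank higher. -/
noncomputable def bucketPot (P : Params) (D i : ℕ) (b : Bucket α) : ℝ :=
  rootsPot P D i b.roots + P.B * ((b.disk.length + P.B - 1) / P.B : ℕ) +
    (b.mem ++ b.disk).length * (if i ≤ P.r then elemWeight D (i + 1) else 0)

/-- The potential of a bucket of rank `i` that need not exist, times `B`. -/
noncomputable def optPot (P : Params) (D i : ℕ) (o : Option (Bucket α)) : ℝ :=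
  (o.map (bucketPot P D i)).getD 0

section

variable {P : Params} {D i : ℕ}

theorem restPot_nonneg (xs : List (Node α)) : 0 ≤ restPot P xs := by
  unfold restPot; split_ifs <;> positivity

theorem restPot_le (xs : List (Node α)) : restPot P xs ≤ 20 * P.full := by
  unfold restPot
  split_ifs
  · positivity
  · exact le_rfl

theorem restPot_mono {xs ys : List (Node α)}
    (h : Multiset.card (contAll xs) ≤ Multiset.card (contAll ys)) :
    restPot P xs ≤ restPot P ys := by
  unfold restPot
  split_ifs
  · exact le_rfl
  · positivity
  · omega
  · exact le_rfl

theorem rootsPot_nonneg (xs : List (Node α)) : 0 ≤ rootsPot P D i xs := by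
  have := potAll_nonneg (P := P) (D := D) (k := i) xs
  have := restPot_nonneg (P := P) xs
  unfold rootsPot
  positivity

theorem rootsPot_le_bucketPot (b : Bucket α) : rootsPot P D i b.roots ≤ bucketPot P D i b := by
  have := elemWeight_nonneg (D := D) (k := i + 1)
  have h1 : (0 : ℝ) ≤ P.B * ((b.disk.length + P.B - 1) / P.B : ℕ) := by positivity
  have h2 : (0 : ℝ) ≤ (b.mem ++ b.disk).length * (if i ≤ P.r then elemWeight D (i + 1) else 0) := by
    split_ifs <;> positivity
  unfold bucketPot
  linarith

theorem bucketPot_nonneg (b : Bucket α) : 0 ≤ bucketPot P D i b :=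
  (rootsPot_nonneg _).trans (rootsPot_le_bucketPot b)

theorem optPot_nonneg (o : Option (Bucket α)) : 0 ≤ optPot P D i o := by
  cases o with
  | none => exact le_rfl
  | some b => exact bucketPot_nonneg b

theorem contAll_eq_zero_of_dead {xs : List (Node α)} (h : ∀ x ∈ xs, x.isDead = true) :
    contAll xs = 0 := by
  induction xs with
  | nil => rfl
  | cons x xs ih =>
    rw [contAll_cons, Node.cont_of_isDead (h x List.mem_cons_self),
      ih fun y hy => h y (List.mem_cons_of_mem _ hy), zero_add]

theorem Params.B_mul_ceil_le (P : Params) (n : ℕ) :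
    P.B * ((n + P.B - 1) / P.B) ≤ n + P.B := by
  have := Nat.mul_div_le (n + P.B - 1) P.B
  omega

end

theorem mkBucket_append (P : Params) (xs : List (Node α)) (es : List (α × ℕ)) :
    (mkBucket P xs es).mem ++ (mkBucket P xs es).disk = es := List.take_append_drop _ _

theorem mkBucket_mem_ne {P : Params} (hP : P.Ok) {xs : List (Node α)} {es : List (α × ℕ)}
    (h : es ≠ []) : (mkBucket P xs es).mem ≠ [] := by
  have := hP.one_le_B
  simp only [mkBucket, ne_eq, List.take_eq_nil_iff, not_or]
  exact ⟨by omega, h⟩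

theorem bucketPot_mkBucket {P : Params} {D i : ℕ} (xs : List (Node α)) (es : List (α × ℕ)) :
    bucketPot P D i (mkBucket P xs es) = rootsPot P D i xs +
      P.B * (((es.drop P.B).length + P.B - 1) / P.B : ℕ) +
      es.length * (if i ≤ P.r then elemWeight D (i + 1) else 0) := by
  rw [bucketPot, mkBucket_append]
  rfl

variable [LinearOrder α] {P : Params} {D i : ℕ}

theorem mkBucket_OK (hP : P.Ok) {xs : List (Node α)} {es : List (α × ℕ)}
    (h1 : xs ≠ []) (h2 : xs.length < P.q) (h3 : ∀ x ∈ xs, Tree P i x) (h4 : es.length ≤ P.full)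
    (h5 : ∀ e ∈ es, e.2 < xs.length) (h6 : i ≤ P.r → (es.map Prod.fst).Pairwise (· ≤ ·))
    (h7 : i ≤ P.r → ∀ a ∈ es.map Prod.fst, ∀ c ∈ elemsAll xs, a ≤ c) :
    (mkBucket P xs es).OK P i := by
  have hm := mkBucket_append P xs es
  refine ⟨h1, h2, h3, fun h => ?_, by rwa [hm], by rwa [hm], by rwa [hm], by rwa [hm]⟩
  by_contra hd
  have : es ≠ [] := by
    rintro rfl
    simp [mkBucket] at hd
  exact mkBucket_mem_ne hP this h

/-- Fill-Up is paid by the potential of the roots. -/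
theorem fillUp_spec (hP : P.Ok) (hD : min i P.r ≤ D) {xs : List (Node α)}
    (hlen : xs.length < P.q) (hxs : ∀ x ∈ xs, Tree P i x) :
    (∀ b, (fillUp P i xs).1 = some b →
      b.OK P i ∧ b.mem ≠ [] ∧ b.roots.length ≤ xs.length) ∧
    optCont (fillUp P i xs).1 = contAll xs ∧
    (P.B : ℝ) * (fillUp P i xs).2 + optPot P D i (fillUp P i xs).1 ≤ rootsPot P D i xs := by
  obtain ⟨r1, r2, r3, r4⟩ := restoreWith_spec (sift_spec hP hD) hxs
  change ∀ y ∈ (restore P xs).1, _ at r1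
  change (restore P xs).1.length ≤ _ at r2
  change contAll (restore P xs).1 = _ at r3
  change (P.B : ℝ) * (restore P xs).2 + potAll P D i (restore P xs).1 ≤ _ at r4
  have hF : (0 : ℝ) ≤ P.full := Nat.cast_nonneg _
  have g1 := hP.two_mul_B_le_full
  have g3 := hP.half_le_full
  have hBx : P.B * xs.length ≤ P.full := Nat.mul_le_mul_left _ hlen.le
  have hBx' : (P.B : ℝ) * xs.length ≤ P.full := by exact_mod_cast hBx
  have hres := restPot_nonneg (P := P) xs
  -- A bucket without elements ceases to exist.
  have none_case : (restore P xs).1 = [] → ∀ n, n = (restore P xs).2 →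
      (∀ b, (none : Option (Bucket α)) = some b →
        b.OK P i ∧ b.mem ≠ [] ∧ b.roots.length ≤ xs.length) ∧
      optCont (none : Option (Bucket α)) = contAll xs ∧
      (P.B : ℝ) * n + optPot P D i (none : Option (Bucket α)) ≤ rootsPot P D i xs := by
    rintro h n rfl
    refine ⟨by simp, by rw [← r3, h]; rfl, ?_⟩
    rw [h] at r4
    simp only [optPot, Option.map_none, Option.getD_none, rootsPot, potAll_nil] at *
    nlinarith
  unfold fillUp
  generalize restore P xs = t at *
  by_cases hi : i ≤ P.r
  · simp only [hi, if_true]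
    by_cases ht : t.1 = []
    · simp only [ht, List.isEmpty_nil, if_true]
      exact none_case ht _ rfl
    · have hte : t.1.isEmpty = false := by simpa using ht
      simp only [hte, Bool.false_eq_true, if_false]
      obtain ⟨e1, e2, e3, e4, e5, e6⟩ := extract_good (D := D) hP hi ht r1
      obtain ⟨d1, d2, d3, d4, d5, d6⟩ := extract_spec P.half t.1
      have hm := mergeCost_le hP d1
      generalize extract P.half t.1 = e at *
      have hl := d1.length_eq
      refine ⟨?_, ?_, ?_⟩
      · intro b hb
        obtain rfl := Option.some.inj hb
        refine ⟨mkBucket_OK hP ?_ (by omega) e1 (d2.trans g3) (by rwa [← hl]) (fun _ => e4)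
          (fun _ => e5), mkBucket_mem_ne hP e2, ?_⟩
        · rintro h0
          rw [h0] at hl
          simp [ht] at hl
        · simp only [mkBucket]; omega
      · simp only [optCont, Option.map_some, Option.getD_some]
        rw [Bucket.cont_eq, mkBucket_append, ← r3, d4]
        rfl
      · simp only [optPot, Option.map_some, Option.getD_some]
        rw [bucketPot_mkBucket, rootsPot, rootsPot]
        simp only [hi, if_true]
        rw [elemWeight_eq (by omega : i ≤ D + 1)] at e6
        have c1 : (P.B : ℝ) * ((mergeCost P t.1 e.2 + P.blocks e.1.length + 1 : ℕ) : ℝ) +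
            P.B * (((e.1.drop P.B).length + P.B - 1) / P.B : ℕ) ≤ 13 * P.full := by
          have b1 := hP.B_mul_blocks_le e.1.length
          have b2 := P.B_mul_ceil_le (e.1.drop P.B).length
          have b3 : (e.1.drop P.B).length ≤ e.1.length := by simp
          have b4 : P.B * t.1.length ≤ P.full := Nat.mul_le_mul_left _ (r2.trans hlen.le)
          have : P.B * (mergeCost P t.1 e.2 + P.blocks e.1.length + 1) +
              P.B * (((e.1.drop P.B).length + P.B - 1) / P.B) ≤ 13 * P.full := by
            have e1 : 5 * P.B * t.1.length = 5 * (P.B * t.1.length) := by ring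
            rw [e1] at hm
            simp only [mul_add]
            omega
          exact_mod_cast this
        have c2 : (P.B : ℝ) * e.2.length ≤ P.B * xs.length := by
          gcongr
          omega
        have c3 : restPot P e.2 + 20 * P.full ≤ restPot P xs + e.1.length * 240 := by
          rcases e3 with h | h
          · have hh : (P.full : ℝ) ≤ 2 * e.1.length := by
              rw [h]; exact_mod_cast P.full_le_two_mul_half
            have : restPot P e.2 ≤ restPot P xs := by
              apply restPot_mono
              rw [← r3, d4]
              simp
            linarith
          · have : restPot P e.2 = 0 := by
              simp [restPot, contAll_eq_zero_of_dead h]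
            have h' : restPot P xs = 20 * P.full := by
              rw [restPot, if_neg]
              rw [← r3, d4, Multiset.card_add, Multiset.coe_card, List.length_map]
              have := List.length_pos_of_ne_nil e2
              omega
            have : (0 : ℝ) ≤ e.1.length * 240 := by positivity
            linarith
        push_cast at c1 ⊢
        linarith
  · simp only [hi, if_false]
    have hi' : P.r < i := by omega
    split
    · rename_i hmin
      exact none_case (minCkey_eq_none hmin) _ rfl
    · rename_i j y hmin
      obtain ⟨l₁, l₂, hl, rfl⟩ := minCkey_eq_some hmin
      obtain ⟨hy1, hy2⟩ := r1 y (by simp [hl])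
      have hyr : P.r < y.rank := hy1.rank_eq.symm ▸ hi'
      obtain ⟨l, ls, hls⟩ := List.exists_cons_of_ne_nil (hy2.lists_ne_nil hy1.shape hyr)
      have hl0 := hy1.shape.lists_ne hyr l (by simp [hls])
      have hlF := hy1.shape.lists_le hyr l (by simp [hls])
      have hya := hy1.shape.arr_eq hyr
      have hset : t.1.set l₁.length { y with lists := y.lists.tail } =
          l₁ ++ { y with lists := ls } :: l₂ := by
        simp [hl, hls]
      have hyT : Tree P i { y with lists := ls } :=
        hy1.congr rfl rfl ⟨fun h => by simp only at h; omega, fun h => by simp only at h; omega,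
          fun h => by simp only at h; omega, fun _ => hya,
          fun _ l' hl' => hy1.shape.lists_ne hyr l' (by rw [hls]; exact List.mem_cons_of_mem _ hl'),
          fun _ l' hl' => hy1.shape.lists_le hyr l' (by rw [hls]; exact List.mem_cons_of_mem _ hl')⟩
      have hcont : contAll t.1 =
          (l : Multiset α) + contAll (l₁ ++ { y with lists := ls } :: l₂) := by
        rw [hl, contAll_append, contAll_append, contAll_cons, contAll_cons, Node.cont_eq y,
          Node.cont_eq { y with lists := ls }]
        simp only [hls, List.flatten_cons, ← Multiset.coe_add]
        abel
      have hhead : y.lists.headD [] = l := by simp [hls]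
      rw [hset, hhead]
      have hlen2 : (l₁ ++ { y with lists := ls } :: l₂).length = t.1.length := by
        simp [hl]
      refine ⟨?_, ?_, ?_⟩
      · intro b hb
        obtain rfl := Option.some.inj hb
        refine ⟨mkBucket_OK hP (by simp) (by omega) ?_ (by simpa using hlF) ?_ (fun h => by omega)
          (fun h => by omega), mkBucket_mem_ne hP (by simpa using hl0), ?_⟩
        · intro z hz
          simp only [List.mem_append, List.mem_cons] at hz
          rcases hz with hz | rfl | hz
          · exact (r1 z (by simp [hl, hz])).1
          · exact hyT
          · exact (r1 z (by simp [hl, hz])).1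
        · intro e he
          obtain ⟨a, _, rfl⟩ := List.mem_map.1 he
          simp
        · simp only [mkBucket]; omega
      · simp only [optCont, Option.map_some, Option.getD_some]
        rw [Bucket.cont_eq, mkBucket_append, ← r3, hcont]
        simp [mkBucket, Function.comp_def]
      · simp only [optPot, Option.map_some, Option.getD_some]
        rw [bucketPot_mkBucket, rootsPot, rootsPot]
        simp only [hi, if_false, mul_zero, add_zero]
        have c1 : (P.B : ℝ) * ((2 * P.blocks l.length + 5 : ℕ) : ℝ) +
            P.B * ((((l.map (fun a => (a, l₁.length))).drop P.B).length + P.B - 1) / P.B : ℕ) ≤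
            13 * P.full := by
          have b1 := hP.B_mul_blocks_le l.length
          have b2 := P.B_mul_ceil_le ((l.map (fun a => (a, l₁.length))).drop P.B).length
          have b3 : ((l.map (fun a => (a, l₁.length))).drop P.B).length ≤ l.length := by simp
          have : P.B * (2 * P.blocks l.length + 5) +
              P.B * ((((l.map (fun a => (a, l₁.length))).drop P.B).length + P.B - 1) / P.B) ≤
              13 * P.full := by
            have e1 : P.B * (2 * P.blocks l.length) = 2 * (P.B * P.blocks l.length) := by ring
            rw [mul_add, e1]
            omega
          exact_mod_cast this
        have c2 : (P.B : ℝ) * (l₁ ++ { y with lists := ls } :: l₂).length ≤ P.B * xs.length := by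
          gcongr
          omega
        have c3 : restPot P (l₁ ++ { y with lists := ls } :: l₂) ≤ restPot P xs := by
          apply restPot_mono
          rw [← r3, hcont]
          simp
        have c4 := treePot_congr (P := P) (D := D) (k := i) (x := y)
          (y := { y with lists := ls }) rfl
        rw [ownPot_of_lt hi', ownPot_of_lt hi', hls, List.length_cons] at c4
        have c5 := le_listWeight (P := P) (k := i)
        rw [hl] at r4
        simp only [potAll_append, potAll_cons] at r4 ⊢
        push_cast at c1 c4 ⊢
        linarith

end

section

variable {α : Type u}

/-! ### Sending the elements of a bucket back -/

theorem sum_map_range {M : Type*} [AddCommMonoid M] (g : ℕ → M) (n : ℕ) :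
    ((List.range n).map g).sum = ∑ j ∈ Finset.range n, g j := rfl

/-- Elements of a list are put in front of the arrays of nodes. -/
def addFront (g : ℕ → List α) (xs : List (Node α)) : List (Node α) :=
  xs.mapIdx (fun j x => { x with arr := g j ++ x.arr })

theorem addFront_cons (g : ℕ → List α) (x : Node α) (xs : List (Node α)) :
    addFront g (x :: xs) =
      { x with arr := g 0 ++ x.arr } :: addFront (fun j => g (j + 1)) xs := by
  simp [addFront, List.mapIdx_cons]

theorem contAll_addFront (g : ℕ → List α) (xs : List (Node α)) :
    contAll (addFront g xs) =
      contAll xs + ∑ j ∈ Finset.range xs.length, (g j : Multiset α) := by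
  induction xs generalizing g with
  | nil => simp [addFront]
  | cons x xs ih =>
    rw [addFront_cons, contAll_cons, contAll_cons, ih, List.length_cons, Finset.sum_range_succ',
      Node.cont_eq, Node.cont_eq x]
    simp only [← Multiset.coe_add]
    abel

theorem potAll_addFront {P : Params} {D i : ℕ} (hi : i ≤ P.r) (g : ℕ → List α)
    (xs : List (Node α)) :
    potAll P D i (addFront g xs) =
      potAll P D i xs + (∑ j ∈ Finset.range xs.length, (g j).length : ℕ) * elemWeight D i := by
  induction xs generalizing g with
  | nil => simp [addFront]
  | cons x xs ih =>
    have h := treePot_congr (P := P) (D := D) (k := i) (x := x)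
      (y := { x with arr := g 0 ++ x.arr }) rfl
    rw [ownPot_of_le hi, ownPot_of_le hi] at h
    simp only [List.length_append] at h
    rw [addFront_cons, potAll_cons, potAll_cons, ih, List.length_cons, Finset.sum_range_succ']
    push_cast at h ⊢
    linarith

/-- The elements of a list are distributed according to a label below `n`. -/
theorem sum_filter_label (n : ℕ) (es : List (α × ℕ)) (h : ∀ e ∈ es, e.2 < n) :
    ∑ j ∈ Finset.range n, (((es.filter (fun e => e.2 = j)).map Prod.fst : List α) : Multiset α) =
      (es.map Prod.fst : List α) := by
  induction es with
  | nil => simp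
  | cons e es ih =>
    have he := h e List.mem_cons_self
    have : ∀ j, ((((e :: es).filter (fun e => e.2 = j)).map Prod.fst : List α) : Multiset α) =
        (if e.2 = j then {e.1} else 0) +
          (((es.filter (fun e => e.2 = j)).map Prod.fst : List α) : Multiset α) := by
      intro j
      by_cases hj : e.2 = j <;> simp [hj]
    simp only [this, Finset.sum_add_distrib]
    rw [ih fun e' he' => h e' (List.mem_cons_of_mem _ he'), Finset.sum_ite_eq]
    simp [he]

theorem putBack_spec {P : Params} {es : List α} {ls : List (List α)} (hes : es ≠ [])
    (hes' : es.length ≤ P.full) (h1 : ∀ l ∈ ls, l ≠ []) (h2 : ∀ l ∈ ls, l.length ≤ P.full) :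
    ((putBack P es ls).flatten : Multiset α) = (es : Multiset α) + ls.flatten ∧
    (putBack P es ls).length ≤ ls.length + 1 ∧
    (∀ l ∈ putBack P es ls, l ≠ []) ∧ (∀ l ∈ putBack P es ls, l.length ≤ P.full) := by
  unfold putBack
  rcases List.eq_nil_or_concat ls with rfl | ⟨ls, l, rfl⟩
  · simpa using ⟨hes, hes'⟩
  simp only [List.concat_eq_append] at *
  simp only [List.getLast?_append, List.getLast?_singleton, Option.some_or,
    List.dropLast_append_of_ne_nil (List.cons_ne_nil _ _), List.dropLast_singleton,
    List.append_nil]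
  have h1' := h1
  have h2' := h2
  simp only [List.mem_append, List.mem_singleton] at h1 h2
  split_ifs with hc hd
  · refine ⟨?_, by simp, ?_, ?_⟩
    · simp only [List.flatten_append, List.flatten_cons, List.flatten_nil, List.append_nil,
        ← Multiset.coe_add]
      abel
    · intro m hm
      simp only [List.mem_append, List.mem_singleton] at hm
      rcases hm with hm | rfl
      · exact h1 m (.inl hm)
      · simp [hes]
    · intro m hm
      simp only [List.mem_append, List.mem_singleton] at hm
      rcases hm with hm | rfl
      · exact h2 m (.inl hm)
      · have : 2 * P.half ≤ P.full + 1 := by unfold Params.half Params.full; omega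
        simp only [List.length_append]
        omega
  · refine ⟨by simp, by simp, ?_, ?_⟩
    · intro m hm
      rcases List.mem_cons.1 hm with rfl | hm
      · exact hes
      · exact h1' m hm
    · intro m hm
      rcases List.mem_cons.1 hm with rfl | hm
      · exact hes'
      · exact h2' m hm
  · refine ⟨?_, by simp, ?_, ?_⟩
    · simp only [List.flatten_append, List.flatten_cons, List.flatten_nil, List.append_nil,
        ← Multiset.coe_add]
      abel
    · intro m hm
      rcases List.mem_append.1 hm with hm | hm
      · exact h1' m hm
      · rw [List.mem_singleton.1 hm]; exact hes
    · intro m hm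
      rcases List.mem_append.1 hm with hm | hm
      · exact h2' m hm
      · rw [List.mem_singleton.1 hm]; exact hes'

variable [LinearOrder α] {P : Params} {D i : ℕ}

/-- Sending the elements of a bucket back costs `O(q)` I/Os, and the potential of the elements
increases by as much. -/
theorem flush_spec (hP : P.Ok) (hD : min i P.r ≤ D) {b : Bucket α} (hb : b.OK P i) :
    (∀ x ∈ (flush P i b).1, Tree P i x) ∧ (flush P i b).1.length = b.roots.length ∧
    contAll (flush P i b).1 = b.cont ∧
    (P.B : ℝ) * (flush P i b).2 + potAll P D i (flush P i b).1 + 600 * P.full +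
      1700 * P.B * b.roots.length ≤ bucketPot P D i b + 250 * P.full := by
  have g1 := hP.two_mul_B_le_full
  have hF : (0 : ℝ) ≤ P.full := Nat.cast_nonneg _
  have hres := restPot_nonneg (P := P) b.roots
  have hceil : (0 : ℝ) ≤ P.B * ((b.disk.length + P.B - 1) / P.B : ℕ) := by positivity
  have hdisk : b.disk.length ≤ (b.mem ++ b.disk).length := by simp
  have hsize := hb.size_le
  have hpos := hb.pos_lt
  have b1 := hP.B_mul_blocks_le b.disk.length
  unfold flush
  simp only
  rw [Bucket.cont_eq, bucketPot, rootsPot]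
  have hsorted := hb.sorted
  have hle := hb.le_roots
  generalize b.mem ++ b.disk = es at *
  by_cases hi : i ≤ P.r
  · simp only [hi, if_true]
    have hlab := sum_filter_label b.roots.length es hpos
    change (∀ x ∈ addFront (fun j => (es.filter (fun e => e.2 = j)).map Prod.fst) b.roots, _) ∧
      (addFront (fun j => (es.filter (fun e => e.2 = j)).map Prod.fst) b.roots).length = _ ∧
      contAll (addFront (fun j => (es.filter (fun e => e.2 = j)).map Prod.fst) b.roots) = _ ∧
      _ + potAll P D i (addFront (fun j => (es.filter (fun e => e.2 = j)).map Prod.fst) b.roots) +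
        _ + _ ≤ _
    refine ⟨?_, by simp [addFront], ?_, ?_⟩
    · intro x hx
      obtain ⟨j, hj, rfl⟩ := List.mem_mapIdx.1 hx
      have hT := hb.tree _ (List.getElem_mem hj)
      have hle' : ∀ a ∈ (es.filter (fun e => e.2 = j)).map Prod.fst,
          ∀ c ∈ b.roots[j].elems, a ≤ c := by
        intro a ha c hc
        refine hle hi a ?_ c (mem_elemsAll.2 ⟨_, List.getElem_mem hj, hc⟩)
        exact (List.filter_sublist.map _).subset ha
      have hr : b.roots[j].rank ≤ P.r := hT.rank_eq.symm ▸ hi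
      refine hT.congr rfl rfl ⟨fun _ => hT.shape.lists_eq hr, fun _ => ?_, fun _ => ?_,
        fun h => ?_, fun h => ?_, fun h => ?_⟩
      · simp only [List.pairwise_append]
        refine ⟨(hsorted hi).sublist (List.filter_sublist.map _), hT.shape.sorted hr, ?_⟩
        intro a ha c hc
        exact hle' a ha c (by rw [Node.elems_eq]; simp [hc])
      · intro a ha c hc
        rcases List.mem_append.1 ha with ha | ha
        · exact hle' a ha c (by
            rw [Node.elems_eq]
            exact List.mem_append_right _ hc)
        · exact hT.shape.le_kids hr a ha c hc
      all_goals simp only at h; omega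
    · rw [contAll_addFront, hlab, add_comm]
    · rw [potAll_addFront hi]
      have hcard : ∑ j ∈ Finset.range b.roots.length,
          ((es.filter (fun e => e.2 = j)).map Prod.fst).length = es.length := by
        have := congrArg Multiset.card hlab
        rw [Multiset.card_sum] at this
        simpa using this
      rw [hcard, elemWeight_eq (by omega : i ≤ D + 1)]
      have c1 : (P.B : ℝ) * ((P.blocks b.disk.length + ((List.range b.roots.length).map (fun j =>
          2 + P.blocks (es.filter (fun e => e.2 = j)).length)).sum : ℕ) : ℝ) ≤ 10 * P.full := by
        have : P.B * ((List.range b.roots.length).map (fun j =>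
            2 + P.blocks (es.filter (fun e => e.2 = j)).length)).sum ≤
            4 * P.full + es.length := by
          rw [sum_map_range, Finset.mul_sum, ← hcard]
          have h1 : ∀ j ∈ Finset.range b.roots.length,
              P.B * (2 + P.blocks (es.filter (fun e => e.2 = j)).length) ≤
              4 * P.B + ((es.filter (fun e => e.2 = j)).map Prod.fst).length := by
            intro j _
            have := hP.B_mul_blocks_le (es.filter (fun e => e.2 = j)).length
            rw [List.length_map, mul_add]
            omega
          refine (Finset.sum_le_sum h1).trans ?_
          rw [Finset.sum_add_distrib, Finset.sum_const, Finset.card_range, smul_eq_mul]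
          have : P.B * b.roots.length ≤ P.full := Nat.mul_le_mul_left _ hb.roots_lt.le
          nlinarith
        have : P.B * (P.blocks b.disk.length + ((List.range b.roots.length).map (fun j =>
          2 + P.blocks (es.filter (fun e => e.2 = j)).length)).sum) ≤ 10 * P.full := by
          rw [mul_add]
          omega
        exact_mod_cast this
      have c2 : (es.length : ℝ) ≤ P.full := by exact_mod_cast hsize
      linarith
  · simp only [hi, if_false]
    have hi' : P.r < i := by omega
    rcases es with _ | ⟨⟨a, j⟩, es⟩
    · refine ⟨hb.tree, rfl, by simp, ?_⟩
      simp only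
      push_cast
      linarith
    · have hj : j < b.roots.length := hpos (a, j) List.mem_cons_self
      obtain ⟨l₁, l₂, hl, hl₁⟩ : ∃ l₁ l₂, b.roots = l₁ ++ b.roots[j] :: l₂ ∧ l₁.length = j :=
        ⟨b.roots.take j, b.roots.drop (j + 1), by simp, by simp; omega⟩
      generalize hy : b.roots[j] = y at hl
      have hgetl : b.roots[j]? = some y := by rw [List.getElem?_eq_getElem hj, hy]
      have hyT : Tree P i y := hb.tree y (by simp [hl])
      have hyr : P.r < y.rank := hyT.rank_eq.symm ▸ hi'
      have hya := hyT.shape.arr_eq hyr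
      have hmod : b.roots.modify j (fun x => { x with
          lists := putBack P (((a, j) :: es).map Prod.fst) x.lists }) =
          l₁ ++ { y with lists := putBack P (((a, j) :: es).map Prod.fst) y.lists } :: l₂ := by
        rw [List.modify_eq_take_cons_drop hj, hy]
        subst hl₁
        rw [hl]
        simp
      obtain ⟨p1, p2, p3, p4⟩ := putBack_spec (P := P) (es := ((a, j) :: es).map Prod.fst)
        (ls := y.lists) (by simp) (by simpa using hsize) (hyT.shape.lists_ne hyr)
        (hyT.shape.lists_le hyr)
      simp only [hmod, hgetl, Option.map_some, Option.getD_some]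
      have hlast : (y.lists.getLastD []).length ≤ P.full := by
        rcases List.mem_cons.1 (List.getLastD_mem_cons (l := y.lists) (a := ([] : List α)))
          with h | h
        · rw [h]; exact Nat.zero_le _
        · exact hyT.shape.lists_le hyr _ h
      have b2 := hP.B_mul_blocks_le ((a, j) :: es).length
      have b3 := hP.B_mul_blocks_le (y.lists.getLastD []).length
      generalize putBack P (((a, j) :: es).map Prod.fst) y.lists = ls at *
      refine ⟨?_, by simp [hl], ?_, ?_⟩
      · intro x hx
        simp only [List.mem_append, List.mem_cons] at hx
        rcases hx with hx | rfl | hx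
        · exact hb.tree x (by simp [hl, hx])
        · exact hyT.congr rfl rfl ⟨fun h => by simp only at h; omega,
            fun h => by simp only at h; omega, fun h => by simp only at h; omega,
            fun _ => hya, fun _ => p3, fun _ => p4⟩
        · exact hb.tree x (by simp [hl, hx])
      · rw [hl, contAll_append, contAll_append, contAll_cons, contAll_cons, Node.cont_eq y,
          Node.cont_eq]
        simp only [p1]
        abel
      · have c4 := treePot_congr (P := P) (D := D) (k := i) (x := y)
          (y := { y with lists := ls }) rfl
        rw [ownPot_of_lt hi', ownPot_of_lt hi'] at c4
        have c5 := listWeight_le (P := P) hi'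
        have c6 : (ls.length : ℝ) * listWeight P i ≤ (y.lists.length + 1) * listWeight P i := by
          have := listWeight_nonneg (P := P) (k := i)
          gcongr
          exact_mod_cast p2
        have c1 : (P.B : ℝ) * ((P.blocks b.disk.length + P.blocks ((a, j) :: es).length +
            2 * P.blocks (y.lists.getLastD []).length + 6 : ℕ) : ℝ) ≤ 20 * P.full := by
          have : P.B * (P.blocks b.disk.length + P.blocks ((a, j) :: es).length +
            2 * P.blocks (y.lists.getLastD []).length + 6) ≤ 20 * P.full := by
            have e1 : P.B * (2 * P.blocks (y.lists.getLastD []).length) =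
              2 * (P.B * P.blocks (y.lists.getLastD []).length) := by ring
            simp only [mul_add, e1]
            omega
          exact_mod_cast this
        have c7 : potAll P D i b.roots = potAll P D i l₁ + (treePot P D i y + potAll P D i l₂) := by
          conv_lhs => rw [hl]
          rw [potAll_append, potAll_cons]
        rw [c7]
        simp only [potAll_append, potAll_cons]
        linarith

end

section

variable {α : Type u}

/-! ### Meld -/

/-- The number of roots of a bucket that need not exist. -/
def optRoots (o : Option (Bucket α)) : ℕ := (o.map (fun b => b.roots.length)).getD 0

section

variable [LinearOrder α] {P : Params} {D i : ℕ}

theorem flushAll_spec (hP : P.Ok) (hD : min i P.r ≤ D) {bs : List (Bucket α)}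
    (hbs : ∀ b ∈ bs, b.OK P i) :
    (∀ x ∈ (bs.map (flush P i)).flatMap Prod.fst, Tree P i x) ∧
    ((bs.map (flush P i)).flatMap Prod.fst).length = (bs.map (fun b => b.roots.length)).sum ∧
    contAll ((bs.map (flush P i)).flatMap Prod.fst) = (bs.map Bucket.cont).sum ∧
    (P.B : ℝ) * (((bs.map (flush P i)).map Prod.snd).sum : ℕ) +
      potAll P D i ((bs.map (flush P i)).flatMap Prod.fst) + 350 * P.full * bs.length +
      1700 * P.B * ((bs.map (fun b => b.roots.length)).sum : ℕ) ≤
      (bs.map (bucketPot P D i)).sum := by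
  induction bs with
  | nil => simp
  | cons b bs ih =>
    obtain ⟨i1, i2, i3, i4⟩ := ih fun c hc => hbs c (List.mem_cons_of_mem _ hc)
    obtain ⟨f1, f2, f3, f4⟩ := flush_spec hP hD (hbs b List.mem_cons_self)
    simp only [List.map_cons, List.flatMap_cons, List.sum_cons, List.length_append,
      contAll_append, potAll_append, List.length_cons]
    refine ⟨?_, by omega, by rw [f3, i3], ?_⟩
    · intro x hx
      rcases List.mem_append.1 hx with hx | hx
      · exact f1 x hx
      · exact i1 x hx
    · push_cast at i4 ⊢
      linarith

/-- A step of Meld is paid by the potential: if there is a carry-out, because `q` roots become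
one; otherwise, because of two buckets at most one is left. -/
theorem meldStep_spec (hP : P.Ok) {bs : List (Bucket α)} (hbs : ∀ b ∈ bs, b.OK P i)
    (hlen : (bs.map (fun b => b.roots.length)).sum < 2 * P.q)
    (hD : bs ≠ [] → min i P.r ≤ D)
    (hD' : P.q ≤ (bs.map (fun b => b.roots.length)).sum → min (i + 1) P.r ≤ D) :
    (∀ b, (meldStep P i bs).1 = some b → b.OK P i ∧ b.mem ≠ []) ∧
    (∀ b, (meldStep P i bs).2.1 = some b → b.OK P (i + 1) ∧ b.roots.length = 1) ∧
    (bs.length ≤ 1 → (meldStep P i bs).2.1 = none) ∧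
    optRoots (meldStep P i bs).1 + P.q * optRoots (meldStep P i bs).2.1 ≤
      (bs.map (fun b => b.roots.length)).sum ∧
    optCont (meldStep P i bs).1 + optCont (meldStep P i bs).2.1 = (bs.map Bucket.cont).sum ∧
    (P.B : ℝ) * (meldStep P i bs).2.2 + optPot P D i (meldStep P i bs).1 +
      optPot P D (i + 1) (meldStep P i bs).2.1 ≤ (bs.map (bucketPot P D i)).sum := by
  have optRoots_le : ∀ {o : Option (Bucket α)} {n : ℕ},
      (∀ b, o = some b → b.OK P i ∧ b.mem ≠ [] ∧ b.roots.length ≤ n) → optRoots o ≤ n := by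
    intro o n h
    cases o with
    | none => exact Nat.zero_le _
    | some b => exact (h b rfl).2.2
  rcases bs with _ | ⟨b, _ | ⟨b', bs⟩⟩
  · simp [meldStep, optRoots, optCont, optPot]
  · have hb := hbs b List.mem_cons_self
    have hD := hD (by simp)
    simp only [meldStep, List.map_cons, List.map_nil, List.sum_cons, List.sum_nil, add_zero]
    split_ifs with hmem
    · obtain ⟨u1, u2, u3⟩ := fillUp_spec hP hD hb.roots_lt hb.tree
      have hm : b.mem = [] := by simpa using hmem
      refine ⟨fun c hc => ⟨(u1 c hc).1, (u1 c hc).2.1⟩, by simp, fun _ => rfl, ?_, ?_, ?_⟩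
      · simpa [optRoots] using optRoots_le u1
      · rw [u2, Bucket.cont_eq, hm, hb.disk_eq hm]
        simp [optCont]
      · have := rootsPot_le_bucketPot (P := P) (D := D) (i := i) b
        simp only [optPot, Option.map_none, Option.getD_none] at *
        linarith
    · refine ⟨?_, by simp, fun _ => rfl, ?_, ?_, ?_⟩
      · intro c hc
        obtain rfl := Option.some.inj hc
        exact ⟨hb, by simpa using hmem⟩
      · simp [optRoots]
      · simp [optCont]
      · simp [optPot]
  · replace hD := hD (by simp)
    have hlen2 : 2 ≤ (b :: b' :: bs).length := by simp
    simp only [meldStep]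
    generalize b :: b' :: bs = bs at *
    obtain ⟨f1, f2, f3, f4⟩ := flushAll_spec (D := D) hP hD hbs
    generalize (bs.map (flush P i)).flatMap Prod.fst = xs at *
    generalize (List.map Prod.snd (bs.map (flush P i))).sum = c at *
    obtain ⟨r1, r2, r3, r4⟩ := restoreWith_spec (sift_spec hP hD) f1
    change ∀ y ∈ (restore P xs).1, _ at r1
    change (restore P xs).1.length ≤ _ at r2
    change contAll (restore P xs).1 = _ at r3
    change (P.B : ℝ) * (restore P xs).2 + potAll P D i (restore P xs).1 ≤ _ at r4
    generalize restore P xs = t at *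
    generalize (bs.map (bucketPot P D i)).sum = Ψ at *
    rw [← f2] at hlen hD' f4 ⊢
    rw [← f3, ← r3]
    have hF : (0 : ℝ) ≤ P.full := Nat.cast_nonneg _
    have hBF : (2 : ℝ) * P.B ≤ P.full := by exact_mod_cast hP.two_mul_B_le_full
    have hn : (700 : ℝ) * P.full ≤ 350 * P.full * bs.length := by
      have : (2 : ℝ) ≤ bs.length := by exact_mod_cast hlen2
      nlinarith
    have hx4 : (2 : ℝ) * P.B * xs.length ≤ 4 * P.full := by
      have : P.B * xs.length ≤ P.B * (2 * P.q) := Nat.mul_le_mul_left _ hlen.le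
      have h' : P.B * (2 * P.q) = 2 * P.full := by unfold Params.full; ring
      rw [h'] at this
      have : (P.B : ℝ) * xs.length ≤ 2 * P.full := by exact_mod_cast this
      linarith
    have hnil : ∀ zs : List (Node α), restPot P zs ≤ 20 * P.full := restPot_le
    split_ifs with hcase
    · obtain ⟨u1, u2, u3⟩ := fillUp_spec hP hD hcase (fun x hx => (r1 x hx).1)
      refine ⟨fun c hc => ⟨(u1 c hc).1, (u1 c hc).2.1⟩, by simp, fun _ => rfl, ?_, ?_, ?_⟩
      · have := optRoots_le u1
        simp only [optRoots, Option.map_none, Option.getD_none] at *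
        omega
      · rw [u2]; simp [optCont]
      · have h1 := hnil t.1
        have h2 : (P.B : ℝ) * t.1.length ≤ P.B * xs.length := by gcongr
        rw [rootsPot] at u3
        simp only [optPot, Option.map_none, Option.getD_none] at *
        push_cast
        linarith
    · rw [not_lt] at hcase
      have hq : (t.1.take P.q).length = P.q := by simp [hcase]
      have hq2 := hP.two_le_q
      have hne : t.1.take P.q ≠ [] := List.ne_nil_of_length_pos (by omega)
      replace hD' := hD' (hcase.trans r2)
      have hT : Tree P (i + 1) ⟨i + 1, [], [], ⊥, t.1.take P.q⟩ :=
        ⟨rfl, hq.le, fun y hy => r1 y (List.mem_of_mem_take hy), ⟨by simp, by simp, by simp,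
          by simp, by simp, by simp⟩⟩
      have hv : Node.violates P (⟨i + 1, [], [], ⊥, t.1.take P.q⟩ : Node α) = true := by
        refine Node.violates_iff.2 ⟨hne, fun _ => hP.one_le_half, fun _ => by simp⟩
      obtain ⟨s1, s2, s3, s4⟩ := sift_spec hP hD' _ hT hv
      have hdrop : (t.1.drop P.q).length < P.q := by
        rw [List.length_drop]; omega
      obtain ⟨u1, u2, u3⟩ := fillUp_spec hP hD hdrop
        (fun x hx => (r1 x (List.mem_of_mem_drop hx)).1)
      have hpot0 : treePot P D (i + 1) (⟨i + 1, [], [], ⊥, t.1.take P.q⟩ : Node α) =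
          260 * P.full + potAll P D i (t.1.take P.q) := by
        rw [treePot_succ, ownPot]
        have : (t.1.take P.q).isEmpty = false := by simpa using hne
        simp only [this, Bool.false_eq_true, if_false, List.length_nil, Nat.cast_zero, zero_mul,
          ite_self]
        ring
      rw [hpot0] at s4
      generalize sift P (⟨i + 1, [], [], ⊥, t.1.take P.q⟩ : Node α) = x at *
      have hsplit : potAll P D i t.1 = potAll P D i (t.1.take P.q) + potAll P D i (t.1.drop P.q) := by
        rw [← potAll_append, List.take_append_drop]
      refine ⟨fun c hc => ⟨(u1 c hc).1, (u1 c hc).2.1⟩, ?_, fun h => by omega, ?_, ?_, ?_⟩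
      · intro c hc
        obtain rfl := Option.some.inj hc
        exact ⟨⟨by simp, (by simp only [List.length_singleton]; omega), by simpa using s1, by simp, by simp, by simp,
          by simp, by simp⟩, rfl⟩
      · have := optRoots_le u1
        rw [List.length_drop] at this
        simp only [optRoots, Option.map_some, Option.getD_some, List.length_singleton] at *
        omega
      · rw [u2]
        simp only [optCont, Option.map_some, Option.getD_some]
        rw [Bucket.cont_eq]
        conv_rhs => rw [← List.take_append_drop P.q t.1, contAll_append]
        simp only [contAll_cons, contAll_nil, s3, Node.cont_eq, List.append_nil, List.map_nil,
          List.flatten_nil, Multiset.coe_nil, add_zero, zero_add]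
        rw [add_comm]
      · have h1 := hnil (t.1.drop P.q)
        have h2 : restPot P [x.1] ≤ 20 * P.full := hnil _
        have h3 : (P.B : ℝ) * (t.1.drop P.q).length + P.B * P.q ≤ P.B * xs.length := by
          rw [← mul_add]
          gcongr
          rw [List.length_drop]
          exact_mod_cast (by omega : t.1.length - P.q + P.q ≤ xs.length)
        have h4 : (P.B : ℝ) * P.q = P.full := by simp [Params.full]
        have h5 : (P.B : ℝ) * ((1 + P.blocks P.q : ℕ) : ℝ) ≤ 3 * P.full := by
          have b1 := hP.B_mul_blocks_le P.q
          have g1 := hP.two_mul_B_le_full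
          have g2 := hP.q_le_full
          have : P.B * (1 + P.blocks P.q) ≤ 3 * P.full := by
            rw [mul_add]; omega
          exact_mod_cast this
        rw [rootsPot] at u3
        have h6 : optPot P D (i + 1) (some (⟨[x.1], [], []⟩ : Bucket α)) =
            600 * P.full + 1700 * P.B + treePot P D (i + 1) x.1 + restPot P [x.1] := by
          have : 0 < P.B := hP.one_le_B
          simp [optPot, bucketPot, rootsPot, this]
        rw [h6]
        push_cast at h5 ⊢
        linarith

end

/-! ### Sums over buckets -/

section Sums

variable {M : Type*} [AddCommMonoid M]

/-- The sum of a function of ranks and buckets over a list of buckets, of which the first has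
rank `i`. -/
def rankSum (g : ℕ → Option (Bucket α) → M) : ℕ → List (Option (Bucket α)) → M
  | _, [] => 0
  | i, o :: os => g i o + rankSum g (i + 1) os

/-- The sum of a function of ranks and buckets over the `n` ranks from `i` on. -/
def slotSum (g : ℕ → Option (Bucket α) → M) (bs : List (Option (Bucket α))) : ℕ → ℕ → M
  | 0, _ => 0
  | n + 1, i => g i (bs.getD i none) + slotSum g bs n (i + 1)

theorem slotSum_eq {g : ℕ → Option (Bucket α) → M} (hg : ∀ i, g i none = 0)
    {bs : List (Option (Bucket α))} {n i : ℕ} (h : bs.length ≤ i + n) :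
    slotSum g bs n i = rankSum g i (bs.drop i) := by
  induction n generalizing i with
  | zero => rw [List.drop_of_length_le (by omega)]; rfl
  | succ n ih =>
    rw [slotSum, ih (by omega)]
    by_cases hi : i < bs.length
    · rw [List.drop_eq_getElem_cons hi, rankSum, List.getD_eq_getElem _ _ hi]
    · rw [List.drop_of_length_le (by omega), List.drop_of_length_le (by omega),
        List.getD_eq_default _ _ (by omega), hg, zero_add]
      rfl

theorem rankSum_set {g : ℕ → Option (Bucket α) → M} {bs : List (Option (Bucket α))} {k i : ℕ}
    {o o' : Option (Bucket α)} (h : bs[k]? = some o) :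
    rankSum g i (bs.set k o') + g (i + k) o = rankSum g i bs + g (i + k) o' := by
  induction bs generalizing i k with
  | nil => simp at h
  | cons b bs ih =>
    cases k with
    | zero =>
      simp only [List.getElem?_cons_zero, Option.some.injEq] at h
      subst h
      simp only [List.set_cons_zero, rankSum, add_zero]
      abel
    | succ k =>
      simp only [List.getElem?_cons_succ] at h
      have := ih (i := i + 1) h
      rw [show i + 1 + k = i + (k + 1) by omega] at this
      simp only [List.set_cons_succ, rankSum]
      rw [add_assoc, this, add_assoc]

theorem rankSum_nonneg {g : ℕ → Option (Bucket α) → ℝ} (hg : ∀ i o, 0 ≤ g i o) (i : ℕ)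
    (bs : List (Option (Bucket α))) : 0 ≤ rankSum g i bs := by
  induction bs generalizing i with
  | nil => exact le_rfl
  | cons b bs ih => exact add_nonneg (hg _ _) (ih _)

end Sums

theorem sum_toList₃ {M : Type*} [AddCommMonoid M] (f : Bucket α → M)
    (o₁ o₂ o₃ : Option (Bucket α)) : ((o₁.toList ++ o₂.toList ++ o₃.toList).map f).sum =
      (o₁.map f).getD 0 + (o₂.map f).getD 0 + (o₃.map f).getD 0 := by
  cases o₁ <;> cases o₂ <;> cases o₃ <;> simp [add_assoc]

/-- The number of elements that must have been inserted for the roots of a bucket to exist. -/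
def bucketWeight (P : Params) (i : ℕ) (o : Option (Bucket α)) : ℕ :=
  P.full * P.q ^ i * optRoots o

variable [LinearOrder α] {P : Params} {D : ℕ}

/-- All buckets of a list satisfy their invariants. -/
def BucketsOK (P : Params) (bs : List (Option (Bucket α))) : Prop :=
  ∀ i b, bs.getD i none = some b → b.OK P i

/-- The addition of the bucket sequences from rank `i` on, with carry `c`. Weights count records
that have been inserted, so that `W` bounds the ranks that occur, whatever has been deleted. -/
theorem meldLoop_spec (hP : P.Ok) {b₁ b₂ : List (Option (Bucket α))} (h₁ : BucketsOK P b₁)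
    (h₂ : BucketsOK P b₂) {W : ℕ} (hW : ∀ k, P.full * P.q ^ k ≤ W → min k P.r ≤ D)
    (n i : ℕ) (c : Option (Bucket α)) (hc : ∀ b, c = some b → b.OK P i ∧ b.roots.length = 1)
    (hle : slotSum (bucketWeight P) b₁ n i + slotSum (bucketWeight P) b₂ n i +
      bucketWeight P i c ≤ W) (hn : 0 < n) :
    (∀ j b, (meldLoop P b₁ b₂ n i c).1.getD j none = some b → b.OK P (i + j) ∧ b.mem ≠ []) ∧
    rankSum (bucketWeight P) i (meldLoop P b₁ b₂ n i c).1 ≤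
      slotSum (bucketWeight P) b₁ n i + slotSum (bucketWeight P) b₂ n i + bucketWeight P i c ∧
    (max b₁.length b₂.length < i + n →
      rankSum (fun _ => optCont) i (meldLoop P b₁ b₂ n i c).1 =
        slotSum (fun _ => optCont) b₁ n i + slotSum (fun _ => optCont) b₂ n i + optCont c) ∧
    (P.B : ℝ) * (meldLoop P b₁ b₂ n i c).2 +
      rankSum (optPot P D) i (meldLoop P b₁ b₂ n i c).1 ≤
      slotSum (optPot P D) b₁ n i + slotSum (optPot P D) b₂ n i + optPot P D i c := by
  induction n generalizing i c with
  | zero => omega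
  | succ n ih =>
    have hbs : ∀ b ∈ (b₁.getD i none).toList ++ (b₂.getD i none).toList ++ c.toList,
        b.OK P i := by
      intro b hb
      simp only [List.mem_append, Option.mem_toList] at hb
      rcases hb with (hb | hb) | hb
      · exact h₁ i b hb
      · exact h₂ i b hb
      · exact (hc b hb).1
    have hroots := sum_toList₃ (fun b : Bucket α => b.roots.length) (b₁.getD i none)
      (b₂.getD i none) c
    have hcont := sum_toList₃ Bucket.cont (b₁.getD i none) (b₂.getD i none) c
    have hpot := sum_toList₃ (bucketPot P D i) (b₁.getD i none) (b₂.getD i none) c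
    change _ = optRoots _ + optRoots _ + optRoots _ at hroots
    change _ = optCont _ + optCont _ + optCont _ at hcont
    change _ = optPot P D i _ + optPot P D i _ + optPot P D i _ at hpot
    have hr : ∀ {bs : List (Option (Bucket α))}, BucketsOK P bs →
        optRoots (bs.getD i none) < P.q := by
      intro bs h
      cases ho : bs.getD i none with
      | none => have := hP.two_le_q; simp only [optRoots, Option.map_none, Option.getD_none]; omega
      | some b => exact (h i b ho).roots_lt
    have hrc : optRoots c ≤ 1 := by
      cases c with
      | none => exact Nat.zero_le _
      | some b => exact (hc b rfl).2.le
    have hr₁ := hr h₁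
    have hr₂ := hr h₂
    simp only [slotSum] at hle ⊢
    have hlen1 : ((b₁.getD i none).toList ++ (b₂.getD i none).toList ++ c.toList).length ≤
        (b₁.getD i none).toList.length + (b₂.getD i none).toList.length + 1 := by
      simp only [List.length_append]
      cases c <;> simp
    rw [meldLoop]
    generalize hbsdef : (b₁.getD i none).toList ++ (b₂.getD i none).toList ++ c.toList = bs at *
    have hweight : P.full * P.q ^ i * (bs.map (fun b => b.roots.length)).sum =
        bucketWeight P i (b₁.getD i none) + bucketWeight P i (b₂.getD i none) +
          bucketWeight P i c := by
      rw [hroots]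
      unfold bucketWeight
      ring
    obtain ⟨m1, m2, m3, m4, m5, m6⟩ := meldStep_spec (D := D) hP hbs
      (by omega)
      (by
        intro hne
        obtain ⟨b, bs', rfl⟩ := List.exists_cons_of_ne_nil hne
        have hb := List.length_pos_of_ne_nil (hbs b List.mem_cons_self).roots_ne
        refine hW i (le_trans ?_ (le_trans hweight.le (by omega)))
        refine Nat.le_mul_of_pos_right _ ?_
        simp only [List.map_cons, List.sum_cons]
        omega)
      (by
        intro hq
        refine hW (i + 1) (le_trans ?_ (le_trans hweight.le (by omega)))
        rw [pow_succ, ← mul_assoc]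
        exact Nat.mul_le_mul_left _ hq)
    have hw' : bucketWeight P i (meldStep P i bs).1 +
        bucketWeight P (i + 1) (meldStep P i bs).2.1 ≤
        P.full * P.q ^ i * (bs.map (fun b => b.roots.length)).sum := by
      refine le_trans (le_of_eq ?_) (Nat.mul_le_mul_left _ m4)
      unfold bucketWeight
      ring
    rw [hcont] at m5
    rw [hpot] at m6
    generalize meldStep P i bs = t at *
    simp only [rankSum]
    rcases Nat.eq_zero_or_pos n with rfl | hn'
    · simp only [meldLoop, slotSum, rankSum, Nat.cast_zero, add_zero] at *
      refine ⟨?_, by omega, ?_, ?_⟩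
      · intro j b hb
        cases j with
        | zero => exact m1 b (by simpa using hb)
        | succ j => simp at hb
      · -- Beyond the ranks of both heaps there is only the carry-in, so that nothing is carried out.
        intro hmax
        have e1 : b₁.getD i none = none := List.getD_eq_default _ _ (by omega)
        have e2 : b₂.getD i none = none := List.getD_eq_default _ _ (by omega)
        rw [e1, e2] at hlen1
        rw [m3 (by simpa using hlen1)] at m5
        simpa [optCont] using m5
      · have := optPot_nonneg (P := P) (D := D) (i := i + 1) t.2.1
        linarith
    · obtain ⟨i1, i2, i3, i4⟩ := ih (i + 1) t.2.1 m2 (by omega) hn'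
      generalize meldLoop P b₁ b₂ n (i + 1) t.2.1 = u at *
      refine ⟨?_, by omega, ?_, ?_⟩
      · intro j b hb
        cases j with
        | zero => exact m1 b (by simpa using hb)
        | succ j =>
          have := i1 j b (by simpa using hb)
          rwa [show i + 1 + j = i + (j + 1) by omega] at this
      · intro hmax
        rw [i3 (by omega)]
        rw [show ∀ A B C E : Multiset α, A + (B + C + E) = A + E + (B + C) by intros; abel, m5]
        abel
      · push_cast
        linarith

end

section

variable {α : Type u}

/-! ### Heaps -/

theorem getD_eq_some {bs : List (Option (Bucket α))} {i : ℕ} {b : Bucket α} :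
    bs.getD i none = some b ↔ bs[i]? = some (some b) := by
  rw [List.getD_eq_getElem?_getD]
  cases bs[i]? <;> simp

@[simp] theorem optCont_none : optCont (none : Option (Bucket α)) = 0 := rfl

@[simp] theorem optPot_none {P : Params} {D i : ℕ} : optPot P D i (none : Option (Bucket α)) = 0 :=
  rfl

@[simp] theorem bucketWeight_none {P : Params} {i : ℕ} :
    bucketWeight P i (none : Option (Bucket α)) = 0 := rfl

/-- The invariant of a heap between operations. -/
structure Heap.OK [LinearOrder α] (P : Params) (H : Heap α) : Prop where
  buffer_sorted : H.buffer.Pairwise (· ≤ ·)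
  buffer_lt : H.buffer.length < P.full
  buckets : BucketsOK P H.buckets
  mem_ne : ∀ i b, H.buckets.getD i none = some b → b.mem ≠ []

/-- The potential of a heap, times `B`: each element of the buffer contributes `K`. -/
noncomputable def Heap.pot (P : Params) (D : ℕ) (K : ℝ) (H : Heap α) : ℝ :=
  H.buffer.length * K + rankSum (optPot P D) 0 H.buckets

/-- A lower bound for the number of elements that have been inserted into a heap. -/
def Heap.weight (P : Params) (H : Heap α) : ℕ :=
  H.buffer.length + rankSum (bucketWeight P) 0 H.buckets

theorem Heap.contents_eq (H : Heap α) :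
    H.contents = (H.buffer : Multiset α) + rankSum (fun _ => optCont) 0 H.buckets := by
  have : ∀ (bs : List (Option (Bucket α))) (i : ℕ),
      ((bs.flatMap (fun b => (b.map Bucket.elems).getD []) : List α) : Multiset α) =
        rankSum (fun _ => optCont) i bs := by
    intro bs
    induction bs with
    | nil => intro i; rfl
    | cons o bs ih =>
      intro i
      rw [List.flatMap_cons, ← Multiset.coe_add, ih (i + 1), rankSum]
      congr 1
      cases o <;> simp [optCont, Bucket.cont]
  rw [Heap.contents, this]

theorem newTree_cont (l : List α) : (newTree l).cont = l := by
  simp [Bucket.cont_eq, newTree, Node.cont_eq]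

/-- The elements of a full buffer have the potential to pay for a new tree. -/
theorem newTree_pot {P : Params} {D : ℕ} (hP : P.Ok) {l : List α} (hl : l.length = P.full) :
    (P.B : ℝ) * newTreeCost P P.full + bucketPot P D 0 (newTree l) ≤
      P.full * (240 * D + 2000) := by
  have h1 : (P.B : ℝ) * newTreeCost P P.full ≤ 3 * P.full := by
    have b1 := hP.B_mul_blocks_le P.full
    have g1 := hP.two_mul_B_le_full
    have : P.B * newTreeCost P P.full ≤ 3 * P.full := by
      rw [newTreeCost, mul_add]; omega
    exact_mod_cast this
  have h2 := restPot_le (P := P) (newTree l).roots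
  have hBF : (2 : ℝ) * P.B ≤ P.full := by exact_mod_cast hP.two_mul_B_le_full
  have hB0 : (P.B - 1) / P.B = 0 := Nat.div_eq_of_lt (by have := hP.one_le_B; omega)
  have h3 : bucketPot P D 0 (newTree l) = 620 * P.full + 1700 * P.B +
      P.full * (240 * (D + 2)) + restPot P (newTree l).roots := by
    simp [bucketPot, rootsPot, newTree, treePot, ownPot, elemWeight, hl, hB0]
    ring
  rw [h3]
  linarith

variable [LinearOrder α] {P : Params} {D : ℕ}

theorem newTree_OK (hP : P.Ok) {l : List α} (hl : l.Pairwise (· ≤ ·)) :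
    (newTree l).OK P 0 ∧ (newTree l).roots.length = 1 := by
  refine ⟨⟨by simp [newTree], ?_, ?_, by simp [newTree], by simp [newTree], by simp [newTree],
    by simp [newTree], by simp [newTree]⟩, rfl⟩
  · have := hP.two_le_q
    simp only [newTree, List.length_singleton]
    omega
  · simp only [newTree, List.mem_singleton, forall_eq]
    exact ⟨rfl, rfl, ⟨by simp, fun _ => hl, by simp, by simp, by simp, by simp⟩⟩

theorem merge_sorted {l₁ l₂ : List α} (h₁ : l₁.Pairwise (· ≤ ·)) (h₂ : l₂.Pairwise (· ≤ ·)) :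
    (List.merge l₁ l₂ (fun a b => decide (a ≤ b))).Pairwise (· ≤ ·) := by
  have := List.pairwise_merge (le := fun a b : α => decide (a ≤ b))
    (by simpa using fun a b c => le_trans) (by simpa using le_total) l₁ l₂
    (by simpa using h₁) (by simpa using h₂)
  simpa using this

/-- Melding keeps the invariants and contents, and its cost is covered by the loss of potential. The
condition on `K` is needed only where a buffer can become full. -/
theorem meld_spec (hP : P.Ok) {W : ℕ} (hW : ∀ k, P.full * P.q ^ k ≤ W → min k P.r ≤ D) {K : ℝ}
    (hK : P.full ≤ W → 240 * D + 2000 ≤ K) {H₁ H₂ : Heap α}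
    (s₁ : H₁.buffer.Pairwise (· ≤ ·)) (s₂ : H₂.buffer.Pairwise (· ≤ ·))
    (l₁ : H₁.buffer.length < P.full) (l₂ : H₂.buffer.length < P.full)
    (h₁ : BucketsOK P H₁.buckets) (h₂ : BucketsOK P H₂.buckets)
    (hw : H₁.weight P + H₂.weight P ≤ W) :
    (meld P H₁ H₂).1.OK P ∧ (meld P H₁ H₂).1.weight P ≤ H₁.weight P + H₂.weight P ∧
    (meld P H₁ H₂).1.contents = H₁.contents + H₂.contents ∧
    (P.B : ℝ) * (meld P H₁ H₂).2 + (meld P H₁ H₂).1.pot P D K ≤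
      H₁.pot P D K + H₂.pot P D K := by
  have hs := merge_sorted s₁ s₂
  have hp := List.merge_perm_append (fun a b : α => decide (a ≤ b)) (xs := H₁.buffer)
    (ys := H₂.buffer)
  have hl : (List.merge H₁.buffer H₂.buffer (fun a b => decide (a ≤ b))).length =
      H₁.buffer.length + H₂.buffer.length := by rw [hp.length_eq, List.length_append]
  have hc : ((List.merge H₁.buffer H₂.buffer (fun a b => decide (a ≤ b)) : List α) :
      Multiset α) = (H₁.buffer : Multiset α) + H₂.buffer := by
    rw [Multiset.coe_add, Multiset.coe_eq_coe]; exact hp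
  rw [Heap.contents_eq, Heap.contents_eq H₁, Heap.contents_eq H₂]
  unfold meld
  simp only
  unfold Heap.weight Heap.pot at *
  generalize List.merge H₁.buffer H₂.buffer (fun a b => decide (a ≤ b)) = buf at *
  set n := max H₁.buckets.length H₂.buckets.length + 1 with hn
  have e₁ : slotSum (bucketWeight P) H₁.buckets n 0 = rankSum (bucketWeight P) 0 H₁.buckets := by
    rw [slotSum_eq (fun _ => bucketWeight_none) (by omega), List.drop_zero]
  have e₂ : slotSum (bucketWeight P) H₂.buckets n 0 = rankSum (bucketWeight P) 0 H₂.buckets := by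
    rw [slotSum_eq (fun _ => bucketWeight_none) (by omega), List.drop_zero]
  have e₃ : slotSum (optPot P D) H₁.buckets n 0 = rankSum (optPot P D) 0 H₁.buckets := by
    rw [slotSum_eq (fun _ => optPot_none) (by omega), List.drop_zero]
  have e₄ : slotSum (optPot P D) H₂.buckets n 0 = rankSum (optPot P D) 0 H₂.buckets := by
    rw [slotSum_eq (fun _ => optPot_none) (by omega), List.drop_zero]
  have e₅ : slotSum (fun _ => optCont) H₁.buckets n 0 = rankSum (fun _ => optCont) 0 H₁.buckets := by
    rw [slotSum_eq (fun _ => optCont_none) (by omega), List.drop_zero]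
  have e₆ : slotSum (fun _ => optCont) H₂.buckets n 0 = rankSum (fun _ => optCont) 0 H₂.buckets := by
    rw [slotSum_eq (fun _ => optCont_none) (by omega), List.drop_zero]
  split_ifs with hlt
  · obtain ⟨m1, m2, m3, m4⟩ := meldLoop_spec hP h₁ h₂ hW n 0 none (by simp)
      (by rw [bucketWeight_none]; omega) (by omega)
    rw [e₁, e₂] at m2
    rw [e₃, e₄] at m4
    rw [e₅, e₆] at m3
    rw [bucketWeight_none] at m2
    rw [optPot_none] at m4
    rw [optCont_none] at m3
    simp only [zero_add] at m1
    refine ⟨⟨hs, hlt, fun i b hb => (m1 i b hb).1, fun i b hb => (m1 i b hb).2⟩, ?_, ?_, ?_⟩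
    · simp only
      omega
    · rw [hc, m3 (by omega)]
      abel
    · simp only [hl]
      push_cast
      linarith
  · rw [not_lt] at hlt
    have hlen : (buf.take P.full).length = P.full := by simp [hlt]
    obtain ⟨t1, t2⟩ := newTree_OK hP (hs.sublist (List.take_sublist P.full buf))
    have t3 := newTree_cont (buf.take P.full)
    have t4 := newTree_pot (D := D) hP hlen
    have t5 : bucketWeight P 0 (some (newTree (buf.take P.full))) = P.full := by
      simp [bucketWeight, optRoots, t2]
    obtain ⟨m1, m2, m3, m4⟩ := meldLoop_spec hP h₁ h₂ hW n 0
      (some (newTree (buf.take P.full)))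
      (by rintro b hb; obtain rfl := Option.some.inj hb; exact ⟨t1, t2⟩)
      (by rw [t5]; omega) (by omega)
    rw [e₁, e₂, t5] at m2
    rw [e₃, e₄] at m4
    rw [e₅, e₆] at m3
    have hdrop : (buf.drop P.full).length = buf.length - P.full := List.length_drop
    refine ⟨⟨hs.sublist (List.drop_sublist _ _), by simp only; omega,
      fun i b hb => ?_, fun i b hb => (m1 i b hb).2⟩, ?_, ?_, ?_⟩
    · have := (m1 i b hb).1
      rwa [zero_add] at this
    · simp only
      omega
    · simp only
      rw [m3 (by omega)]
      have : optCont (some (newTree (buf.take P.full))) = ((buf.take P.full : List α) : Multiset α) :=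
        t3
      have h' : (H₁.buffer : Multiset α) + H₂.buffer =
          ((buf.take P.full : List α) : Multiset α) + ((buf.drop P.full : List α) : Multiset α) := by
        rw [← hc, Multiset.coe_add, List.take_append_drop]
      rw [this, add_add_add_comm, h']
      abel
    · have h1 : optPot P D 0 (some (newTree (buf.take P.full))) =
        bucketPot P D 0 (newTree (buf.take P.full)) := rfl
      rw [h1] at m4
      have h2 : ((buf.drop P.full).length : ℝ) = H₁.buffer.length + H₂.buffer.length - P.full := by
        rw [hdrop, Nat.cast_sub hlt, hl]; push_cast; ring
      have h3 : (P.full : ℝ) * (240 * D + 2000) ≤ P.full * K := by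
        have := hK (by omega)
        gcongr
      simp only [h2]
      push_cast
      linarith

theorem insert_spec (hP : P.Ok) {W : ℕ} (hW : ∀ k, P.full * P.q ^ k ≤ W → min k P.r ≤ D) {K : ℝ}
    (hK : P.full ≤ W → 240 * D + 2000 ≤ K) {H : Heap α} (a : α) (hH : H.OK P)
    (hw : H.weight P + 1 ≤ W) :
    (insert P a H).1.OK P ∧ (insert P a H).1.weight P ≤ H.weight P + 1 ∧
    (insert P a H).1.contents = a ::ₘ H.contents ∧
    (P.B : ℝ) * (insert P a H).2 + (insert P a H).1.pot P D K ≤ H.pot P D K + K := by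
  have hs : (H.buffer.orderedInsert (· ≤ ·) a).Pairwise (· ≤ ·) :=
    hH.buffer_sorted.orderedInsert a
  have hl := List.orderedInsert_length (· ≤ ·) H.buffer a
  have hc : ((H.buffer.orderedInsert (· ≤ ·) a : List α) : Multiset α) = a ::ₘ H.buffer := by
    rw [Multiset.cons_coe, Multiset.coe_eq_coe]; exact List.perm_orderedInsert _ _ _
  have hlt := hH.buffer_lt
  unfold insert
  simp only
  generalize H.buffer.orderedInsert (· ≤ ·) a = buf at *
  split_ifs with hcase
  · refine ⟨⟨hs, hcase, hH.buckets, hH.mem_ne⟩, ?_, ?_, ?_⟩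
    · simp only [Heap.weight]; omega
    · rw [Heap.contents_eq, Heap.contents_eq, ← Multiset.cons_add, ← hc]
    · simp only [Heap.pot, hl]
      push_cast
      linarith
  · have hlen : buf.length = P.full := by omega
    obtain ⟨t1, t2⟩ := newTree_OK hP hs
    have t3 := newTree_cont buf
    have t4 := newTree_pot (D := D) hP hlen
    have t5 : Heap.weight P ⟨[], [some (newTree buf)]⟩ = P.full := by
      simp [Heap.weight, rankSum, bucketWeight, optRoots, t2]
    have t6 : Heap.weight P ⟨[], H.buckets⟩ + H.buffer.length = H.weight P := by
      simp [Heap.weight, add_comm]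
    have hfull : 0 < P.full := by have := hP.two_mul_B_le_full; have := hP.one_le_B; omega
    obtain ⟨m1, m2, m3, m4⟩ := meld_spec (H₁ := ⟨[], H.buckets⟩)
      (H₂ := ⟨[], [some (newTree buf)]⟩) hP hW hK .nil .nil hfull hfull hH.buckets
      (by
        intro i b hb
        rw [getD_eq_some] at hb
        cases i with
        | zero => simp at hb; exact hb ▸ t1
        | succ i => simp at hb)
      (by omega)
    refine ⟨m1, m2.trans (by omega), ?_, ?_⟩
    · rw [m3, Heap.contents_eq, Heap.contents_eq, Heap.contents_eq, ← Multiset.cons_add, ← hc,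
        ← t3]
      simp only [rankSum, optCont, Option.map_some, Option.getD_some, Multiset.coe_nil, add_zero,
        zero_add]
      rw [add_comm]
    · have h1 : Heap.pot P D K ⟨[], [some (newTree buf)]⟩ = bucketPot P D 0 (newTree buf) := by
        simp [Heap.pot, rankSum, optPot]
      have h2 : Heap.pot P D K ⟨[], H.buckets⟩ + H.buffer.length * K = H.pot P D K := by
        simp [Heap.pot, add_comm]
      have h3 : (P.full : ℝ) * (240 * D + 2000) ≤ P.full * K := by
        have := hK (by omega)
        gcongr
      have h4 : (P.full : ℝ) = H.buffer.length + 1 := by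
        exact_mod_cast (by omega : P.full = H.buffer.length + 1)
      rw [h1] at m4
      have h5 : (P.full : ℝ) * K = H.buffer.length * K + K := by rw [h4]; ring
      rw [hlen]
      push_cast
      linarith

end

section

variable {α : Type u}

/-! ### Findmin and Deletemin -/

theorem rankSum_weight_le {P : Params} {bs : List (Option (Bucket α))} {k i : ℕ}
    {o : Option (Bucket α)} (h : bs[k]? = some o) :
    bucketWeight P (i + k) o ≤ rankSum (bucketWeight P) i bs := by
  have := rankSum_set (g := bucketWeight P) (i := i) (o' := none) h
  rw [bucketWeight_none] at this
  omega

theorem mem_rankSum_cont {bs : List (Option (Bucket α))} {i : ℕ} {a : α} :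
    a ∈ rankSum (fun _ => optCont) i bs ↔
      ∃ (k : ℕ) (b : Bucket α), bs[k]? = some (some b) ∧ a ∈ b.cont := by
  induction bs generalizing i with
  | nil => simp [rankSum]
  | cons o bs ih =>
    rw [rankSum, Multiset.mem_add, ih]
    constructor
    · rintro (h | ⟨k, b, h1, h2⟩)
      · cases o with
        | none => simp at h
        | some b => exact ⟨0, b, rfl, h⟩
      · exact ⟨k + 1, b, h1, h2⟩
    · rintro ⟨k, b, h1, h2⟩
      cases k with
      | zero =>
        simp only [List.getElem?_cons_zero, Option.some.injEq] at h1
        subst h1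
        exact .inl h2
      | succ k => exact .inr ⟨k, b, h1, h2⟩

variable [LinearOrder α] {P : Params} {D i : ℕ}

theorem minBucket_eq_none {bs : List (Option (Bucket α))} (h : minBucket P i bs = none) :
    ∀ (k : ℕ) (b : Bucket α), bs[k]? ≠ some (some b) := by
  induction bs generalizing i with
  | nil => simp
  | cons o bs ih =>
    cases o with
    | none =>
      rw [minBucket] at h
      intro k b
      cases k with
      | zero => simp
      | succ k => exact ih h k b
    | some c =>
      rw [minBucket] at h
      split at h
      · simp at h
      · split_ifs at h

theorem minBucket_eq_some {bs : List (Option (Bucket α))} {j : ℕ} {b : Bucket α}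
    (h : minBucket P i bs = some (j, b)) :
    ∃ k, j = i + k ∧ bs[k]? = some (some b) ∧
      ∀ (k' : ℕ) (b' : Bucket α), bs[k']? = some (some b') →
        b.minkey P j ≤ b'.minkey P (i + k') := by
  induction bs generalizing i j b with
  | nil => simp [minBucket] at h
  | cons o bs ih =>
    cases o with
    | none =>
      rw [minBucket] at h
      obtain ⟨k, rfl, h1, h2⟩ := ih h
      refine ⟨k + 1, by omega, h1, ?_⟩
      intro k' b' h'
      cases k' with
      | zero => simp at h'
      | succ k' => exact (h2 k' b' h').trans_eq (by rw [show i + 1 + k' = i + (k' + 1) by omega])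
    | some c =>
      rw [minBucket] at h
      split at h
      · rename_i hn
        simp only [Option.some.injEq, Prod.mk.injEq] at h
        obtain ⟨rfl, rfl⟩ := h
        refine ⟨0, rfl, rfl, ?_⟩
        intro k' b' h'
        cases k' with
        | zero => simp at h'; simp [h']
        | succ k' => exact absurd h' (minBucket_eq_none hn k' b')
      · rename_i j' c' hs
        obtain ⟨k, rfl, h1, h2⟩ := ih hs
        split_ifs at h with hle <;> simp only [Option.some.injEq, Prod.mk.injEq] at h <;>
          obtain ⟨rfl, rfl⟩ := h
        · refine ⟨0, rfl, rfl, ?_⟩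
          intro k' b' h'
          cases k' with
          | zero => simp at h'; simp [h']
          | succ k' =>
            refine hle.trans ((h2 k' b' h').trans_eq ?_)
            rw [show i + 1 + k' = i + (k' + 1) by omega]
        · refine ⟨k + 1, by omega, h1, ?_⟩
          intro k' b' h'
          cases k' with
          | zero =>
            simp only [List.getElem?_cons_zero, Option.some.injEq] at h'
            obtain rfl := h'
            exact (not_le.1 hle).le
          | succ k' =>
            exact (h2 k' b' h').trans_eq (by rw [show i + 1 + k' = i + (k' + 1) by omega])

/-- Deleting the first element of a bucket: loading the next block is paid for by the term of
`bucketPot` that counts the blocks on disk, and a refill by `fillUp_spec`. -/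
theorem deleteHead_spec (hP : P.Ok) (hD : min i P.r ≤ D) {b : Bucket α} (hb : b.OK P i)
    {e : α × ℕ} {es : List (α × ℕ)} (he : b.mem = e :: es) :
    (∀ c, (b.deleteHead P i).1 = some c → c.OK P i ∧ c.mem ≠ []) ∧
    optRoots (b.deleteHead P i).1 ≤ b.roots.length ∧
    e.1 ::ₘ optCont (b.deleteHead P i).1 = b.cont ∧
    (P.B : ℝ) * (b.deleteHead P i).2 + optPot P D i (b.deleteHead P i).1 ≤
      bucketPot P D i b := by
  have hwt : (0 : ℝ) ≤ (if i ≤ P.r then elemWeight D (i + 1) else 0) := by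
    split_ifs
    · exact elemWeight_nonneg
    · exact le_rfl
  have hsize := hb.size_le
  have hpos := hb.pos_lt
  have hsorted := hb.sorted
  have hle := hb.le_roots
  rw [he] at hsize hpos hsorted hle
  unfold Bucket.deleteHead
  rw [he, List.tail_cons]
  by_cases h1 : es = []
  · subst h1
    simp only [List.isEmpty_nil, Bool.not_true, Bool.false_eq_true, if_false, List.cons_append,
      List.nil_append] at *
    by_cases h2 : b.disk = []
    · simp only [h2, List.isEmpty_nil, Bool.not_true, Bool.false_eq_true, if_false]
      obtain ⟨u1, u2, u3⟩ := fillUp_spec hP hD hb.roots_lt hb.tree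
      refine ⟨fun c hc => ⟨(u1 c hc).1, (u1 c hc).2.1⟩, ?_, ?_, ?_⟩
      · cases ho : (fillUp P i b.roots).1 with
        | none => exact Nat.zero_le _
        | some c => exact (u1 c ho).2.2
      · rw [u2, Bucket.cont_eq, he, h2]
        simp
      · exact u3.trans (rootsPot_le_bucketPot b)
    · have h3 : b.disk.isEmpty = false := by simpa using h2
      simp only [h3, Bool.not_false, if_true]
      refine ⟨?_, le_rfl, ?_, ?_⟩
      · intro c hc
        obtain rfl := Option.some.inj hc
        refine ⟨mkBucket_OK hP hb.roots_ne hb.roots_lt hb.tree ?_ ?_ ?_ ?_, mkBucket_mem_ne hP h2⟩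
        · simp only [List.length_cons] at hsize; omega
        · exact fun x hx => hpos x (List.mem_cons_of_mem _ hx)
        · intro hi
          have := hsorted hi
          rw [List.map_cons, List.pairwise_cons] at this
          exact this.2
        · exact fun hi a ha => hle hi a (by rw [List.map_cons]; exact List.mem_cons_of_mem _ ha)
      · simp only [optCont, Option.map_some, Option.getD_some]
        rw [Bucket.cont_eq, mkBucket_append, Bucket.cont_eq, he, List.cons_append, List.map_cons,
          ← Multiset.cons_coe, Multiset.cons_add]
        rfl
      · simp only [optPot, Option.map_some, Option.getD_some]
        rw [bucketPot_mkBucket, bucketPot, he]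
        have hB := hP.one_le_B
        have hd := List.length_pos_of_ne_nil h2
        -- Loading a block lowers the number of blocks that still have to be loaded by one.
        have key : ((b.disk.drop P.B).length + P.B - 1) / P.B + 1 ≤
            (b.disk.length + P.B - 1) / P.B := by
          rw [List.length_drop, ← Nat.add_div_right _ (by omega : 0 < P.B)]
          rcases le_total b.disk.length P.B with h | h
          · rw [Nat.sub_eq_zero_of_le h, zero_add, show P.B - 1 + P.B = P.B - 1 + 1 * P.B by ring,
              Nat.add_mul_div_right _ _ (by omega : 0 < P.B),
              Nat.div_eq_of_lt (by omega : P.B - 1 < P.B), Nat.le_div_iff_mul_le (by omega)]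
            omega
          · exact Nat.div_le_div_right (by omega)
        have key' : (P.B : ℝ) * ((((b.disk.drop P.B).length + P.B - 1) / P.B : ℕ) + 1) ≤
            P.B * ((b.disk.length + P.B - 1) / P.B : ℕ) := by
          gcongr
          exact_mod_cast key
        simp only [List.cons_append, List.nil_append, List.length_cons]
        push_cast at key' ⊢
        linarith
  · have h3 : es.isEmpty = false := by simpa using h1
    simp only [h3, Bool.not_false, if_true]
    refine ⟨?_, le_rfl, ?_, ?_⟩
    · intro c hc
      obtain rfl := Option.some.inj hc
      refine ⟨⟨hb.roots_ne, hb.roots_lt, hb.tree, fun h => absurd h h1, ?_, ?_, ?_, ?_⟩, h1⟩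
      · simp only [List.cons_append, List.length_cons] at hsize ⊢; omega
      · exact fun x hx => hpos x (List.mem_cons_of_mem _ hx)
      · intro hi
        have := hsorted hi
        rw [List.cons_append, List.map_cons, List.pairwise_cons] at this
        exact this.2
      · exact fun hi a ha => hle hi a
          (by rw [List.cons_append, List.map_cons]; exact List.mem_cons_of_mem _ ha)
    · simp only [optCont, Option.map_some, Option.getD_some]
      rw [Bucket.cont_eq, Bucket.cont_eq, he, List.cons_append, List.map_cons,
        ← Multiset.cons_coe, Multiset.cons_add]
    · simp only [optPot, Option.map_some, Option.getD_some]
      rw [bucketPot, bucketPot, he]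
      simp only [List.cons_append, List.length_cons]
      push_cast
      linarith

/-- Deleting the first element of one of the buckets of a heap. -/
theorem deleteBucket_spec (hP : P.Ok) {W : ℕ} (hW : ∀ k, P.full * P.q ^ k ≤ W → min k P.r ≤ D)
    {K : ℝ} {H : Heap α} (hH : H.OK P) (hw : H.weight P ≤ W) {b : Bucket α}
    (hi : H.buckets[i]? = some (some b)) :
    Heap.OK P ⟨H.buffer, H.buckets.set i (b.deleteHead P i).1⟩ ∧
    Heap.weight P ⟨H.buffer, H.buckets.set i (b.deleteHead P i).1⟩ ≤ H.weight P ∧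
    ((b.mem.head?.map Prod.fst).toList : Multiset α) +
      Heap.contents ⟨H.buffer, H.buckets.set i (b.deleteHead P i).1⟩ = H.contents ∧
    (P.B : ℝ) * (b.deleteHead P i).2 +
      Heap.pot P D K ⟨H.buffer, H.buckets.set i (b.deleteHead P i).1⟩ ≤ H.pot P D K := by
  have hi' := getD_eq_some.2 hi
  have hb := hH.buckets i b hi'
  obtain ⟨e, es, he⟩ := List.exists_cons_of_ne_nil (hH.mem_ne i b hi')
  have hD : min i P.r ≤ D := by
    refine hW i (le_trans ?_ hw)
    have h1 := rankSum_weight_le (P := P) (i := 0) hi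
    rw [zero_add] at h1
    refine le_trans ?_ (h1.trans (Nat.le_add_left _ _))
    exact Nat.le_mul_of_pos_right _ (List.length_pos_of_ne_nil hb.roots_ne)
  obtain ⟨d1, d2, d3, d4⟩ := deleteHead_spec (D := D) hP hD hb he
  generalize b.deleteHead P i = t at *
  have hset : ∀ k c, (H.buckets.set i t.1).getD k none = some c → c.OK P k ∧ c.mem ≠ [] := by
    intro k c hc
    rw [getD_eq_some, List.getElem?_set] at hc
    split_ifs at hc with h1 h2
    · subst h1
      exact d1 c (Option.some.inj hc)
    · have := getD_eq_some.2 hc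
      exact ⟨hH.buckets k c this, hH.mem_ne k c this⟩
  refine ⟨⟨hH.buffer_sorted, hH.buffer_lt, fun k c hc => (hset k c hc).1,
    fun k c hc => (hset k c hc).2⟩, ?_, ?_, ?_⟩
  · have h1 := rankSum_set (g := bucketWeight P) (i := 0) (o' := t.1) hi
    have h2 : bucketWeight P (0 + i) t.1 ≤ bucketWeight P (0 + i) (some b) :=
      Nat.mul_le_mul_left _ d2
    simp only [Heap.weight]
    omega
  · have h1 := rankSum_set (g := fun _ => optCont) (i := 0) (o' := t.1) hi
    have h2 : optCont (some b) = e.1 ::ₘ optCont t.1 := d3.symm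
    rw [h2, ← Multiset.singleton_add, ← add_assoc] at h1
    have h3 := add_right_cancel h1
    rw [Heap.contents_eq, Heap.contents_eq, he, ← h3]
    simp only [List.head?_cons, Option.map_some, Option.toList_some, Multiset.coe_singleton]
    abel
  · have h1 := rankSum_set (g := optPot P D) (i := 0) (o' := t.1) hi
    have h2 : optPot P D (0 + i) (some b) = bucketPot P D i b := by rw [zero_add]; rfl
    rw [h2, zero_add] at h1
    simp only [Heap.pot]
    linarith

theorem deletemin_spec (hP : P.Ok) {W : ℕ} (hW : ∀ k, P.full * P.q ^ k ≤ W → min k P.r ≤ D)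
    {K : ℝ} (hK : 0 ≤ K) {H : Heap α} (hH : H.OK P) (hw : H.weight P ≤ W) :
    (deletemin P H).2.1.OK P ∧ (deletemin P H).2.1.weight P ≤ H.weight P ∧
    ((deletemin P H).1.toList : Multiset α) + (deletemin P H).2.1.contents = H.contents ∧
    (P.B : ℝ) * (deletemin P H).2.2 + (deletemin P H).2.1.pot P D K ≤ H.pot P D K := by
  have buf_case : ∀ buf, H.buffer = buf →
      Heap.OK P ⟨buf.tail, H.buckets⟩ ∧ Heap.weight P ⟨buf.tail, H.buckets⟩ ≤ H.weight P ∧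
      (buf.head?.toList : Multiset α) + Heap.contents ⟨buf.tail, H.buckets⟩ = H.contents ∧
      (P.B : ℝ) * (0 : ℕ) + Heap.pot P D K ⟨buf.tail, H.buckets⟩ ≤ H.pot P D K := by
    rintro buf rfl
    have hlt := hH.buffer_lt
    have hlen : H.buffer.tail.length ≤ H.buffer.length := by simp
    refine ⟨⟨hH.buffer_sorted.sublist (List.tail_sublist _), by simp only; omega, hH.buckets,
      hH.mem_ne⟩, ?_, ?_, ?_⟩
    · simp only [Heap.weight]; omega
    · rw [Heap.contents_eq, Heap.contents_eq]
      cases H.buffer with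
      | nil => simp
      | cons a as => simp [← Multiset.cons_coe]
    · have : (H.buffer.tail.length : ℝ) * K ≤ H.buffer.length * K := by gcongr
      simp only [Heap.pot, Nat.cast_zero, mul_zero]
      linarith
  unfold deletemin
  split
  · rename_i hn
    exact buf_case _ rfl
  · rename_i j b hs hbuf
    obtain ⟨k, rfl, h1, -⟩ := minBucket_eq_some hs
    rw [zero_add] at *
    have := deleteBucket_spec hP hW (K := K) hH hw h1
    rwa [hbuf] at this
  · rename_i j b e buf hs hbuf
    obtain ⟨k, rfl, h1, -⟩ := minBucket_eq_some hs
    rw [zero_add] at *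
    split_ifs with hlt
    · exact buf_case _ hbuf
    · have := deleteBucket_spec hP hW (K := K) hH hw h1
      rwa [hbuf] at this

theorem findmin_fst (H : Heap α) : (findmin P H).1 = (deletemin P H).1 := by
  unfold findmin deletemin
  split
  · rfl
  · rfl
  · split_ifs <;> rfl

theorem findmin_snd (H : Heap α) : (findmin P H).2 = 0 := by
  unfold findmin
  split
  · rfl
  · rfl
  · split_ifs <;> rfl

/-! ### Exactness -/

/-- As long as all trees consist of pnodes, Deletemin returns a smallest element. -/
theorem deletemin_isMinOf {H : Heap α} (hH : H.OK P)
    (hr : ∀ i b, H.buckets[i]? = some (some b) → i ≤ P.r) :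
    IsMinOf H.contents (deletemin P H).1 := by
  -- The first element of a bucket is the least of the bucket and its trees.
  have head_le : ∀ (i : ℕ) (b : Bucket α), H.buckets[i]? = some (some b) → ∃ e es, b.mem = e :: es ∧
      b.minkey P i = e.1 ∧ e.1 ∈ b.cont ∧ ∀ a ∈ b.cont, e.1 ≤ a := by
    intro i b hi
    have hi' := getD_eq_some.2 hi
    have hir := hr i b hi
    have hb := hH.buckets i b hi'
    obtain ⟨e, es, he⟩ := List.exists_cons_of_ne_nil (hH.mem_ne i b hi')
    have hsorted := hb.sorted hir
    have hle := hb.le_roots hir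
    rw [he] at hsorted hle
    simp only [List.cons_append, List.map_cons, List.pairwise_cons] at hsorted hle
    refine ⟨e, es, he, by simp [Bucket.minkey, he, hir], ?_, ?_⟩
    · rw [Bucket.cont_eq, he]; simp
    · intro a ha
      rw [Bucket.cont_eq, he, Multiset.mem_add, mem_contAll] at ha
      simp only [List.cons_append, List.map_cons, Multiset.mem_coe, List.mem_cons] at ha
      rcases ha with (rfl | ha) | ha
      · exact le_rfl
      · exact hsorted.1 a ha
      · exact hle e.1 List.mem_cons_self a ha
  have mem_iff : ∀ a, a ∈ H.contents ↔ a ∈ H.buffer ∨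
      ∃ (k : ℕ) (b : Bucket α), H.buckets[k]? = some (some b) ∧ a ∈ b.cont := by
    intro a
    rw [Heap.contents_eq, Multiset.mem_add, mem_rankSum_cont, Multiset.mem_coe]
  have hsort := hH.buffer_sorted
  unfold deletemin
  split
  · rename_i hn
    have hno := minBucket_eq_none hn
    cases hbuf : H.buffer with
    | nil =>
      refine .inl ⟨by simp, Multiset.eq_zero_of_forall_notMem fun a ha => ?_⟩
      rcases (mem_iff a).1 ha with h | ⟨k, b, h, _⟩
      · simp [hbuf] at h
      · exact hno k b h
    | cons c cs =>
      rw [hbuf, List.pairwise_cons] at hsort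
      refine .inr ⟨c, by simp, (mem_iff c).2 (.inl (by simp [hbuf])), fun a ha => ?_⟩
      rcases (mem_iff a).1 ha with h | ⟨k, b, h, _⟩
      · rw [hbuf] at h
        rcases List.mem_cons.1 h with rfl | h
        · exact le_rfl
        · exact hsort.1 a h
      · exact absurd h (hno k b)
  · rename_i j b hs hbuf
    obtain ⟨k, rfl, h1, h2⟩ := minBucket_eq_some hs
    rw [zero_add] at *
    obtain ⟨e, es, he, e1, e2, e3⟩ := head_le k b h1
    refine .inr ⟨e.1, by simp [he], (mem_iff _).2 (.inr ⟨k, b, h1, e2⟩), fun a ha => ?_⟩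
    rcases (mem_iff a).1 ha with h | ⟨k', b', h, h'⟩
    · simp [hbuf] at h
    · obtain ⟨e', es', he', e1', e2', e3'⟩ := head_le k' b' h
      have := h2 k' b' h
      rw [zero_add, e1, e1', WithBot.coe_le_coe] at this
      exact this.trans (e3' a h')
  · rename_i j b c cs hs hbuf
    obtain ⟨k, rfl, h1, h2⟩ := minBucket_eq_some hs
    rw [zero_add] at *
    obtain ⟨e, es, he, e1, e2, e3⟩ := head_le k b h1
    have hle : ∀ a, (∃ (k : ℕ) (b : Bucket α), H.buckets[k]? = some (some b) ∧ a ∈ b.cont) →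
        e.1 ≤ a := by
      rintro a ⟨k', b', h, h'⟩
      obtain ⟨e', es', he', e1', e2', e3'⟩ := head_le k' b' h
      have := h2 k' b' h
      rw [zero_add, e1, e1', WithBot.coe_le_coe] at this
      exact this.trans (e3' a h')
    rw [hbuf, List.pairwise_cons] at hsort
    have hbufle : ∀ a ∈ H.buffer, c ≤ a := by
      intro a h
      rw [hbuf] at h
      rcases List.mem_cons.1 h with rfl | h
      · exact le_rfl
      · exact hsort.1 a h
    rw [e1]
    split_ifs with hlt
    · rw [WithBot.coe_lt_coe] at hlt
      refine .inr ⟨c, rfl, (mem_iff c).2 (.inl (by simp [hbuf])), fun a ha => ?_⟩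
      rcases (mem_iff a).1 ha with h | h
      · exact hbufle a h
      · exact hlt.le.trans (hle a h)
    · rw [WithBot.coe_lt_coe, not_lt] at hlt
      refine .inr ⟨e.1, by simp [he], (mem_iff _).2 (.inr ⟨k, b, h1, e2⟩), fun a ha => ?_⟩
      rcases (mem_iff a).1 ha with h | h
      · exact hlt.trans (hbufle a h)
      · exact hle a h

theorem Node.corrupt_eq (x : Node α) : x.corrupt =
    x.lists.flatten.filter (fun a : α => decide ((a : WithBot α) < x.ckey)) ++
      corruptAll x.kids := by
  cases x; simp [Node.corrupt]

theorem corruptAll_eq_nil {xs : List (Node α)} (h : ∀ x ∈ xs, x.corrupt = []) :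
    corruptAll xs = [] := by
  induction xs with
  | nil => simp [corruptAll]
  | cons x xs ih =>
    simp [corruptAll, h x List.mem_cons_self, ih fun y hy => h y (List.mem_cons_of_mem _ hy)]

theorem Tree.corrupt_eq_nil {k : ℕ} (hk : k ≤ P.r) {x : Node α} (hx : Tree P k x) :
    x.corrupt = [] := by
  have hl : x.lists = [] := hx.shape.lists_eq (hx.rank_eq.symm ▸ hk)
  rw [Node.corrupt_eq, hl]
  induction k generalizing x with
  | zero => simp [hx.2.1, corruptAll]
  | succ k ih =>
    rw [corruptAll_eq_nil fun y hy => ?_]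
    · simp
    · have hy' := (hx.2.2.1 y hy).1
      have hl' : y.lists = [] := hy'.shape.lists_eq (hy'.rank_eq.symm ▸ by omega)
      rw [Node.corrupt_eq, hl']
      exact ih (by omega) hy' hl'

theorem corrupt_eq_zero {H : Heap α} (hH : H.OK P)
    (hr : ∀ i b, H.buckets[i]? = some (some b) → i ≤ P.r) : H.corrupt P = 0 := by
  rw [Heap.corrupt, Multiset.coe_eq_zero, List.flatten_eq_nil_iff]
  intro l hl
  obtain ⟨i, hi, rfl⟩ := List.mem_mapIdx.1 hl
  cases hb : H.buckets[i] with
  | none => rfl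
  | some b =>
    have h1 : H.buckets[i]? = some (some b) := by rw [List.getElem?_eq_getElem hi, hb]
    have hir := hr i b h1
    have hb' := hH.buckets i b (getD_eq_some.2 h1)
    simp only [Option.map_some, Option.getD_some, Bucket.corrupt, hir, if_true, List.nil_append]
    exact corruptAll_eq_nil fun x hx => (hb'.tree x hx).corrupt_eq_nil hir

end

section

variable {α : Type u} [LinearOrder α] {P : Params}

/-! ### Reachable heaps -/

theorem Reach.spec (hP : P.Ok) {n : ℕ} {H : Heap α} (h : Reach P n H) :
    H.OK P ∧ H.weight P ≤ n := by
  have hW : ∀ W k, P.full * P.q ^ k ≤ W → min k P.r ≤ P.r := fun _ _ _ => min_le_right _ _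
  induction h with
  | empty =>
    have hfull : 0 < P.full := by have := hP.two_mul_B_le_full; have := hP.one_le_B; omega
    refine ⟨⟨.nil, hfull, fun i b hb => ?_, fun i b hb => ?_⟩,
      by simp [Heap.empty, Heap.weight, rankSum]⟩
    all_goals simp [Heap.empty] at hb
  | @insert n H a _ ih =>
    have := insert_spec hP (hW _) (fun _ => le_rfl) a ih.1 le_rfl
    exact ⟨this.1, this.2.1.trans (by omega)⟩
  | @deletemin n H _ ih =>
    have := deletemin_spec hP (hW _) le_rfl ih.1 le_rfl
    exact ⟨this.1, this.2.1.trans ih.2⟩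
  | @meld n₁ n₂ H₁ H₂ _ _ ih₁ ih₂ =>
    have := meld_spec hP (hW _) (fun _ => le_rfl) ih₁.1.buffer_sorted ih₂.1.buffer_sorted
      ih₁.1.buffer_lt ih₂.1.buffer_lt ih₁.1.buckets ih₂.1.buckets le_rfl
    exact ⟨this.1, this.2.1.trans (by omega)⟩

/-- The amortised cost of Insert is the potential of an element of the buffer. Buckets only
exist if the buffer can get full, so that otherwise this potential may be zero. -/
theorem amortisedCosts_of (hP : P.Ok) {N : ℕ∞} {D : ℕ} {K c : ℝ}
    (hD : ∀ k, ((P.full * P.q ^ k : ℕ) : ℕ∞) ≤ N → min k P.r ≤ D) (hK0 : 0 ≤ K)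
    (hK : (P.full : ℕ∞) ≤ N → 240 * D + 2000 ≤ K) (hc : K / P.B ≤ c) :
    AmortisedCosts α P N c := by
  have hB : (0 : ℝ) < P.B := by exact_mod_cast hP.one_le_B
  have hD' : ∀ W : ℕ, (W : ℕ∞) ≤ N → ∀ k, P.full * P.q ^ k ≤ W → min k P.r ≤ D :=
    fun W hW k hk => hD k (le_trans (by exact_mod_cast hk) hW)
  have hK' : ∀ W : ℕ, (W : ℕ∞) ≤ N → P.full ≤ W → 240 * D + 2000 ≤ K :=
    fun W hW hk => hK (le_trans (by exact_mod_cast hk) hW)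
  refine ⟨fun H => H.pot P D K / P.B, ?_, ?_, ?_, ?_, ?_, ?_⟩
  · simp [Heap.empty, Heap.pot, rankSum]
  · intro n H _ _
    have : 0 ≤ rankSum (optPot P D) 0 H.buckets := rankSum_nonneg (fun _ => optPot_nonneg) _ _
    have : 0 ≤ H.pot P D K := add_nonneg (by positivity) this
    positivity
  · intro n H a h hn
    obtain ⟨h1, h2⟩ := h.spec hP
    obtain ⟨-, -, -, h3⟩ := insert_spec hP (hD' _ hn) (hK' _ hn) a h1 (by omega)
    refine le_trans ?_ hc
    rw [← sub_div, ← le_sub_iff_add_le, ← sub_div, le_div_iff₀ hB]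
    linarith
  · intro n H _ _
    simp [findmin_snd]
  · intro n H h hn
    obtain ⟨h1, h2⟩ := h.spec hP
    obtain ⟨-, -, -, h3⟩ := deletemin_spec hP (hD' _ hn) hK0 h1 h2
    rw [← sub_div, ← le_sub_iff_add_le, zero_sub, ← neg_div, le_div_iff₀ hB]
    linarith
  · intro n₁ n₂ H₁ H₂ h₁ h₂ hn
    obtain ⟨a1, a2⟩ := h₁.spec hP
    obtain ⟨b1, b2⟩ := h₂.spec hP
    obtain ⟨-, -, -, h3⟩ := meld_spec hP (hD' _ hn) (hK' _ hn) a1.buffer_sorted b1.buffer_sorted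
      a1.buffer_lt b1.buffer_lt a1.buckets b1.buckets (by omega)
    rw [← add_div, ← sub_div, ← le_sub_iff_add_le, zero_sub, ← neg_div, le_div_iff₀ hB]
    linarith

/-- A heap is exact if it has too few elements for a tree that does not consist of pnodes. -/
theorem exactPriorityQueue_of (hP : P.Ok) {N : ℕ} (hN : ∀ k, P.full * P.q ^ k ≤ N → k ≤ P.r) :
    ExactPriorityQueue α P N := by
  have hW : ∀ W k, P.full * P.q ^ k ≤ W → min k P.r ≤ P.r := fun _ _ _ => min_le_right _ _
  have hr : ∀ {n : ℕ} {H : Heap α}, Reach P n H → n ≤ N →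
      ∀ (i : ℕ) (b : Bucket α), H.buckets[i]? = some (some b) → i ≤ P.r := by
    intro n H h hn i b hb
    obtain ⟨h1, h2⟩ := h.spec hP
    refine hN i ?_
    have h3 := rankSum_weight_le (P := P) (i := 0) hb
    rw [zero_add] at h3
    have h4 : P.full * P.q ^ i ≤ bucketWeight P i (some b) :=
      Nat.le_mul_of_pos_right _
        (List.length_pos_of_ne_nil (h1.buckets i b (getD_eq_some.2 hb)).roots_ne)
    unfold Heap.weight at h2
    omega
  refine ⟨rfl, ?_, ?_, ?_, ?_, ?_⟩
  · exact fun n H h hn => corrupt_eq_zero (h.spec hP).1 (hr h hn)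
  · exact fun n H a h _ => (insert_spec hP (hW _) (fun _ => le_rfl) a (h.spec hP).1 le_rfl).2.2.1
  · intro n H h hn
    rw [findmin_fst]
    exact deletemin_isMinOf (h.spec hP).1 (hr h hn)
  · intro n H h hn
    refine ⟨deletemin_isMinOf (h.spec hP).1 (hr h hn), ?_⟩
    rw [← (deletemin_spec hP (hW _) le_rfl (h.spec hP).1 le_rfl).2.2.1, add_tsub_cancel_left]
  · intro n₁ n₂ H₁ H₂ h₁ h₂ _
    have a := (h₁.spec hP).1
    have b := (h₂.spec hP).1
    exact (meld_spec hP (hW _) (fun _ => le_rfl) a.buffer_sorted b.buffer_sorted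
      a.buffer_lt b.buffer_lt a.buckets b.buckets le_rfl).2.2.1

/-! ### The parameters -/

theorem params_ok {M B : ℕ} (ε : ℝ) (hB : 1 ≤ B) (hM : 4 * B ≤ M) : (params M B ε).Ok := by
  refine ⟨hB, ?_⟩
  change 2 ≤ Nat.sqrt (M / B)
  rw [Nat.le_sqrt, Nat.le_div_iff_mul_le hB]
  omega

/-- Logarithms to the bases `⌊√m⌋` and `m` differ by a factor of at most `4`, because
`m ≤ ⌊√m⌋ ^ 4`. -/
theorem le_four_mul_logb {M B k : ℕ} {x : ℝ} (hB : 1 ≤ B) (hM : 4 * B ≤ M)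
    (hx : ((Nat.sqrt (M / B) : ℕ) : ℝ) ^ k ≤ x) : (k : ℝ) ≤ 4 * Real.logb ((M : ℝ) / B) x := by
  have hq : 2 ≤ Nat.sqrt (M / B) := (params_ok 1 hB hM).two_le_q
  have hlt := Nat.lt_succ_sqrt (M / B)
  generalize Nat.sqrt (M / B) = q at *
  have hB' : (0 : ℝ) < B := by exact_mod_cast hB
  have hm : (4 : ℝ) ≤ M / B := by
    rw [le_div_iff₀ hB']
    exact_mod_cast hM
  have hm4 : (M : ℝ) / B ≤ (q : ℝ) ^ 4 := by
    rw [div_le_iff₀ hB']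
    have h1 : M < (M / B + 1) * B := by
      rw [mul_comm]; exact Nat.lt_mul_div_succ M hB
    have h2 : M / B + 1 ≤ q ^ 4 := by
      have : (q + 1) * (q + 1) ≤ q ^ 2 * q ^ 2 := Nat.mul_le_mul (by nlinarith) (by nlinarith)
      calc M / B + 1 ≤ (q + 1) * (q + 1) := hlt
        _ ≤ q ^ 4 := by rw [← pow_add] at this; exact this
    exact_mod_cast h1.le.trans (Nat.mul_le_mul_right _ h2)
  have hq0 : (0 : ℝ) < q := by positivity
  have hlogm : 0 < Real.log ((M : ℝ) / B) := Real.log_pos (by linarith)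
  have h1 : Real.log ((M : ℝ) / B) ≤ 4 * Real.log q := by
    have := Real.log_le_log (by linarith) hm4
    rwa [Real.log_pow] at this
  have h2 : (k : ℝ) * Real.log q ≤ Real.log x := by
    have := Real.log_le_log (by positivity) hx
    rwa [Real.log_pow] at this
  rw [Real.logb, ← mul_div_assoc, le_div_iff₀ hlogm]
  have : (k : ℝ) * Real.log ((M : ℝ) / B) ≤ k * (4 * Real.log q) := by gcongr
  linarith

end

end EMSH

theorem mainTheorem3 :
    ∃ C : ℝ, 0 < C ∧
      ∀ (α : Type u) [LinearOrder α] (M B : ℕ) (ε : ℝ), 1 ≤ B → 4 * B ≤ M → 0 < ε → ε ≤ 1 →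
        EMSH.AmortisedCosts α (EMSH.params M B ε) ⊤
          (C * (1 / (B : ℝ)) * max 1 (Real.logb ((M : ℝ) / B) (1 / ε))) ∧
        ∀ N : ℕ, ε < 1 / (N : ℝ) →
          EMSH.ExactPriorityQueue α (EMSH.params M B ε) N ∧
          (B ≤ N →
            EMSH.AmortisedCosts α (EMSH.params M B ε) N
              (C * (1 / (B : ℝ)) * Real.logb ((M : ℝ) / B) ((N : ℝ) / B))) := by
  refine ⟨8000, by norm_num, ?_⟩
  intro α _ M B ε hB hM hε hε1
  have hP := EMSH.params_ok ε hB hM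
  have hq : 2 ≤ Nat.sqrt (M / B) := hP.two_le_q
  have hq1 : (1 : ℝ) < ((Nat.sqrt (M / B) : ℕ) : ℝ) := by exact_mod_cast hq
  have hB' : (0 : ℝ) < B := by exact_mod_cast hB
  have hm : (1 : ℝ) < M / B := by
    rw [lt_div_iff₀ hB', one_mul]
    exact_mod_cast (by omega : B < M)
  have hε' : 1 ≤ 1 / ε := (one_le_div hε).2 hε1
  refine ⟨?_, fun N hN => ⟨?_, fun hBN => ?_⟩⟩
  · refine EMSH.amortisedCosts_of (D := (EMSH.params M B ε).r)
      (K := 240 * (EMSH.params M B ε).r + 2000) hP (fun _ _ => min_le_right _ _) (by positivity)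
      (fun _ => le_rfl) ?_
    have hr : ((Nat.sqrt (M / B) : ℕ) : ℝ) ^ (EMSH.params M B ε).r ≤ 1 / ε := by
      rw [← Real.rpow_natCast, ← Real.le_logb_iff_rpow_le hq1 (by linarith)]
      exact Nat.floor_le (Real.logb_nonneg hq1 hε')
    have h1 := EMSH.le_four_mul_logb hB hM hr
    have h2 := le_max_left 1 (Real.logb ((M : ℝ) / B) (1 / ε))
    have h3 := le_max_right 1 (Real.logb ((M : ℝ) / B) (1 / ε))
    rw [mul_one_div, div_mul_eq_mul_div]
    change _ / (B : ℝ) ≤ _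
    gcongr
    linarith
  · refine EMSH.exactPriorityQueue_of hP fun k hk => ?_
    have hqk : Nat.sqrt (M / B) ^ k ≤ N := by
      refine le_trans (Nat.le_mul_of_pos_left _ ?_) hk
      have := hP.two_mul_B_le_full
      have := hP.one_le_B
      omega
    have hN0 : 0 < N := lt_of_lt_of_le (by positivity) hqk
    have hN' : (N : ℝ) ≤ 1 / ε := by
      rw [le_div_iff₀ hε]
      rw [lt_div_iff₀ (by exact_mod_cast hN0)] at hN
      linarith
    refine Nat.le_floor ?_
    rw [Real.le_logb_iff_rpow_le hq1 (by linarith), Real.rpow_natCast]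
    refine le_trans ?_ hN'
    exact_mod_cast hqk
  · have hNB : (1 : ℝ) ≤ N / B := by
      rw [le_div_iff₀ hB', one_mul]
      exact_mod_cast hBN
    have hlog : 0 ≤ Real.logb ((M : ℝ) / B) (N / B) := Real.logb_nonneg hm hNB
    -- The largest rank of a tree with at most `N` elements.
    set D := Nat.log (Nat.sqrt (M / B)) (N / B) - 1 with hDdef
    have hNB0 : N / B ≠ 0 := (Nat.div_pos hBN hB).ne'
    have hpow : ∀ k, B * Nat.sqrt (M / B) * Nat.sqrt (M / B) ^ k ≤ N →
        k + 1 ≤ Nat.log (Nat.sqrt (M / B)) (N / B) := by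
      intro k hk
      rw [Nat.le_log_iff_pow_le hq hNB0, Nat.le_div_iff_mul_le hB, pow_succ]
      calc _ = B * Nat.sqrt (M / B) * Nat.sqrt (M / B) ^ k := by ring
        _ ≤ N := hk
    refine EMSH.amortisedCosts_of (D := D)
      (K := if (EMSH.params M B ε).full ≤ N then 240 * D + 2000 else 0) hP ?_ ?_ ?_ ?_
    · intro k hk
      have := hpow k (by exact_mod_cast hk)
      omega
    · split_ifs <;> positivity
    · intro h
      rw [if_pos (by exact_mod_cast h)]
    · rw [mul_one_div, div_mul_eq_mul_div]
      change _ / (B : ℝ) ≤ _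
      gcongr
      split_ifs with hfull
      · have h1 := hpow 0 (by rw [pow_zero, mul_one]; exact hfull)
        have h2 : ((Nat.sqrt (M / B) : ℕ) : ℝ) ^ (D + 1) ≤ N / B := by
          rw [hDdef, Nat.sub_add_cancel (by omega)]
          refine le_trans ?_ (Nat.cast_div_le (α := ℝ))
          exact_mod_cast Nat.pow_log_le_self _ hNB0
        have h3 := EMSH.le_four_mul_logb hB hM h2
        push_cast at h3
        have : (0 : ℝ) ≤ D := Nat.cast_nonneg _
        linarith
      · linarith
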